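/- Let $d\ge 1$, $0<\alpha<2$, $0<\mu_-\le\mu_+<\infty$, and let $\mu\in L_\infty(\mathbb R^d\times\mathbb R^d)$ be real-valued with $\mu_-\le\mu(\mathbf x,\mathbf y)\le\mu_+$, $\mu(\mathbf x,\mathbf y)=\mu(\mathbf y,\mathbf x)$ and $\mu(\mathbf x+\mathbf m,\mathbf y+\mathbf n)=\mu(\mathbf x,\mathbf y)$ for all $\mathbf m,\mathbf n\in\mathbb Z^d$ (almost everywhere in $(\mathbf x,\mathbf y)$). Let $\Omega=[0,1)^d$, and let $\widetilde H^{\alpha/2}(\Omega)$ be the space of functions in $H^{\alpha/2}(\Omega)$ whose $\mathbb Z^d$-periodic extension belongs to $H^{\alpha/2}_{\mathrm{loc}}(\mathbb R^d)$; such functions are identified with their periodic extensions. For $\boldsymbol\xi\in\mathbb R^d$ let $\mathbb A(\boldsymbol\xi)$ be the self-adjoint operator in $L_2(\Omega)$ that corresponds to the closed quadratic form $$a(\boldsymbol\xi)[u,u]=\frac12\int_{\mathbb R^d}d\mathbf y\int_\Omega d\mathbf x\,\mu(\mathbf x,\mathbf y)\,\frac{|e^{i\langle\boldsymbol\xi,\mathbf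 x\rangle}u(\mathbf x)-e^{i\langle\boldsymbol\xi,\mathbf y\rangle}u(\mathbf y)|^2}{|\mathbf x-\mathbf y|^{d+\alpha}},\qquad u\in\widetilde H^{\alpha/2}(\Omega).$$ Put $$c_0(d,\alpha)=\int_{\mathbb R^d}\frac{1-\cos z_1}{|\mathbf z|^{d+\alpha}}\,d\mathbf z,\quad V_\alpha(\boldsymbol\xi)=\int_{\mathbb R^d}\frac{1-\cos\langle\boldsymbol\xi,\mathbf z\rangle}{|\mathbf z|^{d+\alpha}}\,d\mathbf z,\quad \mu^0=\int_\Omega\int_\Omega\mu(\mathbf x,\mathbf y)\,d\mathbf x\,d\mathbf y,$$ $$d_0=\mu_-\,c_0(d,\alpha)\,\pi^\alpha,\qquad \delta_0=\pi\Bigl(\frac{\mu_-}{3\mu_+}\Bigr)^{1/\alpha}.$$ Let $F(\boldsymbol\xi)$ be the spectral projection of $\mathbb A(\boldsymbol\xi)$ for the interval $[0,d_0/3]$, and let $P$ be the orthogonal projection of $L_2(\Omega)$ onto the span of the constant function $\mathbf 1_\Omega$. Then there is a constant $C>0$, depending only on $d,\alpha,\mu_-,\mu_+$, such that for all $\boldsymbol\xi$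 with $|\boldsymbol\xi|\le\delta_0$ the operator $\mathbb A(\boldsymbol\xi)F(\boldsymbol\xi)$ is defined on all of $L_2(\Omega)$ and $$\bigl\|\mathbb A(\boldsymbol\xi)F(\boldsymbol\xi)-\mu^0V_\alpha(\boldsymbol\xi)P\bigr\|_{L_2(\Omega)\to L_2(\Omega)}\le C\cdot\begin{cases}|\boldsymbol\xi|^{2\alpha},&0<\alpha<1,\\ |\boldsymbol\xi|^2\,(1+|\ln|\boldsymbol\xi||)^2,&\alpha=1,\\ |\boldsymbol\xi|^2,&1<\alpha<2,\end{cases}$$ where for $\boldsymbol\xi=\mathbf 0$ the right-hand side is understood as $0$. -/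

import Mathlib

open MeasureTheory Set

noncomputable section

namespace LevyType

/-! ### Spectral measures of self-adjoint operators

Unbounded operators in a Hilbert space `H` are represented by their graphs, subsets of `H × H`. -/

/-- A projection-valued Borel measure on the real line with values in a Hilbert space `H`. -/
structure ProjectionMeasure (H : Type*) [NormedAddCommGroup H] [InnerProductSpace ℂ H]
    [CompleteSpace H] where
  /-- the projection attached to a Borel set (the values on other sets are irrelevant) -/
  proj : Set ℝ → H →L[ℂ] H
  isStarProjection : ∀ s, MeasurableSet s → IsStarProjection (proj s)
  empty : proj ∅ = 0
  univ : proj Set.univ = 1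
  iUnion : ∀ s : ℕ → Set ℝ, (∀ n, MeasurableSet (s n)) → Pairwise (Function.onFun Disjoint s) →
    ∀ u : H, HasSum (fun n => proj (s n) u) (proj (⋃ n, s n) u)

namespace ProjectionMeasure

variable {H : Type*} [NormedAddCommGroup H] [InnerProductSpace ℂ H] [CompleteSpace H]

theorem re_inner_nonneg (E : ProjectionMeasure H) (u : H) (s : Set ℝ) (hs : MeasurableSet s) :
    0 ≤ (inner ℂ u (E.proj s u)).re := by
  have h := E.isStarProjection s hs
  have h1 : E.proj s u = E.proj s (E.proj s u) := by
    have := congrArg (fun T : H →L[ℂ] H => T u) h.isIdempotentElem.eq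
    simpa using this.symm
  have h2 : inner ℂ u (E.proj s (E.proj s u)) = inner ℂ (E.proj s u) (E.proj s u) := by
    rw [← ContinuousLinearMap.adjoint_inner_left, ← ContinuousLinearMap.star_eq_adjoint,
      h.isSelfAdjoint.star_eq]
  rw [h1, h2]
  exact inner_self_nonneg (𝕜 := ℂ)

/-- The finite Borel measure `Δ ↦ (E(Δ) u, u) = ‖E(Δ) u‖²`. -/
def scalarMeasure (E : ProjectionMeasure H) (u : H) : Measure ℝ :=
  Measure.ofMeasurable (fun s _ => ENNReal.ofReal (inner ℂ u (E.proj s u)).re)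
    (by simp [E.empty])
    (by
      intro s hs hd
      have h : HasSum (fun n => (inner ℂ u (E.proj (s n) u)).re)
          (inner ℂ u (E.proj (⋃ n, s n) u)).re :=
        (E.iUnion s hs hd u).mapL (Complex.reCLM ∘L ((innerSL ℂ u).restrictScalars ℝ))
      rw [← h.tsum_eq, ENNReal.ofReal_tsum_of_nonneg
        (fun n => E.re_inner_nonneg u (s n) (hs n)) h.summable])

/-- `E` is the spectral measure of the operator `A` with graph `T`, that is `A = ∫ t dE(t)`:
the domain of `A` consists of the `u` with `∫ t² d(E(t)u, u) < ∞`, and on it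
`(A u, u) = ∫ t d(E(t)u, u)` and `‖A u‖² = ∫ t² d(E(t)u, u)`. -/
structure IsSpectralMeasureOf (E : ProjectionMeasure H) (T : Set (H × H)) : Prop where
  mem_domain_iff : ∀ u : H,
    (∃ f, (u, f) ∈ T) ↔ ∫⁻ t, ENNReal.ofReal (t ^ 2) ∂(E.scalarMeasure u) < ⊤
  inner_eq : ∀ u f : H, (u, f) ∈ T → inner ℂ u f = ((∫ t, t ∂(E.scalarMeasure u) : ℝ) : ℂ)
  norm_sq_eq : ∀ u f : H, (u, f) ∈ T → ‖f‖ ^ 2 = ∫ t, t ^ 2 ∂(E.scalarMeasure u)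

end ProjectionMeasure

/-! ### The periodicity cell and the space `L₂(Ω)` -/

/-- The space `ℝ^d` with its Euclidean norm. -/
abbrev Space (d : ℕ) : Type := EuclideanSpace ℝ (Fin d)

/-- The cell `Ω = [0,1)^d`. -/
def cell (d : ℕ) : Set (Space d) := {x | ∀ i, x i ∈ Ico (0 : ℝ) 1}

/-- An element of the lattice `ℤ^d`, as a vector of `ℝ^d`. -/
def latticeVec {d : ℕ} (n : Fin d → ℤ) : Space d := WithLp.toLp 2 fun i => (n i : ℝ)

/-- The complex Hilbert space `L₂(Ω)`. -/
abbrev L2Cell (d : ℕ) : Type := Lp ℂ 2 (volume.restrict (cell d))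

instance (d : ℕ) : IsFiniteMeasure (volume.restrict (cell d)) := by
  refine isFiniteMeasure_restrict.2 (ne_of_lt ?_)
  refine Bornology.IsBounded.measure_lt_top ?_
  refine (Metric.isBounded_iff_subset_closedBall (0 : Space d)).2 ⟨√(d : ℝ), fun x hx => ?_⟩
  rw [mem_closedBall_zero_iff, EuclideanSpace.norm_eq]
  refine Real.sqrt_le_sqrt ?_
  calc ∑ i, ‖x i‖ ^ 2 ≤ ∑ _i : Fin d, (1 : ℝ) := by
        refine Finset.sum_le_sum fun i _ => ?_
        have h := hx i
        rw [Real.norm_eq_abs, sq_abs]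
        nlinarith [h.1, h.2]
    _ = d := by simp

/-- The function `1_Ω`, identically one on `Ω`. -/
def oneCell (d : ℕ) : L2Cell d := Lp.const 2 (volume.restrict (cell d)) (1 : ℂ)

/-- The orthogonal projection `P` of `L₂(Ω)` onto the linear span of `1_Ω`. -/
def projOne (d : ℕ) : L2Cell d →L[ℂ] L2Cell d := (ℂ ∙ oneCell d).starProjection

/-- The `ℤ^d`-periodic extension to `ℝ^d` of a function on `Ω`. -/
def periodicExt {d : ℕ} (u : Space d → ℂ) (x : Space d) : ℂ :=
  u (WithLp.toLp 2 fun i => Int.fract (x i))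

/-! ### Sobolev spaces of order `0 < s < 1` -/

/-- Membership in `H^s(O)`, `0 < s < 1`: square integrability and finiteness of the double integral
of `|f(x) - f(y)|² / |x - y|^(d+2s)` over `O × O`. -/
def MemSobolev {d : ℕ} (s : ℝ) (O : Set (Space d)) (f : Space d → ℂ) : Prop :=
  MemLp f 2 (volume.restrict O) ∧
    ∫⁻ p in O ×ˢ O, ENNReal.ofReal
      (‖f p.1 - f p.2‖ ^ 2 / ‖p.1 - p.2‖ ^ ((d : ℝ) + 2 * s)) < ⊤

/-- Membership in `H^s_loc(ℝ^d)`, `0 < s < 1`. -/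
def MemSobolevLoc {d : ℕ} (s : ℝ) (f : Space d → ℂ) : Prop :=
  ∀ R : ℝ, 0 < R → MemSobolev s (Metric.ball 0 R) f

/-- The space of the functions in `H^s(Ω)` whose periodic extension is in `H^s_loc(ℝ^d)`. -/
def periodicSobolev (d : ℕ) (s : ℝ) : Set (L2Cell d) :=
  {u | MemSobolev s (cell d) (u : Space d → ℂ) ∧
    MemSobolevLoc s (periodicExt (u : Space d → ℂ))}

/-! ### The operators `A(ξ)` -/

/-- The assumptions on the coefficient: `μ` is (a representative of) a function in
`L_∞(ℝ^d × ℝ^d)` with values between `μm` and `μp`, symmetric, and `ℤ^d`-periodic in each of its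
two variables. -/
structure IsCoefficient {d : ℕ} (μ : Space d × Space d → ℝ) (μm μp : ℝ) : Prop where
  aestronglyMeasurable : AEStronglyMeasurable μ volume
  bounds : ∀ᵐ p, μm ≤ μ p ∧ μ p ≤ μp
  symm : ∀ᵐ p : Space d × Space d, μ (p.2, p.1) = μ p
  periodic : ∀ m n : Fin d → ℤ, ∀ᵐ p : Space d × Space d,
    μ (p.1 + latticeVec m, p.2 + latticeVec n) = μ p

/-- The difference `e^{i⟨ξ,x⟩} u(x) - e^{i⟨ξ,y⟩} u(y)`, with `u` extended periodically. -/
def twistedDiff {d : ℕ} (ξ : Space d) (u : Space d → ℂ) (p : Space d × Space d) : ℂ :=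
  Complex.exp (Complex.I * (inner ℝ ξ p.1 : ℝ)) * periodicExt u p.1 -
    Complex.exp (Complex.I * (inner ℝ ξ p.2 : ℝ)) * periodicExt u p.2

/-- The sesquilinear form `a(ξ)[u,v]`, linear in `u` and antilinear in `v`; the first variable `x`
runs over `Ω` and the second variable `y` over `ℝ^d`. -/
def form {d : ℕ} (α : ℝ) (μ : Space d × Space d → ℝ) (ξ : Space d) (u v : L2Cell d) : ℂ :=
  (1 / 2 : ℂ) * ∫ p in cell d ×ˢ (Set.univ : Set (Space d)),
    ((μ p / ‖p.1 - p.2‖ ^ ((d : ℝ) + α) : ℝ) : ℂ) *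
      (twistedDiff ξ u p * starRingEnd ℂ (twistedDiff ξ v p))

/-- The graph of the self-adjoint operator `A(ξ)` in `L₂(Ω)` that corresponds to the form `a(ξ)`:
`u` is in the domain of `A(ξ)` and `A(ξ)u = f` if and only if `u` is in the form domain and
`a(ξ)[u,v] = (f,v)` for all `v` in the form domain. Mathlib's inner product is antilinear in its
first argument. -/
def opGraph {d : ℕ} (α : ℝ) (μ : Space d × Space d → ℝ) (ξ : Space d) :
    Set (L2Cell d × L2Cell d) :=
  {q | q.1 ∈ periodicSobolev d (α / 2) ∧
    ∀ v ∈ periodicSobolev d (α / 2), form α μ ξ q.1 v = inner ℂ v q.2}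

/-! ### Constants -/

/-- `c₀(d,α)`, the integral of `(1 - cos z₁) / |z|^(d+α)` over `ℝ^d`. -/
def c0 (d : ℕ) [NeZero d] (α : ℝ) : ℝ :=
  ∫ z : Space d, (1 - Real.cos (z 0)) / ‖z‖ ^ ((d : ℝ) + α)

/-- `V_α(k)`, the integral of `(1 - cos⟨k,z⟩) / |z|^(d+α)` over `ℝ^d`. -/
def V {d : ℕ} (α : ℝ) (k : Space d) : ℝ :=
  ∫ z : Space d, (1 - Real.cos (inner ℝ k z)) / ‖z‖ ^ ((d : ℝ) + α)

/-- `d₀ = μ₋ c₀(d,α) π^α`. -/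
def d0 (d : ℕ) [NeZero d] (α μm : ℝ) : ℝ := μm * c0 d α * Real.pi ^ α

/-- `δ₀ = π (μ₋ / (3 μ₊))^(1/α)`. -/
def delta0 (α μm μp : ℝ) : ℝ := Real.pi * (μm / (3 * μp)) ^ (1 / α)

/-- `μ⁰`, the mean value of the coefficient over `Ω × Ω`. -/
def mean {d : ℕ} (μ : Space d × Space d → ℝ) : ℝ := ∫ p in cell d ×ˢ cell d, μ p

/-- The right-hand side of the estimate, as a function of `r = |ξ|`, without the constant. -/
def rate (α r : ℝ) : ℝ :=
  if α < 1 then r ^ (2 * α)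
  else if α = 1 then r ^ 2 * (1 + |Real.log r|) ^ 2
  else r ^ 2

end LevyType

end

noncomputable section

/-! ### Diagonal operators in a Hilbert basis. -/

namespace HilbertBasis

variable {ι H : Type*} [NormedAddCommGroup H] [InnerProductSpace ℂ H] (b : HilbertBasis ι ℂ H)

/-! Write the form as `‖T u‖²` with `T = formMap α μ ξ`, and let `o` be the constant function, a
unit vector. For fixed z = y - x, Parseval in x turns the form with coefficient one into the
diagonal form Σ V_α(ξ + 2πn)|û(n)|²; hence `‖T u‖²` lies between μ₋ and μ₊ times that sum
(`symbol_le_norm_sq_formMap`, `norm_sq_formMap_le_symbol`). Since V_α(k) = c₀|k|^α tends to infinity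
along the frequencies, A(ξ) has an orthonormal eigenbasis (`exists_eigenbasis`). For |ξ| ≤ δ₀ ≤ π
the form is at least d₀‖v‖² on the complement of `o`, while `‖T o‖²` ≤ d₀/3. So exactly one
eigenvalue l, counted with multiplicity, lies in [0, d₀/3], and F(ξ) is the projection onto its unit
eigenvector φ.

Let ρ be the square root of the rate. If |(T v, T o)| ≤ Cρ(‖T v‖ + ‖v‖) for all v, then φ differs
from a multiple of `o` by O(ρ) and l differs from `‖T o‖²` by O(ρ²) (`eigenpair_estimates`). As l
itself is O(ρ), replacing the projection onto φ by P inside lF costs O(ρ²)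
(`threshold_approximation`).

Two analytic facts remain. For the cross term, Cauchy–Schwarz on all of Ω × ℝ^d would only give
|ξ|^{α/2}; it is used for |x - y| ≤ 1, where it gives |ξ|, and the rest is bounded by ∫ min(2,
|ξ||z|)|z|^{-d-α} dz over |z| > 1. This integral is O(ρ) and is the source of the three cases
(`integral_tailProfile_le`). For `‖T o‖²`, shift the kernel K(z) = (1 - cos⟨ξ,z⟩)|z|^{-d-α} by s ∈
Ω: the average over s is exactly μ⁰V_α(ξ) by periodicity of μ (`integral_shiftedForm`), and each
shift costs ∫|K(z) - K(z - s)| dz = O(ρ²), because a bounded shift gains a factor |ξ| over the tail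
integral (`abs_cosKernel_sub_le`). -/

theorem hasSum_norm_inner_sq (u : H) : HasSum (fun i => ‖inner ℂ (b i) u‖ ^ 2) (‖u‖ ^ 2) := by
  have h := (b.hasSum_inner_mul_inner u u).mapL Complex.reCLM
  have h2 : Complex.reCLM (inner ℂ u u) = ‖u‖ ^ 2 := by
    simpa using inner_self_eq_norm_sq (𝕜 := ℂ) u
  rw [h2] at h
  refine h.congr_fun fun i => ?_
  rw [← inner_conj_symm u (b i), mul_comm]
  simp only [Complex.reCLM_apply, Complex.mul_conj, Complex.ofReal_re, Complex.normSq_eq_norm_sq]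

theorem ext_inner {u v : H} (h : ∀ i, inner ℂ (b i) u = inner ℂ (b i) v) : u = v := by
  apply b.repr.injective
  ext i
  simp only [b.repr_apply_apply, h]

theorem exists_inner_eq {c : ι → ℂ} (hc : Summable fun i => ‖c i‖ ^ 2) :
    ∃ u : H, ∀ i, inner ℂ (b i) u = c i := by
  have hm : Memℓp c 2 := by
    refine memℓp_gen ?_
    simpa using hc
  refine ⟨b.repr.symm ⟨c, hm⟩, fun i => ?_⟩
  rw [← b.repr_apply_apply]
  simp

theorem exists_diag {m : ι → ℝ} {M : ℝ} (hm : ∀ i, |m i| ≤ M) (u : H) :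
    ∃ v : H, ∀ i, inner ℂ (b i) v = m i * inner ℂ (b i) u := by
  refine b.exists_inner_eq ?_
  refine Summable.of_nonneg_of_le (fun i => by positivity) (fun i => ?_)
    ((b.hasSum_norm_inner_sq u).summable.mul_left (M ^ 2))
  rw [norm_mul, mul_pow, Complex.norm_real, Real.norm_eq_abs]
  have := hm i
  gcongr

/-- The diagonal operator with bounded real symbol `m` in the basis `b`. -/
def diag (m : ι → ℝ) (M : ℝ) (hm : ∀ i, |m i| ≤ M) : H →L[ℂ] H :=
  LinearMap.mkContinuous
    { toFun := fun u => (b.exists_diag hm u).choose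
      map_add' := fun u v => b.ext_inner fun i => by
        rw [inner_add_right, (b.exists_diag hm _).choose_spec, (b.exists_diag hm _).choose_spec,
          (b.exists_diag hm _).choose_spec, inner_add_right, mul_add]
      map_smul' := fun c u => b.ext_inner fun i => by
        rw [RingHom.id_apply, inner_smul_right, (b.exists_diag hm _).choose_spec,
          (b.exists_diag hm _).choose_spec, inner_smul_right]
        ring } |M| (fun u => by
      have h1 := b.hasSum_norm_inner_sq u
      have h2 := b.hasSum_norm_inner_sq (b.exists_diag hm u).choose
      simp only [(b.exists_diag hm _).choose_spec] at h2
      refine abs_le_of_sq_le_sq' ?_ (by positivity) |>.2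
      rw [mul_pow]
      refine hasSum_le (fun i => ?_) h2 (h1.mul_left _)
      rw [norm_mul, mul_pow, Complex.norm_real, Real.norm_eq_abs]
      have := (hm i).trans (le_abs_self M)
      gcongr)

@[simp]
theorem inner_diag (m : ι → ℝ) (M : ℝ) (hm : ∀ i, |m i| ≤ M) (u : H) (i : ι) :
    inner ℂ (b i) (b.diag m M hm u) = m i * inner ℂ (b i) u :=
  (b.exists_diag hm u).choose_spec i

theorem diag_symm (m : ι → ℝ) (M : ℝ) (hm : ∀ i, |m i| ≤ M) (u v : H) :
    inner ℂ (b.diag m M hm u) v = inner ℂ u (b.diag m M hm v) := by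
  have h1 := b.hasSum_inner_mul_inner (b.diag m M hm u) v
  have h2 := b.hasSum_inner_mul_inner u (b.diag m M hm v)
  refine h1.unique (h2.congr_fun fun i => ?_)
  rw [inner_diag, ← inner_conj_symm, inner_diag, map_mul, inner_conj_symm, Complex.conj_ofReal]
  ring

/-- The finite truncations have finite rank, and they converge in operator norm because the
discarded entries of the symbol are uniformly small. -/
theorem isCompactOperator_diag (m : ι → ℝ) (M : ℝ) (hm : ∀ i, |m i| ≤ M) [CompleteSpace H]
    (h0 : Filter.Tendsto m Filter.cofinite (nhds 0)) : IsCompactOperator (b.diag m M hm) := by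
  classical
  let f : Finset ι → H →L[ℂ] H := fun F =>
    ∑ i ∈ F, (m i : ℂ) • (innerSL ℂ (b i)).smulRight (b i)
  have hf : ∀ F u i, inner ℂ (b i) (f F u) = (if i ∈ F then (m i : ℂ) else 0) * inner ℂ (b i) u := by
    intro F u i
    simp only [f, _root_.sum_apply, inner_sum, _root_.smul_apply,
      ContinuousLinearMap.smulRight_apply, inner_smul_right, innerSL_apply_apply,
      orthonormal_iff_ite.1 b.orthonormal]
    simp
  have hlim : Filter.Tendsto f Filter.atTop (nhds (b.diag m M hm)) := by
    rw [Metric.tendsto_atTop]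
    intro ε hε
    have hfin : {i | ¬ |m i| < ε / 2}.Finite := by
      have := Metric.tendsto_nhds.1 h0 (ε / 2) (by positivity)
      simpa [Filter.eventually_cofinite] using this
    refine ⟨hfin.toFinset, fun F hF => ?_⟩
    rw [dist_eq_norm]
    refine lt_of_le_of_lt (ContinuousLinearMap.opNorm_le_bound _ (half_pos hε).le fun u => ?_)
      (half_lt_self hε)
    have h1 := b.hasSum_norm_inner_sq u
    have h2 := b.hasSum_norm_inner_sq ((f F - b.diag m M hm) u)
    refine abs_le_of_sq_le_sq' ?_ (by positivity) |>.2
    rw [mul_pow]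
    refine hasSum_le (fun i => ?_) h2 (h1.mul_left _)
    rw [_root_.sub_apply, inner_sub_right, hf, inner_diag, ← sub_mul, norm_mul,
      mul_pow]
    gcongr
    split_ifs with hi
    · simp only [sub_self, norm_zero]
      positivity
    · have : i ∉ hfin.toFinset := fun h => hi (hF h)
      simp only [Finite.mem_toFinset, mem_ofPred_eq, not_not] at this
      simpa using this.le
  refine isCompactOperator_of_tendsto hlim (Filter.Eventually.of_forall fun F => ?_)
  induction F using Finset.induction_on with
  | empty => simpa [f] using! isCompactOperator_zero
  | insert i F hi ih =>
    simp only [f, Finset.sum_insert hi] at ih ⊢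
    refine IsCompactOperator.add (IsCompactOperator.smul ?_ _) ih
    exact (isCompactOperator_of_locallyCompactSpace_rng
      (ContinuousLinearMap.toSpanSingleton ℂ (b i))).comp_clm (innerSL ℂ (b i))

end HilbertBasis

/-! ### Eigenbases of compact symmetric operators. -/

/-- Bases of the individual subspaces are concatenated. A vector orthogonal to all of them has zero
projection on every subspace, so it is orthogonal to the dense sum. -/
theorem OrthogonalFamily.exists_hilbertBasis.{u, v} {κ : Type u} {H : Type v} [NormedAddCommGroup H]
    [InnerProductSpace ℂ H] [CompleteSpace H] {G : κ → Submodule ℂ H} [∀ z, CompleteSpace (G z)]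
    (hG : OrthogonalFamily ℂ (fun z => G z) fun z => (G z).subtypeₗᵢ) (htop : (⨆ z, G z)ᗮ = ⊥) :
    ∃ (ι : Type (max u v)) (b : HilbertBasis ι ℂ H), ∀ i, ∃ z, b i ∈ G z := by
  choose w B hB using fun z => _root_.exists_hilbertBasis ℂ (G z)
  have ho := hG.orthonormal_sigma_orthonormal (v_family := fun z => B z)
    (fun z => (B z).orthonormal)
  have hbot : (Submodule.span ℂ (Set.range fun a : Σ z, w z =>
      (G a.1).subtypeₗᵢ (B a.1 a.2)))ᗮ = ⊥ := by
    rw [eq_bot_iff, ← htop]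
    intro v hv
    rw [← Submodule.iInf_orthogonal, Submodule.mem_iInf]
    intro z
    rw [Submodule.mem_orthogonal']
    intro x hx
    have h := (B z).hasSum_inner_mul_inner ((G z).orthogonalProjectionOnto v) ⟨x, hx⟩
    have h0 : ∀ i, inner ℂ ((G z).orthogonalProjectionOnto v) (B z i) = 0 := by
      intro i
      rw [Submodule.inner_orthogonalProjectionOnto_eq_of_mem_right]
      exact (Submodule.mem_orthogonal' _ _).1 hv _ (Submodule.subset_span ⟨⟨z, i⟩, rfl⟩)
    simp only [h0, zero_mul] at h
    have := h.unique hasSum_zero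
    rwa [Submodule.inner_orthogonalProjectionOnto_eq_of_mem_right] at this
  have hb := HilbertBasis.coe_mkOfOrthogonalEqBot ho hbot
  generalize HilbertBasis.mkOfOrthogonalEqBot ho hbot = b at hb
  refine ⟨Σ z, w z, b, fun a => ⟨a.1, ?_⟩⟩
  rw [hb]
  exact (B a.1 a.2).2

/-- Eigenspaces of a compact symmetric operator are mutually orthogonal with dense sum, and the
eigenvalues are real, so a concatenated basis consists of eigenvectors. -/
theorem LinearMap.IsSymmetric.exists_hilbertBasis_eigenvectors.{u} {H : Type u} [NormedAddCommGroup H]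
    [InnerProductSpace ℂ H] [CompleteSpace H] {R : H →L[ℂ] H} (hc : IsCompactOperator R)
    (hs : (R : H →ₗ[ℂ] H).IsSymmetric) :
    ∃ (ι : Type u) (b : HilbertBasis ι ℂ H) (ν : ι → ℝ), ∀ i, R (b i) = (ν i : ℂ) • b i := by
  have hcl : ∀ z, CompleteSpace (Module.End.eigenspace (R : H →ₗ[ℂ] H) z) := fun z => by
    have : IsClosed (Module.End.eigenspace (R : H →ₗ[ℂ] H) z : Set H) := by
      have : (Module.End.eigenspace (R : H →ₗ[ℂ] H) z : Set H) = {x | R x = z • x} := by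
        ext x
        exact Module.End.mem_eigenspace_iff
      rw [this]
      exact isClosed_eq R.continuous (continuous_const_smul z)
    exact this.completeSpace_coe
  obtain ⟨ι, b, hb⟩ := hs.orthogonalFamily_eigenspaces.exists_hilbertBasis
    (ContinuousLinearMap.orthogonalComplement_iSup_eigenspaces_eq_bot hc hs)
  choose z hz using hb
  refine ⟨ι, b, fun i => (z i).re, fun i => ?_⟩
  have h1 : R (b i) = z i • b i := Module.End.mem_eigenspace_iff.1 (hz i)
  have h2 := hs.conj_eigenvalue_eq_self
    (Module.End.hasEigenvalue_of_hasEigenvector ⟨hz i, b.orthonormal.ne_zero i⟩)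
  rw [h1, Complex.conj_eq_iff_re.1 h2]

/-! ### Spectral measures: action on eigenvectors, and existence from an eigenbasis. -/

namespace LevyType
namespace ProjectionMeasure

variable {ι H : Type*} [NormedAddCommGroup H] [InnerProductSpace ℂ H] [CompleteSpace H]

theorem scalarMeasure_apply (E : ProjectionMeasure H) (u : H) {s : Set ℝ} (hs : MeasurableSet s) :
    E.scalarMeasure u s = ENNReal.ofReal (inner ℂ u (E.proj s u)).re :=
  Measure.ofMeasurable_apply s hs

theorem re_inner_proj (E : ProjectionMeasure H) (u : H) {s : Set ℝ} (hs : MeasurableSet s) :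
    (inner ℂ u (E.proj s u)).re = ‖E.proj s u‖ ^ 2 := by
  have h := E.isStarProjection s hs
  have h1 : E.proj s u = E.proj s (E.proj s u) := by
    have := congrArg (fun T : H →L[ℂ] H => T u) h.isIdempotentElem.eq
    simpa using this.symm
  have h2 : inner ℂ u (E.proj s (E.proj s u)) = inner ℂ (E.proj s u) (E.proj s u) := by
    rw [← ContinuousLinearMap.adjoint_inner_left, ← ContinuousLinearMap.star_eq_adjoint,
      h.isSelfAdjoint.star_eq]
  rw [h1, h2, ← h1]
  exact inner_self_eq_norm_sq (𝕜 := ℂ) _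

theorem proj_eq_zero_of_scalarMeasure_eq_zero (E : ProjectionMeasure H) (u : H) {s : Set ℝ}
    (hs : MeasurableSet s) (h : E.scalarMeasure u s = 0) : E.proj s u = 0 := by
  rw [E.scalarMeasure_apply u hs, E.re_inner_proj u hs, ENNReal.ofReal_eq_zero] at h
  have : ‖E.proj s u‖ = 0 := by
    have := le_antisymm h (by positivity)
    simpa using this
  simpa using this

theorem proj_add_proj_compl (E : ProjectionMeasure H) (u : H) {s : Set ℝ}
    (hs : MeasurableSet s) : E.proj s u + E.proj sᶜ u = u := by
  -- Finite additivity is extracted from countable additivity by padding with empty sets.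
  let t : ℕ → Set ℝ := fun n => if n = 0 then s else if n = 1 then sᶜ else ∅
  have ht : ∀ n, MeasurableSet (t n) := by
    intro n
    simp only [t]
    split_ifs
    · exact hs
    · exact hs.compl
    · exact MeasurableSet.empty
  have hd : Pairwise (Function.onFun Disjoint t) := by
    intro m n hmn
    simp only [Function.onFun, t]
    split_ifs <;> first | omega | simp [disjoint_compl_right, disjoint_compl_left]
  have hU : (⋃ n, t n) = Set.univ := by
    refine eq_univ_of_forall fun x => mem_iUnion.2 ?_
    by_cases hx : x ∈ s
    · exact ⟨0, by simpa [t] using hx⟩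
    · exact ⟨1, by simpa [t] using hx⟩
  have h := E.iUnion t ht hd u
  have h2 : HasSum (fun n => E.proj (t n) u) (∑ n ∈ Finset.range 2, E.proj (t n) u) := by
    refine hasSum_sum_of_ne_finset_zero fun n hn => ?_
    have h0 : n ≠ 0 := fun h => hn (by simp [h])
    have h1 : n ≠ 1 := fun h => hn (by simp [h])
    simp [t, h0, h1, E.empty]
  have := h2.unique h
  rw [hU, E.univ] at this
  simpa [Finset.sum_range_succ, t] using this

instance (E : ProjectionMeasure H) (u : H) : IsFiniteMeasure (E.scalarMeasure u) :=
  ⟨by rw [E.scalarMeasure_apply u MeasurableSet.univ]; exact ENNReal.ofReal_lt_top⟩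

theorem scalarMeasure_univ (E : ProjectionMeasure H) (u : H) :
    (E.scalarMeasure u).real Set.univ = ‖u‖ ^ 2 := by
  rw [Measure.real, E.scalarMeasure_apply u MeasurableSet.univ, E.re_inner_proj u MeasurableSet.univ,
    E.univ, ENNReal.toReal_ofReal (by positivity)]
  simp

/-- On an eigenvector the spectral projections act as zero or as the identity. -/
theorem IsSpectralMeasureOf.proj_eigenvector {E : ProjectionMeasure H} {T : Set (H × H)}
    (hE : E.IsSpectralMeasureOf T) {φ : H} {l : ℝ} (hφ : (φ, (l : ℂ) • φ) ∈ T) {s : Set ℝ}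
    (hs : MeasurableSet s) : E.proj s φ = s.indicator (fun _ => φ) l := by
  set m := E.scalarMeasure φ with hm
  have hsq : Integrable (fun t : ℝ => t ^ 2) m := by
    refine ⟨by fun_prop, ?_⟩
    have h := (hE.mem_domain_iff φ).1 ⟨_, hφ⟩
    rw [hasFiniteIntegral_iff_norm]
    simpa using h
  have hid : Integrable (fun t : ℝ => t) m := by
    refine (hsq.add (integrable_const 1)).mono (by fun_prop) (Filter.Eventually.of_forall fun t => ?_)
    simp only [Pi.add_apply, Real.norm_eq_abs]
    rw [abs_of_nonneg (by positivity : (0 : ℝ) ≤ t ^ 2 + 1), abs_le]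
    constructor <;> nlinarith [sq_nonneg (t - 1), sq_nonneg (t + 1)]
  have h1 : ∫ t, t ∂m = l * ‖φ‖ ^ 2 := by
    have := hE.inner_eq _ _ hφ
    rw [inner_smul_right, inner_self_eq_norm_sq_to_K] at this
    apply Complex.ofReal_injective
    rw [← hm] at this
    rw [← this]
    push_cast
    rfl
  have h2 : ∫ t, t ^ 2 ∂m = l ^ 2 * ‖φ‖ ^ 2 := by
    rw [← hE.norm_sq_eq _ _ hφ, norm_smul, mul_pow]
    simp
  have hA : Integrable (fun t : ℝ => t ^ 2 - 2 * l * t) m := hsq.sub (hid.const_mul _)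
  have hexp : (fun t : ℝ => (t - l) ^ 2) = fun t => t ^ 2 - 2 * l * t + l ^ 2 := by
    ext t; ring
  -- The first two moments of the scalar measure are those of a point mass at `l`, so the variance
  -- about `l` vanishes and the measure is concentrated there. Thus any spectral measure of the
  -- graph is determined on eigenvectors, without a general uniqueness theorem.
  have h3 : ∫ t, (t - l) ^ 2 ∂m = 0 := by
    rw [hexp, integral_add hA (integrable_const _), integral_sub hsq (hid.const_mul _),
      integral_const_mul, h1, h2, integral_const, hm, E.scalarMeasure_univ, smul_eq_mul]
    ring
  have h4 : m {l}ᶜ = 0 := by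
    have hint : Integrable (fun t : ℝ => (t - l) ^ 2) m := by
      rw [hexp]
      exact hA.add (integrable_const _)
    have := (integral_eq_zero_iff_of_nonneg (fun t => by positivity) hint).1 h3
    rw [Filter.EventuallyEq, ae_iff] at this
    convert! this using 2
    ext t
    simp [sub_eq_zero]
  by_cases hl : l ∈ s
  · rw [indicator_of_mem hl]
    have h5 : E.proj sᶜ φ = 0 := E.proj_eq_zero_of_scalarMeasure_eq_zero φ hs.compl
      (measure_mono_null (by simpa using hl) h4)
    have := E.proj_add_proj_compl φ hs
    rwa [h5, add_zero] at this
  · rw [indicator_of_notMem hl]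
    exact E.proj_eq_zero_of_scalarMeasure_eq_zero φ hs
      (measure_mono_null (by simpa using hl) h4)

/-- The spectral measure of the operator that acts as multiplication by `l i` on the `i`-th vector
of a Hilbert basis. -/
def ofBasis (b : HilbertBasis ι ℂ H) (l : ι → ℝ) : ProjectionMeasure H where
  proj s := b.diag (fun i => s.indicator (fun _ => (1 : ℝ)) (l i)) 1 (fun i => by
    by_cases h : l i ∈ s <;> simp [h])
  isStarProjection s _ := by
    refine ⟨?_, ?_⟩
    · ext u
      refine b.ext_inner fun i => ?_
      by_cases h : l i ∈ s <;> simp [h]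
    · rw [ContinuousLinearMap.isSelfAdjoint_iff_isSymmetric]
      exact b.diag_symm _ _ _
  empty := by
    ext u
    refine b.ext_inner fun i => ?_
    simp
  univ := by
    ext u
    refine b.ext_inner fun i => ?_
    simp
  iUnion s _ hd u := by
    -- Each projected vector is the part of the expansion of `u` over the indices with `l i ∈ t`.
    -- For disjoint sets these index sets partition the one of the union, and additivity becomes
    -- regrouping of a convergent sum.
    have key : ∀ t : Set ℝ, HasSum (fun i : {i // l i ∈ t} => inner ℂ (b i) u • b i)
        (b.diag (fun i => t.indicator (fun _ => (1 : ℝ)) (l i)) 1 (fun i => by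
          by_cases h : l i ∈ t <;> simp [h]) u) := by
      intro t
      have h := b.hasSum_repr (b.diag (fun i => t.indicator (fun _ => (1 : ℝ)) (l i)) 1 (fun i => by
          by_cases h : l i ∈ t <;> simp [h]) u)
      have h' := (hasSum_subtype_iff_of_support_subset (s := {i | l i ∈ t}) (f := fun i =>
        b.repr (b.diag (fun i => t.indicator (fun _ => (1 : ℝ)) (l i)) 1 (fun i => by
          by_cases h : l i ∈ t <;> simp [h]) u) i • b i) (by
            intro i hi
            by_contra hc
            have hc' : l i ∉ t := hc
            simp [b.repr_apply_apply, hc'] at hi)).2 h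
      refine h'.congr_fun fun i => ?_
      have : l i ∈ t := i.2
      simp [b.repr_apply_apply, this]
    have hd' : ∀ m n, m ≠ n → Disjoint {i | l i ∈ s m} {i | l i ∈ s n} := fun m n hmn =>
      Disjoint.preimage l (hd hmn)
    have h := key (⋃ n, s n)
    have hU : {i | l i ∈ ⋃ n, s n} = ⋃ n, {i | l i ∈ s n} := by ext; simp
    let e := (Set.unionEqSigmaOfDisjoint (t := fun n => {i | l i ∈ s n}) hd').symm.trans
      (Equiv.setCongr hU.symm)
    have h2 := e.hasSum_iff.2 h
    exact HasSum.sigma h2 fun n => key (s n)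

theorem ofBasis_scalarMeasure (b : HilbertBasis ι ℂ H) (l : ι → ℝ) (u : H) :
    (ofBasis b l).scalarMeasure u = Measure.sum fun i =>
      ENNReal.ofReal (‖inner ℂ (b i) u‖ ^ 2) • Measure.dirac (l i) := by
  ext s hs
  rw [scalarMeasure_apply _ _ hs, re_inner_proj _ _ hs, Measure.sum_apply _ hs,
    ← (b.hasSum_norm_inner_sq _).tsum_eq, ENNReal.ofReal_tsum_of_nonneg (fun i => by positivity)
      (b.hasSum_norm_inner_sq _).summable]
  congr 1
  ext i
  by_cases h : l i ∈ s <;> simp [ofBasis, h, Measure.dirac_apply' _ hs]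

/-- An operator that is diagonal in a Hilbert basis has a spectral measure. -/
theorem ofBasis_isSpectralMeasureOf (b : HilbertBasis ι ℂ H) (l : ι → ℝ) {T : Set (H × H)}
    (hT : ∀ u f, (u, f) ∈ T ↔ ∀ i, inner ℂ (b i) f = l i * inner ℂ (b i) u) :
    (ofBasis b l).IsSpectralMeasureOf T := by
  have hsum : ∀ u f, (u, f) ∈ T → HasSum (fun i => l i ^ 2 * ‖inner ℂ (b i) u‖ ^ 2) (‖f‖ ^ 2) := by
    intro u f hf
    refine (b.hasSum_norm_inner_sq f).congr_fun fun i => ?_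
    rw [(hT u f).1 hf i, norm_mul, mul_pow, Complex.norm_real, Real.norm_eq_abs, sq_abs]
  have hlin : ∀ u, ∫⁻ t, ENNReal.ofReal (t ^ 2) ∂((ofBasis b l).scalarMeasure u) =
      ∑' i, ENNReal.ofReal (l i ^ 2 * ‖inner ℂ (b i) u‖ ^ 2) := by
    intro u
    rw [ofBasis_scalarMeasure, lintegral_sum_measure]
    congr 1
    ext i
    rw [lintegral_smul_measure, lintegral_dirac, smul_eq_mul, mul_comm,
      ENNReal.ofReal_mul (by positivity)]
  have hdom : ∀ u, (∃ f, (u, f) ∈ T) ↔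
      ∫⁻ t, ENNReal.ofReal (t ^ 2) ∂((ofBasis b l).scalarMeasure u) < ⊤ := by
    intro u
    rw [hlin]
    constructor
    · rintro ⟨f, hf⟩
      have h := hsum u f hf
      rw [← ENNReal.ofReal_tsum_of_nonneg (fun i => by positivity) h.summable]
      exact ENNReal.ofReal_lt_top
    · intro h
      have hs : Summable fun i => ‖(l i : ℂ) * inner ℂ (b i) u‖ ^ 2 := by
        have := ENNReal.summable_toReal h.ne
        refine this.congr fun i => ?_
        rw [ENNReal.toReal_ofReal (by positivity), norm_mul, mul_pow, Complex.norm_real,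
          Real.norm_eq_abs, sq_abs]
      obtain ⟨f, hf⟩ := b.exists_inner_eq hs
      exact ⟨f, (hT u f).2 hf⟩
  have hint2 : ∀ u f, (u, f) ∈ T →
      Integrable (fun t : ℝ => t ^ 2) ((ofBasis b l).scalarMeasure u) := by
    intro u f hf
    refine ⟨by fun_prop, ?_⟩
    have h := (hdom u).1 ⟨_, hf⟩
    rw [hasFiniteIntegral_iff_norm]
    simpa using h
  have hint1 : ∀ u f, (u, f) ∈ T →
      Integrable (fun t : ℝ => t) ((ofBasis b l).scalarMeasure u) := by
    intro u f hf
    refine ((hint2 u f hf).add (integrable_const 1)).mono (by fun_prop)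
      (Filter.Eventually.of_forall fun t => ?_)
    simp only [Pi.add_apply, Real.norm_eq_abs]
    rw [abs_of_nonneg (by positivity : (0 : ℝ) ≤ t ^ 2 + 1), abs_le]
    constructor <;> nlinarith [sq_nonneg (t - 1), sq_nonneg (t + 1)]
  refine ⟨hdom, fun u f hf => ?_, fun u f hf => ?_⟩
  · have h := hint1 u f hf
    rw [ofBasis_scalarMeasure] at h ⊢
    have h1 := hasSum_integral_measure h
    have h2 : HasSum (fun i => ((l i * ‖inner ℂ (b i) u‖ ^ 2 : ℝ) : ℂ)) (inner ℂ u f) := by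
      refine (b.hasSum_inner_mul_inner u f).congr_fun fun i => ?_
      rw [(hT u f).1 hf i, ← inner_conj_symm u (b i), mul_left_comm, Complex.conj_mul']
      push_cast
      ring
    have h3 := Complex.hasSum_ofReal.2 h1
    refine h2.unique (h3.congr_fun fun i => ?_)
    rw [integral_smul_measure, integral_dirac, ENNReal.toReal_ofReal (by positivity), smul_eq_mul,
      mul_comm]
  · have h := hint2 u f hf
    rw [ofBasis_scalarMeasure] at h ⊢
    have h1 := hasSum_integral_measure h
    refine (hsum u f hf).unique (h1.congr_fun fun i => ?_)
    rw [integral_smul_measure, integral_dirac, ENNReal.toReal_ofReal (by positivity), smul_eq_mul,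
      mul_comm]

end ProjectionMeasure

/-- The graph of the operator that corresponds to the quadratic form `u ↦ ‖T u‖²` on `D`. -/
def formGraph {H K : Type*} [NormedAddCommGroup H] [InnerProductSpace ℂ H]
    [NormedAddCommGroup K] [InnerProductSpace ℂ K] {D : Submodule ℂ H} (T : D →ₗ[ℂ] K) :
    Set (H × H) :=
  {q | ∃ hu : q.1 ∈ D, ∀ v : D, inner ℂ (T v) (T ⟨q.1, hu⟩) = inner ℂ (v : H) q.2}

/-! ### From a closed form to an orthonormal eigenbasis. -/

section Resolvent

universe u

variable {H : Type u} {K : Type*} [NormedAddCommGroup H] [InnerProductSpace ℂ H] [CompleteSpace H]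
  [NormedAddCommGroup K] [InnerProductSpace ℂ K] [CompleteSpace K]

/-- The operator `G* G + S²`. -/
def gramOp (G : H →L[ℂ] K) (S : H →L[ℂ] H) : H →L[ℂ] H :=
  (ContinuousLinearMap.adjoint G) ∘L G + (ContinuousLinearMap.adjoint S) ∘L S

theorem inner_gramOp_right (G : H →L[ℂ] K) (S : H →L[ℂ] H) (f g : H) :
    inner ℂ f (gramOp G S g) = inner ℂ (G f) (G g) + inner ℂ (S f) (S g) := by
  simp [gramOp, ContinuousLinearMap.adjoint_inner_right]

theorem inner_gramOp_left (G : H →L[ℂ] K) (S : H →L[ℂ] H) (f g : H) :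
    inner ℂ (gramOp G S f) g = inner ℂ (G f) (G g) + inner ℂ (S f) (S g) := by
  simp [gramOp, ContinuousLinearMap.adjoint_inner_left]

theorem inner_gramOp_self (G : H →L[ℂ] K) (S : H →L[ℂ] H) (f : H) :
    inner ℂ (gramOp G S f) f = ((‖G f‖ ^ 2 + ‖S f‖ ^ 2 : ℝ) : ℂ) := by
  rw [inner_gramOp_left, inner_self_eq_norm_sq_to_K, inner_self_eq_norm_sq_to_K]
  push_cast
  rfl

/-- The eigenvector expansion of the operator whose graph is given in the form
`u = S f`, `(G h, G f) = (S h, g)` for all `h`, with `S` compact. -/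
theorem exists_eigenbasis_of_gram {G : H →L[ℂ] K} {S : H →L[ℂ] H}
    (hS : IsCompactOperator S) (hSs : ∀ x y, inner ℂ (S x) y = inner ℂ x (S y))
    (hSi : Function.Injective S) {c : ℝ} (hc : 0 < c)
    (hlow : ∀ f, c * ‖f‖ ^ 2 ≤ ‖G f‖ ^ 2 + ‖S f‖ ^ 2) :
    ∃ (ι : Type u) (b : HilbertBasis ι ℂ H) (l : ι → ℝ), (∀ i, 0 ≤ l i) ∧
      (∀ u g, (∃ f, S f = u ∧ ∀ h, inner ℂ (G h) (G f) = inner ℂ (S h) g) ↔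
        ∀ i, inner ℂ (b i) g = l i * inner ℂ (b i) u) ∧
      ∀ f κ, 0 ≤ κ → ‖G f‖ ^ 2 ≤ κ * ‖S f‖ ^ 2 → S f ≠ 0 → ∃ i, l i ≤ κ := by
  -- Lax–Milgram: the lower bound `hlow` is coercivity of `gramOp G S`.
  have hunit : IsUnit (gramOp G S) := by
    refine ContinuousLinearMap.isUnit_of_forall_le_norm_inner_map _ (c := ⟨c, hc.le⟩) hc fun f => ?_
    rw [inner_gramOp_self, Complex.norm_real, Real.norm_eq_abs, abs_of_nonneg (by positivity),
      mul_comm]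
    exact hlow f
  obtain ⟨⟨B, B', h1, h2⟩, hB⟩ := hunit
  simp only at hB
  have hBB : ∀ x, B (B' x) = x := fun x => congrArg (fun T : H →L[ℂ] H => T x) h1
  have hBB' : ∀ x, B' (B x) = x := fun x => congrArg (fun T : H →L[ℂ] H => T x) h2
  have hBr : ∀ f g, inner ℂ f (B g) = inner ℂ (G f) (G g) + inner ℂ (S f) (S g) := by
    intro f g; rw [hB, inner_gramOp_right]
  have hBs : ∀ f g, inner ℂ (B f) g = inner ℂ f (B g) := by
    intro f g; rw [hB, inner_gramOp_right, inner_gramOp_left]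
  have hBself : ∀ f, inner ℂ (B f) f = ((‖G f‖ ^ 2 + ‖S f‖ ^ 2 : ℝ) : ℂ) := by
    intro f; rw [hB, inner_gramOp_self]
  have hB's : ∀ x y, inner ℂ (B' x) y = inner ℂ x (B' y) := by
    intro x y
    conv_lhs => rw [← hBB y]
    rw [← hBs, hBB]
  -- With `B = G*G + S²`, the form of A + 1 at `u = S f` is `(B f, f)`, so `R = S B⁻¹ S` is the
  -- resolvent (A + 1)⁻¹.
  let R : H →L[ℂ] H := S ∘L B' ∘L S
  have hR : ∀ x, R x = S (B' (S x)) := fun x => rfl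
  have hRs : ∀ x y, inner ℂ (R x) y = inner ℂ x (R y) := by
    intro x y; rw [hR, hSs, hB's, hSs, hR]
  have hRc : IsCompactOperator R := hS.comp_clm (B' ∘L S)
  have hRi : ∀ x, R x = 0 → x = 0 := by
    intro x hx
    have : B' (S x) = 0 := hSi (by rw [map_zero]; exact hx)
    have : S x = 0 := by rw [← hBB (S x), this, map_zero]
    exact hSi (by rw [map_zero]; exact this)
  obtain ⟨ι, b, ν, hν⟩ := LinearMap.IsSymmetric.exists_hilbertBasis_eigenvectors hRc hRs
  have hν0 : ∀ i, ν i ≠ 0 := by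
    intro i h
    apply b.orthonormal.ne_zero i
    apply hRi
    rw [hν, h]
    simp
  -- For `y = B⁻¹ S (b i)` one has `S y = ν i • b i`, and the identity `(B y, y) = ν i` reads ν = ‖G
  -- y‖² + ν².
  have hν1 : ∀ i, 0 < ν i ∧ ν i ≤ 1 := by
    intro i
    have e1 : inner ℂ (B (B' (S (b i)))) (B' (S (b i))) = (ν i : ℂ) := by
      rw [hBB, hSs, ← hR, hν, inner_smul_right, inner_self_eq_norm_sq_to_K, b.orthonormal.1 i]
      simp
    rw [hBself, ← hR, hν] at e1
    have e2 := Complex.ofReal_injective e1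
    rw [norm_smul, b.orthonormal.1 i, Complex.norm_real, mul_one, Real.norm_eq_abs, sq_abs] at e2
    have h0 : 0 < ν i := lt_of_le_of_ne (by rw [← e2]; positivity) (hν0 i).symm
    refine ⟨h0, ?_⟩
    have : ν i * ν i ≤ ν i * 1 := by nlinarith [sq_nonneg ‖G (B' (S (b i)))‖]
    exact le_of_mul_le_mul_left this h0
  have hRb : ∀ i x, inner ℂ (b i) (R x) = ν i * inner ℂ (b i) x := by
    intro i x
    rw [← hRs, hν, inner_smul_left, Complex.conj_ofReal]
  -- The graph relation g = A u is rewritten as u = (A + 1)⁻¹(g + u), which can be read coefficient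
  -- by coefficient with eigenvalues 1/ν - 1.
  have hgr : ∀ u g, (∃ f, S f = u ∧ ∀ h, inner ℂ (G h) (G f) = inner ℂ (S h) g) ↔
      u = R (g + u) := by
    intro u g
    constructor
    · rintro ⟨f, rfl, hf⟩
      have : B f = S (g + S f) := by
        refine ext_inner_left ℂ fun h => ?_
        rw [hBr, hf, ← inner_add_right, hSs]
      rw [hR, ← this, hBB']
    · intro hu
      refine ⟨B' (S (g + u)), hu.symm, fun h => ?_⟩
      have := hBr h (B' (S (g + u)))
      rw [hBB, ← hSs, inner_add_right, ← hR, ← hu] at this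
      exact (add_right_cancel this).symm
  refine ⟨ι, b, fun i => 1 / ν i - 1, fun i => ?_, fun u g => ?_, fun f κ hκ hf hne => ?_⟩
  · rw [sub_nonneg, le_div_iff₀ (hν1 i).1, one_mul]
    exact (hν1 i).2
  · rw [hgr]
    have hcoef : ∀ i, inner ℂ (b i) u = inner ℂ (b i) (R (g + u)) ↔
        inner ℂ (b i) g = ((1 / ν i - 1 : ℝ) : ℂ) * inner ℂ (b i) u := by
      intro i
      have h0 : (ν i : ℂ) ≠ 0 := by exact_mod_cast hν0 i
      rw [hRb, inner_add_right]
      push_cast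
      constructor
      · intro h
        field_simp
        linear_combination -h
      · intro h
        rw [h]
        field_simp
        ring
    exact ⟨fun h i => (hcoef i).1 (by rw [← h]), fun h => b.ext_inner fun i => (hcoef i).2 (h i)⟩
  -- Variational upper bound for the lowest eigenvalue. Positivity of `B` at f - (1+κ)y, with y =
  -- B⁻¹ S u, turns the Rayleigh bound on f into (1+κ)(u, R u) ≥ ‖u‖². If all l > κ, then (1+κ)ν < 1
  -- for all indices, which forces u = 0.
  · by_contra! hall
    set u := S f with hu
    set y := B' (S u) with hy
    have hpos : 0 ≤ (inner ℂ (B (f - ((1 + κ : ℝ) : ℂ) • y)) (f - ((1 + κ : ℝ) : ℂ) • y)).re := by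
      rw [hBself, Complex.ofReal_re]; positivity
    have hyf : inner ℂ (B y) f = ((‖u‖ ^ 2 : ℝ) : ℂ) := by
      rw [hy, hBB, hSs, ← hu, inner_self_eq_norm_sq_to_K]
      push_cast
      rfl
    have hfy : inner ℂ (B f) y = ((‖u‖ ^ 2 : ℝ) : ℂ) := by
      rw [hBs, ← inner_conj_symm, hyf, Complex.conj_ofReal]
    have hyy : inner ℂ (B y) y = inner ℂ u (R u) := by
      rw [hy, hBB, hSs, hR]
    rw [map_sub, map_smul, inner_sub_left, inner_sub_right, inner_sub_right, inner_smul_left,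
      inner_smul_left, inner_smul_right, inner_smul_right, hBself, hfy, hyf, hyy,
      Complex.conj_ofReal] at hpos
    have hre : (inner ℂ u (R u)).re * (1 + κ) ≥ ‖u‖ ^ 2 := by
      simp only [Complex.sub_re, Complex.re_ofReal_mul, Complex.ofReal_re] at hpos
      have : (1 + κ) * ‖u‖ ^ 2 ≤ (1 + κ) * ((inner ℂ u (R u)).re * (1 + κ)) := by nlinarith
      exact le_of_mul_le_mul_left this (by positivity)
    have hs1 := b.hasSum_norm_inner_sq u
    have hs2 : HasSum (fun i => ν i * ‖inner ℂ (b i) u‖ ^ 2) (inner ℂ u (R u)).re := by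
      refine ((b.hasSum_inner_mul_inner u (R u)).mapL Complex.reCLM).congr_fun fun i => ?_
      rw [hRb, ← inner_conj_symm u (b i), mul_left_comm, Complex.conj_mul']
      simp only [Complex.reCLM_apply, Complex.re_ofReal_mul]
      norm_cast
    have hs3 := hs1.sub (hs2.mul_right (1 + κ))
    have hlt : ∀ i, ν i * (1 + κ) < 1 := by
      intro i
      have := hall i
      rw [lt_sub_iff_add_lt, lt_div_iff₀ (hν1 i).1] at this
      linarith
    have hnn : ∀ i, 0 ≤ ‖inner ℂ (b i) u‖ ^ 2 - ν i * ‖inner ℂ (b i) u‖ ^ 2 * (1 + κ) := by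
      intro i
      have : 0 ≤ (1 - ν i * (1 + κ)) * ‖inner ℂ (b i) u‖ ^ 2 :=
        mul_nonneg (by linarith [hlt i]) (by positivity)
      linarith
    have hz : ‖u‖ ^ 2 - (inner ℂ u (R u)).re * (1 + κ) = 0 :=
      le_antisymm (by linarith) (hs3.nonneg hnn)
    rw [hz] at hs3
    have hz2 := (hasSum_zero_iff_of_nonneg hnn).1 hs3
    apply hne
    refine b.ext_inner fun i => ?_
    have := congrFun hz2 i
    simp only [Pi.zero_apply] at this
    have h3 : (1 - ν i * (1 + κ)) * ‖inner ℂ (b i) u‖ ^ 2 = 0 := by linarith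
    rcases mul_eq_zero.1 h3 with h4 | h4
    · linarith [hlt i]
    · rw [inner_zero_right]
      simpa using h4

/-- A form that is two-sided comparable with a diagonal form with discrete symbol `w → ∞`
corresponds to an operator with an orthonormal basis of eigenvectors. -/
theorem exists_eigenbasis_of_form {ι : Type*} (e : HilbertBasis ι ℂ H) {w : ι → ℝ}
    (hw : ∀ i, 0 ≤ w i) (hwlim : Filter.Tendsto w Filter.cofinite Filter.atTop)
    {D : Submodule ℂ H} (hD : ∀ u, u ∈ D ↔ Summable fun i => w i * ‖inner ℂ (e i) u‖ ^ 2)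
    (T : D →ₗ[ℂ] K) {m M : ℝ} (hm : 0 < m) (hM : 0 ≤ M)
    (hlow : ∀ u : D, m * ∑' i, w i * ‖inner ℂ (e i) (u : H)‖ ^ 2 ≤ ‖T u‖ ^ 2)
    (hup : ∀ u : D, ‖T u‖ ^ 2 ≤ M * ∑' i, w i * ‖inner ℂ (e i) (u : H)‖ ^ 2) :
    ∃ (ι' : Type u) (b : HilbertBasis ι' ℂ H) (l : ι' → ℝ), (∀ i, 0 ≤ l i) ∧
      (∀ u g, (u, g) ∈ formGraph T ↔ ∀ i, inner ℂ (b i) g = l i * inner ℂ (b i) u) ∧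
      ∀ (u : D) κ, 0 ≤ κ → ‖T u‖ ^ 2 ≤ κ * ‖(u : H)‖ ^ 2 → (u : H) ≠ 0 → ∃ i, l i ≤ κ := by
  have hpos : ∀ i, 0 < √(1 + w i) := fun i => Real.sqrt_pos.2 (by linarith [hw i])
  have hsq : ∀ i, √(1 + w i) ^ 2 = 1 + w i := fun i => Real.sq_sqrt (by linarith [hw i])
  have hs1 : ∀ i, |(√(1 + w i))⁻¹| ≤ 1 := by
    intro i
    rw [abs_of_pos (inv_pos.2 (hpos i))]
    exact inv_le_one_of_one_le₀ (Real.one_le_sqrt.2 (by linarith [hw i]))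
  -- Preconditioning: `S` maps `H` bijectively onto the form domain, is compact because `w → ∞`, and
  -- makes `G = T S` bounded.
  let S : H →L[ℂ] H := e.diag (fun i => (√(1 + w i))⁻¹) 1 hs1
  have hSc : IsCompactOperator S := by
    refine e.isCompactOperator_diag _ _ _ ?_
    refine Filter.Tendsto.inv_tendsto_atTop ?_
    refine Real.tendsto_sqrt_atTop.comp ?_
    exact Filter.tendsto_atTop_add_const_left _ _ hwlim
  have hSn : ∀ f i, ‖inner ℂ (e i) (S f)‖ ^ 2 = (1 + w i)⁻¹ * ‖inner ℂ (e i) f‖ ^ 2 := by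
    intro f i
    rw [HilbertBasis.inner_diag, norm_mul, mul_pow, Complex.norm_real, Real.norm_eq_abs, sq_abs,
      inv_pow, hsq]
  have hfrac : ∀ i, w i * (1 + w i)⁻¹ ≤ 1 := by
    intro i
    have := hw i
    rw [mul_inv_le_iff₀ (by positivity)]
    linarith
  have hterm : ∀ f i, w i * ‖inner ℂ (e i) (S f)‖ ^ 2 ≤ ‖inner ℂ (e i) f‖ ^ 2 := by
    intro f i
    rw [hSn, ← mul_assoc]
    exact mul_le_of_le_one_left (by positivity) (hfrac i)
  have hsum : ∀ f, Summable fun i => w i * ‖inner ℂ (e i) (S f)‖ ^ 2 := fun f =>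
    Summable.of_nonneg_of_le (fun i => mul_nonneg (hw i) (by positivity)) (hterm f)
      (e.hasSum_norm_inner_sq f).summable
  have hSD : ∀ f, S f ∈ D := fun f => (hD _).2 (hsum f)
  have hsurj : ∀ u ∈ D, ∃ f, S f = u := by
    intro u hu
    have : Summable fun i => ‖(√(1 + w i) : ℂ) * inner ℂ (e i) u‖ ^ 2 := by
      refine ((e.hasSum_norm_inner_sq u).summable.add ((hD u).1 hu)).congr fun i => ?_
      rw [norm_mul, mul_pow, Complex.norm_real, Real.norm_eq_abs, sq_abs, hsq]
      ring
    obtain ⟨f, hf⟩ := e.exists_inner_eq this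
    refine ⟨f, e.ext_inner fun i => ?_⟩
    rw [HilbertBasis.inner_diag, hf, ← mul_assoc]
    have : (√(1 + w i) : ℂ) ≠ 0 := by exact_mod_cast (hpos i).ne'
    push_cast
    rw [inv_mul_cancel₀ this, one_mul]
  have hle : ∀ f, ∑' i, w i * ‖inner ℂ (e i) (S f)‖ ^ 2 ≤ ‖f‖ ^ 2 := fun f =>
    hasSum_le (hterm f) (hsum f).hasSum (e.hasSum_norm_inner_sq f)
  let G : H →L[ℂ] K := LinearMap.mkContinuous (T ∘ₗ (S : H →ₗ[ℂ] H).codRestrict D hSD) (√M)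
    (fun f => by
      refine abs_le_of_sq_le_sq' ?_ (by positivity) |>.2
      rw [mul_pow, Real.sq_sqrt hM]
      exact (hup ⟨S f, hSD f⟩).trans (mul_le_mul_of_nonneg_left (hle f) hM))
  have hG : ∀ f, G f = T ⟨S f, hSD f⟩ := fun f => rfl
  obtain ⟨ι', b, l, h1, h2, h3⟩ := exists_eigenbasis_of_gram (G := G) hSc (e.diag_symm _ _ _)
    (fun x y hxy => e.ext_inner fun i => by
      have := congrArg (fun z => inner ℂ (e i) z) hxy
      simp only [S, HilbertBasis.inner_diag] at this
      have h0 : (((√(1 + w i))⁻¹ : ℝ) : ℂ) ≠ 0 := by exact_mod_cast (inv_pos.2 (hpos i)).ne'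
      exact mul_left_cancel₀ h0 this)
    -- Coercivity holds mode by mode: m w + 1 ≥ min(m, 1)(1 + w).
    (c := min m 1) (lt_min hm one_pos) (fun f => by
      have a1 := hlow ⟨S f, hSD f⟩
      rw [← hG] at a1
      simp only at a1
      refine le_trans ?_ (add_le_add_left a1 _)
      have a2 := ((hsum f).hasSum.mul_left m).add (e.hasSum_norm_inner_sq (S f))
      refine hasSum_le (fun i => ?_) ((e.hasSum_norm_inner_sq f).mul_left (min m 1)) a2
      rw [hSn]
      have hwi := hw i
      have a3 : min m 1 * (1 + w i) ≤ m * w i + 1 := by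
        nlinarith [min_le_left m 1, min_le_right m 1]
      have a4 : min m 1 ≤ (m * w i + 1) * (1 + w i)⁻¹ := by
        rwa [← div_eq_mul_inv, le_div_iff₀ (by positivity)]
      calc min m 1 * ‖inner ℂ (e i) f‖ ^ 2
          ≤ ((m * w i + 1) * (1 + w i)⁻¹) * ‖inner ℂ (e i) f‖ ^ 2 := by gcongr
        _ = _ := by ring)
  refine ⟨ι', b, l, h1, fun u g => ?_, fun u κ hκ hu hne => ?_⟩
  · rw [← h2]
    constructor
    · rintro ⟨hu, hv⟩
      obtain ⟨f, hf⟩ := hsurj u hu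
      refine ⟨f, hf, fun h => ?_⟩
      have := hv ⟨S h, hSD h⟩
      subst hf
      exact this
    · rintro ⟨f, rfl, hf⟩
      refine ⟨hSD f, fun v => ?_⟩
      obtain ⟨v, hv⟩ := v
      obtain ⟨h, rfl⟩ := hsurj v hv
      exact hf h
  · obtain ⟨u, hu'⟩ := u
    obtain ⟨f, rfl⟩ := hsurj u hu'
    exact h3 f κ hκ hu hne

end Resolvent

/-! ### Abstract perturbation theory at the spectral threshold. -/

section Threshold

universe u

variable {H : Type u} {K : Type*} [NormedAddCommGroup H] [InnerProductSpace ℂ H]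
  [NormedAddCommGroup K] [InnerProductSpace ℂ K] {D : Submodule ℂ H} {T : D →ₗ[ℂ] K}

/-- Two rank-one orthogonal projections are close when the unit vectors are close. -/
theorem norm_rankOne_sub_rankOne_le {φ o ψ u : H} {c : ℂ} (ho : ‖o‖ = 1) (hφ : ‖φ‖ = 1)
    (hψ : φ = c • o + ψ) (hort : inner ℂ o ψ = 0) :
    ‖inner ℂ φ u • φ - inner ℂ o u • o‖ ≤ 3 * ‖ψ‖ * ‖u‖ ∧ ‖c‖ ^ 2 + ‖ψ‖ ^ 2 = 1 := by
  have hpyth : ‖c‖ ^ 2 + ‖ψ‖ ^ 2 = 1 := by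
    have h := norm_add_sq_eq_norm_sq_add_norm_sq_of_inner_eq_zero (c • o) ψ
      (by rw [inner_smul_left, hort, mul_zero])
    rw [← hψ, norm_smul, hφ, ho] at h
    nlinarith
  refine ⟨?_, hpyth⟩
  have hc : ‖c‖ ≤ 1 := by nlinarith [norm_nonneg c, sq_nonneg ‖ψ‖]
  have hψ1 : ‖ψ‖ ≤ 1 := by nlinarith [norm_nonneg ψ, sq_nonneg ‖c‖]
  have hcc : (starRingEnd ℂ c) * c = 1 - ((‖ψ‖ ^ 2 : ℝ) : ℂ) := by
    rw [Complex.conj_mul', ← Complex.ofReal_pow, ← Complex.ofReal_one, ← Complex.ofReal_sub]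
    congr 1
    linarith
  -- Since |c|² - 1 = -‖ψ‖², the coefficients of `o` combine so that each of the three remaining
  -- terms carries a factor ψ; this is the 3 in the bound.
  have hdec : inner ℂ φ u • φ - inner ℂ o u • o =
      inner ℂ φ u • ψ + (c * inner ℂ ψ u) • o - (((‖ψ‖ ^ 2 : ℝ) : ℂ) * inner ℂ o u) • o := by
    have h1 : inner ℂ φ u = starRingEnd ℂ c * inner ℂ o u + inner ℂ ψ u := by
      rw [hψ, inner_add_left, inner_smul_left]
    have h2 : inner ℂ φ u • φ = inner ℂ φ u • ψ + (inner ℂ φ u * c) • o := by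
      conv_lhs => rw [hψ, smul_add, smul_smul, ← hψ]
      rw [add_comm]
    rw [h2, add_sub_assoc, add_sub_assoc, ← sub_smul, ← sub_smul]
    congr 2
    rw [h1]
    linear_combination (inner ℂ o u) * hcc
  rw [hdec]
  have b1 : ‖inner ℂ φ u • ψ‖ ≤ ‖ψ‖ * ‖u‖ := by
    rw [norm_smul, mul_comm]
    have := norm_inner_le_norm (𝕜 := ℂ) φ u
    rw [hφ, one_mul] at this
    gcongr
  have b2 : ‖(c * inner ℂ ψ u) • o‖ ≤ ‖ψ‖ * ‖u‖ := by
    rw [norm_smul, norm_mul, ho, mul_one]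
    have := norm_inner_le_norm (𝕜 := ℂ) ψ u
    calc ‖c‖ * ‖inner ℂ ψ u‖ ≤ 1 * (‖ψ‖ * ‖u‖) := by gcongr
      _ = _ := one_mul _
  have b3 : ‖(((‖ψ‖ ^ 2 : ℝ) : ℂ) * inner ℂ o u) • o‖ ≤ ‖ψ‖ * ‖u‖ := by
    rw [norm_smul, norm_mul, ho, mul_one, Complex.norm_real, Real.norm_eq_abs,
      abs_of_nonneg (by positivity)]
    have := norm_inner_le_norm (𝕜 := ℂ) o u
    rw [ho, one_mul] at this
    have h2 : ‖ψ‖ ^ 2 ≤ ‖ψ‖ := by nlinarith [norm_nonneg ψ]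
    gcongr
  calc _ ≤ ‖inner ℂ φ u • ψ‖ + ‖(c * inner ℂ ψ u) • o‖ +
        ‖(((‖ψ‖ ^ 2 : ℝ) : ℂ) * inner ℂ o u) • o‖ :=
        (norm_sub_le _ _).trans (by gcongr; exact norm_add_le _ _)
    _ ≤ _ := by linarith

theorem inner_of_mem_formGraph {φ g : H} (h : (φ, g) ∈ formGraph T) (v : D) :
    inner ℂ (T v) (T ⟨φ, h.1⟩) = inner ℂ (v : H) g := h.2 v

/-- Below `Λ / 3` there is at most one eigenvalue if the form is at least `Λ` on the orthogonal
complement of a vector. -/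
theorem eigenvalue_unique {ι : Type*} {b : HilbertBasis ι ℂ H} {l : ι → ℝ} {Λ : ℝ} (hΛ : 0 < Λ)
    (hgr : ∀ i, (b i, (l i : ℂ) • b i) ∈ formGraph T) {o : H}
    (hgap : ∀ v : D, inner ℂ o (v : H) = 0 → Λ * ‖(v : H)‖ ^ 2 ≤ ‖T v‖ ^ 2) {i j : ι}
    (hi : l i ≤ Λ / 3) (hj : l j ≤ Λ / 3) : i = j := by
  classical
  by_contra hij
  let B : ι → D := fun k => ⟨b k, (hgr k).1⟩
  have hB : ∀ k (v : D), inner ℂ (T v) (T (B k)) = l k * inner ℂ (v : H) (b k) := by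
    intro k v
    rw [← inner_smul_right]
    exact inner_of_mem_formGraph (hgr k) v
  have hort := orthonormal_iff_ite.1 b.orthonormal
  have key : ∀ p q : ℂ, inner ℂ o ((p • B i + q • B j : D) : H) = 0 → p = 0 ∧ q = 0 := by
    intro p q h0
    have h1 := hgap _ h0
    have h2 : ‖T (p • B i + q • B j)‖ ^ 2 = l i * ‖p‖ ^ 2 + l j * ‖q‖ ^ 2 := by
      apply Complex.ofReal_injective
      have := inner_self_eq_norm_sq_to_K (𝕜 := ℂ) (T (p • B i + q • B j))
      push_cast
      refine this.symm.trans ?_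
      conv_lhs => rw [map_add, map_smul, map_smul, inner_add_right, inner_smul_right,
        inner_smul_right, ← map_smul, ← map_smul, ← map_add, hB, hB]
      simp only [B, Submodule.coe_add, Submodule.coe_smul, inner_add_left, inner_smul_left, hort,
        if_neg hij, if_neg (Ne.symm hij), if_true, mul_one, mul_zero, add_zero, zero_add]
      rw [← Complex.mul_conj', ← Complex.mul_conj']
      ring
    have h3 : ‖((p • B i + q • B j : D) : H)‖ ^ 2 = ‖p‖ ^ 2 + ‖q‖ ^ 2 := by
      have := norm_add_sq_eq_norm_sq_add_norm_sq_of_inner_eq_zero (𝕜 := ℂ) (p • b i) (q • b j)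
        (by rw [inner_smul_left, inner_smul_right, hort, if_neg hij]; simp)
      simp only [norm_smul, b.orthonormal.1, mul_one] at this
      simp only [B, Submodule.coe_add, Submodule.coe_smul]
      nlinarith
    rw [h2, h3] at h1
    have h4 : ‖p‖ ^ 2 + ‖q‖ ^ 2 ≤ 0 := by
      have : l i * ‖p‖ ^ 2 + l j * ‖q‖ ^ 2 ≤ Λ / 3 * ‖p‖ ^ 2 + Λ / 3 * ‖q‖ ^ 2 := by gcongr
      by_contra! hc
      nlinarith
    constructor
    · have : ‖p‖ ^ 2 = 0 := le_antisymm (by nlinarith [sq_nonneg ‖q‖]) (by positivity)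
      simpa using this
    · have : ‖q‖ ^ 2 = 0 := le_antisymm (by nlinarith [sq_nonneg ‖p‖]) (by positivity)
      simpa using this
  -- This combination of the two eigenvectors is orthogonal to `o`, where the gap `Λ` contradicts
  -- eigenvalues at most `Λ / 3` unless both coefficients vanish. Then `b i` itself is orthogonal to
  -- `o`, and `key 1 0` is absurd.
  have h1 := key (inner ℂ o (b j)) (-inner ℂ o (b i)) (by
    simp only [B, Submodule.coe_add, Submodule.coe_smul, inner_add_right, inner_smul_right]
    ring)
  have h2 := key 1 0 (by
    have : inner ℂ o (b i) = 0 := by simpa using h1.2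
    simp [B, this])
  exact one_ne_zero h2.1

/-- The constant in the threshold approximation. -/
def thresholdConst (Λ C₁ C₂ C₃ : ℝ) : ℝ :=
  -- For the part ψ of the eigenvector orthogonal to `o`: `‖T ψ‖ ≤ A ρ` and `‖ψ‖ ≤ B ρ`. The four
  -- terms below come from changing the projection, from the eigenvalue shift when `B ρ` is small,
  -- from the same shift when it is large, and from replacing `‖T o‖²` by `q`.
  let A := 3 / 2 * C₁ * (1 + 1 / √Λ)
  let B := A / √Λ
  3 * C₃ * B + 2 * C₁ * (A + B) + 4 * Λ / 3 * B ^ 2 + C₂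

/-- Write φ = c o + ψ with ψ ⟂ o. The eigenvalue equation tested with ψ gives ‖Tψ‖² - l‖ψ‖² = -c(Tψ,
To); the gap absorbs l‖ψ‖², and the weak coupling `happ` makes ψ of order ρ. Tested with `o` it
gives c(l - ‖To‖²) = (To, Tψ), where the coupling and ψ contribute one factor ρ each. -/
theorem eigenpair_estimates {Λ C₁ ρ : ℝ} (hΛ : 0 < Λ) (hC₁ : 0 ≤ C₁)
    (hρ : 0 ≤ ρ) {o : D} (ho : ‖(o : H)‖ = 1)
    (hgap : ∀ v : D, inner ℂ (o : H) (v : H) = 0 → Λ * ‖(v : H)‖ ^ 2 ≤ ‖T v‖ ^ 2)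
    (happ : ∀ v : D, ‖inner ℂ (T v) (T o)‖ ≤ C₁ * ρ * (‖T v‖ + ‖(v : H)‖))
    (hlow : ‖T o‖ ^ 2 ≤ Λ / 3) {φ : H} {l : ℝ} (hφ : ‖φ‖ = 1) (hl0 : 0 ≤ l) (hl : l ≤ Λ / 3)
    (hgr : (φ, (l : ℂ) • φ) ∈ formGraph T) {A B : ℝ} (hA : A = 3 / 2 * C₁ * (1 + 1 / √Λ))
    (hB : B = A / √Λ) :
    (∀ u, ‖inner ℂ φ u • φ - inner ℂ (o : H) u • (o : H)‖ ≤ 3 * (B * ρ) * ‖u‖) ∧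
      |l - ‖T o‖ ^ 2| ≤ (2 * C₁ * (A + B) + 4 * Λ / 3 * B ^ 2) * ρ ^ 2 := by
  let φD : D := ⟨φ, hgr.1⟩
  set c : ℂ := inner ℂ (o : H) φ with hc
  let ψ : D := φD - c • o
  have hψ : φ = c • (o : H) + (ψ : H) := by simp [ψ, φD]
  have hφψ : φD = c • o + ψ := by simp [ψ]
  have hort : inner ℂ (o : H) (ψ : H) = 0 := by
    simp only [ψ, φD, Submodule.coe_sub, Submodule.coe_smul, inner_sub_right, inner_smul_right,
      inner_self_eq_norm_sq_to_K, ho, ← hc]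
    simp
  have hort' : inner ℂ (ψ : H) (o : H) = 0 := by rw [← inner_conj_symm, hort, map_zero]
  have hsL : 0 < √Λ := Real.sqrt_pos.2 hΛ
  have hsL2 : √Λ ^ 2 = Λ := Real.sq_sqrt hΛ.le
  have hA0 : 0 ≤ A := by rw [hA]; positivity
  have hB0 : 0 ≤ B := by rw [hB]; positivity
  have hpy := (norm_rankOne_sub_rankOne_le (u := φ) ho hφ hψ hort).2
  have hc1 : ‖c‖ ≤ 1 := by nlinarith [norm_nonneg c, sq_nonneg ‖(ψ : H)‖]
  set t := ‖T ψ‖ with ht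
  set s := ‖(ψ : H)‖ with hs
  have ht0 : 0 ≤ t := norm_nonneg _
  have hs0 : 0 ≤ s := norm_nonneg _
  have hst : s ≤ t / √Λ := by
    rw [le_div_iff₀ hsL]
    refine abs_le_of_sq_le_sq' ?_ ht0 |>.2
    rw [mul_pow, hsL2, mul_comm]
    exact hgap ψ hort
  have e1 : (t ^ 2 - l * s ^ 2 : ℝ) = -(c * inner ℂ (T ψ) (T o)) := by
    have h1 := inner_of_mem_formGraph hgr ψ
    change inner ℂ (T ψ) (T φD) = _ at h1
    have h2 : inner ℂ (T ψ) (T φD) = c * inner ℂ (T ψ) (T o) + ((t ^ 2 : ℝ) : ℂ) := by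
      rw [hφψ, map_add, map_smul, inner_add_right, inner_smul_right,
        inner_self_eq_norm_sq_to_K (𝕜 := ℂ) (T ψ)]
      push_cast
      rfl
    have h3 : inner ℂ (ψ : H) ((l : ℂ) • φ) = ((l * s ^ 2 : ℝ) : ℂ) := by
      rw [hψ, inner_smul_right, inner_add_right, inner_smul_right, hort', mul_zero, zero_add,
        inner_self_eq_norm_sq_to_K]
      push_cast
      rfl
    rw [h2, h3] at h1
    push_cast at h1 ⊢
    linear_combination h1
  have e2 : t ^ 2 - l * s ^ 2 ≤ C₁ * ρ * (t + s) := by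
    refine le_trans ?_ (happ ψ)
    have h := congrArg norm e1
    rw [Complex.norm_real, norm_neg, norm_mul] at h
    calc t ^ 2 - l * s ^ 2 ≤ ‖t ^ 2 - l * s ^ 2‖ := Real.le_norm_self _
      _ = ‖c‖ * ‖inner ℂ (T ψ) (T o)‖ := h
      _ ≤ 1 * ‖inner ℂ (T ψ) (T o)‖ := by gcongr
      _ = _ := one_mul _
  -- The gap and l ≤ Λ/3 leave at least 2/3 of t² on the left of `e2`; hence the 3/2 in `A`.
  have hls : l * s ^ 2 ≤ t ^ 2 / 3 := by
    have h1 : Λ * s ^ 2 ≤ t ^ 2 := hgap ψ hort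
    nlinarith [sq_nonneg s]
  have htA : t ≤ A * ρ := by
    rcases eq_or_lt_of_le ht0 with h0 | h0
    · rw [← h0]; positivity
    · have h1 : t * t ≤ t * (A * ρ) := by
        have : t + s ≤ t * (1 + 1 / √Λ) := by
          rw [mul_add, mul_one, mul_one_div]; linarith
        have h2 : C₁ * ρ * (t + s) ≤ C₁ * ρ * (t * (1 + 1 / √Λ)) := by gcongr
        rw [hA]
        nlinarith
      exact le_of_mul_le_mul_left h1 h0
  have hsB : s ≤ B * ρ := by
    refine hst.trans ?_
    rw [hB, div_mul_eq_mul_div]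
    gcongr
  refine ⟨fun u => ?_, ?_⟩
  · refine (norm_rankOne_sub_rankOne_le (u := u) ho hφ hψ hort).1.trans ?_
    gcongr
  -- Dividing by `c` in the equation tested with `o` requires |c| to be bounded below.
  · by_cases hsmall : B * ρ ≤ 1 / 2
    · have hch : 1 / 2 ≤ ‖c‖ := by
        have : s ≤ 1 / 2 := hsB.trans hsmall
        nlinarith [norm_nonneg c]
      have e3 : c * ((l - ‖T o‖ ^ 2 : ℝ) : ℂ) = inner ℂ (T o) (T ψ) := by
        have h1 := inner_of_mem_formGraph hgr o
        change inner ℂ (T o) (T φD) = _ at h1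
        rw [hφψ, map_add, map_smul, inner_add_right, inner_smul_right, inner_smul_right, ← hc,
          inner_self_eq_norm_sq_to_K (𝕜 := ℂ) (T o)] at h1
        push_cast
        have h2 : ((RCLike.ofReal ‖T o‖ : ℂ)) = (‖T o‖ : ℂ) := rfl
        rw [h2] at h1
        linear_combination -h1
      have e4 := congrArg norm e3
      rw [norm_mul, Complex.norm_real, Real.norm_eq_abs] at e4
      have e5 := happ ψ
      rw [norm_inner_symm, ← e4] at e5
      have e6 : 1 / 2 * |l - ‖T o‖ ^ 2| ≤ C₁ * ρ * (A * ρ + B * ρ) :=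
        calc 1 / 2 * |l - ‖T o‖ ^ 2| ≤ ‖c‖ * |l - ‖T o‖ ^ 2| := by gcongr
          _ ≤ C₁ * ρ * (t + s) := e5
          _ ≤ _ := by gcongr
      have h0 : 0 ≤ 4 * Λ / 3 * B ^ 2 * ρ ^ 2 := by positivity
      have h1 : C₁ * ρ * (A * ρ + B * ρ) = C₁ * (A + B) * ρ ^ 2 := by ring
      rw [h1] at e6
      rw [add_mul]
      linarith
    -- For large ρ the trivial bound suffices: both numbers lie in [0, Λ/3], and 1 ≤ 4(Bρ)².
    · push Not at hsmall
      have h1 : 1 ≤ 4 * (B ^ 2 * ρ ^ 2) := by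
        have : 1 / 2 * (1 / 2) ≤ (B * ρ) * (B * ρ) := by gcongr
        nlinarith
      have h2 : |l - ‖T o‖ ^ 2| ≤ Λ / 3 := by
        have h0 : 0 ≤ ‖T o‖ ^ 2 := by positivity
        rw [abs_le]
        constructor <;> linarith
      have h3 : 0 ≤ 2 * C₁ * (A + B) * ρ ^ 2 := by positivity
      have h4 : Λ / 3 * 1 ≤ Λ / 3 * (4 * (B ^ 2 * ρ ^ 2)) := by gcongr
      calc |l - ‖T o‖ ^ 2| ≤ Λ / 3 * (4 * (B ^ 2 * ρ ^ 2)) := by linarith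
        _ ≤ _ := by rw [add_mul]; linarith

variable [CompleteSpace H] in
/-- The threshold approximation for the operator of the form `‖T u‖²`. -/
theorem threshold_approximation {ι : Type*} {b : HilbertBasis ι ℂ H} {l : ι → ℝ}
    (hl : ∀ i, 0 ≤ l i)
    (hgr : ∀ u g, (u, g) ∈ formGraph T ↔ ∀ i, inner ℂ (b i) g = l i * inner ℂ (b i) u)
    (hex : ∀ (u : D) κ, 0 ≤ κ → ‖T u‖ ^ 2 ≤ κ * ‖(u : H)‖ ^ 2 → (u : H) ≠ 0 → ∃ i, l i ≤ κ)
    {Λ C₁ C₂ C₃ ρ q : ℝ} (hΛ : 0 < Λ) (hC₁ : 0 ≤ C₁) (hC₃ : 0 ≤ C₃)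
    (hρ : 0 ≤ ρ) {o : D} (ho : ‖(o : H)‖ = 1)
    (hgap : ∀ v : D, inner ℂ (o : H) (v : H) = 0 → Λ * ‖(v : H)‖ ^ 2 ≤ ‖T v‖ ^ 2)
    (happ : ∀ v : D, ‖inner ℂ (T v) (T o)‖ ≤ C₁ * ρ * (‖T v‖ + ‖(v : H)‖))
    (hlow : ‖T o‖ ^ 2 ≤ Λ / 3) (hlow' : ‖T o‖ ^ 2 ≤ C₃ * ρ)
    (hq : |‖T o‖ ^ 2 - q| ≤ C₂ * ρ ^ 2)
    {E : ProjectionMeasure H} (hE : E.IsSpectralMeasureOf (formGraph T)) (u : H) :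
    ∃ f, (E.proj (Icc 0 (Λ / 3)) u, f) ∈ formGraph T ∧
      ‖f - (q : ℂ) • inner ℂ (o : H) u • (o : H)‖ ≤
        thresholdConst Λ C₁ C₂ C₃ * ρ ^ 2 * ‖u‖ := by
  classical
  have hort := orthonormal_iff_ite.1 b.orthonormal
  have heig : ∀ i, (b i, (l i : ℂ) • b i) ∈ formGraph T := by
    intro i
    rw [hgr]
    intro j
    rw [inner_smul_right, hort]
    split_ifs with h
    · rw [h]
    · simp
  -- The vector `o` is the trial vector that produces an eigenvalue in the interval.
  obtain ⟨i₀, hi₀⟩ := hex o (‖T o‖ ^ 2) (by positivity) (by rw [ho]; simp)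
    (by intro h; rw [h] at ho; simp at ho)
  have hi₁ := hi₀.trans hlow
  -- By self-adjointness the projection is tested on the eigenvectors; it fixes `b i₀` and, as no
  -- second eigenvalue lies in the interval, kills the others.
  have hF : E.proj (Icc 0 (Λ / 3)) u = inner ℂ (b i₀) u • b i₀ := by
    refine b.ext_inner fun i => ?_
    have hsa := (E.isStarProjection (Icc 0 (Λ / 3)) measurableSet_Icc).isSelfAdjoint
    rw [ContinuousLinearMap.isSelfAdjoint_iff_isSymmetric] at hsa
    have h1 : inner ℂ (b i) (E.proj (Icc 0 (Λ / 3)) u) =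
        inner ℂ (E.proj (Icc 0 (Λ / 3)) (b i)) u := (hsa (b i) u).symm
    rw [h1, hE.proj_eigenvector (heig i) measurableSet_Icc, inner_smul_right, hort]
    by_cases h : i = i₀
    · subst h
      rw [indicator_of_mem (show l i ∈ Icc 0 (Λ / 3) from ⟨hl i, hi₁⟩)]
      simp
    · rw [indicator_of_notMem (fun hm => h (eigenvalue_unique hΛ heig hgap hm.2 hi₁)), if_neg h]
      simp
  obtain ⟨hP, hL⟩ := eigenpair_estimates hΛ hC₁ hρ ho hgap happ hlow (b.orthonormal.1 i₀)
    (hl i₀) hi₁ (heig i₀) rfl rfl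
  refine ⟨(l i₀ : ℂ) • inner ℂ (b i₀) u • b i₀, ?_, ?_⟩
  · rw [hF, hgr]
    intro j
    rw [inner_smul_right, inner_smul_right, hort]
    split_ifs with h
    · rw [h]
    · simp
  · have hdec : (l i₀ : ℂ) • inner ℂ (b i₀) u • b i₀ - (q : ℂ) • inner ℂ (o : H) u • (o : H) =
        (l i₀ : ℂ) • (inner ℂ (b i₀) u • b i₀ - inner ℂ (o : H) u • (o : H)) +
          ((l i₀ - q : ℝ) : ℂ) • inner ℂ (o : H) u • (o : H) := by
      push_cast
      rw [smul_sub, sub_smul]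
      abel
    have hou : ‖inner ℂ (o : H) u • (o : H)‖ ≤ ‖u‖ := by
      rw [norm_smul, ho, mul_one]
      simpa [ho] using norm_inner_le_norm (𝕜 := ℂ) (o : H) u
    rw [hdec]
    refine (norm_add_le _ _).trans ?_
    rw [norm_smul, norm_smul, Complex.norm_real, Complex.norm_real, Real.norm_eq_abs,
      Real.norm_eq_abs, abs_of_nonneg (hl i₀)]
    have h1 := mul_le_mul (hi₀.trans hlow') (hP u) (norm_nonneg _) (by positivity)
    have h2 : |l i₀ - q| ≤ |l i₀ - ‖T o‖ ^ 2| + |‖T o‖ ^ 2 - q| := abs_sub_le _ _ _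
    have h3 := mul_le_mul (h2.trans (add_le_add hL hq)) hou (norm_nonneg _)
      ((abs_nonneg _).trans (h2.trans (add_le_add hL hq)))
    refine (add_le_add h1 h3).trans_eq ?_
    simp only [thresholdConst]
    ring

end Threshold

variable {d : ℕ}

/-! ### The torus -/

/-- Reduction of a point modulo `ℤ^d` to the cell. -/
def wrap (x : Space d) : Space d := WithLp.toLp 2 fun i => Int.fract (x i)

theorem periodicExt_eq (u : Space d → ℂ) (x : Space d) : periodicExt u x = u (wrap x) := rfl

theorem wrap_apply (x : Space d) (i : Fin d) : wrap x i = Int.fract (x i) := rfl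

theorem wrap_mem (x : Space d) : wrap x ∈ cell d := fun _ =>
  ⟨Int.fract_nonneg _, Int.fract_lt_one _⟩

theorem wrap_of_mem {x : Space d} (hx : x ∈ cell d) : wrap x = x := by
  ext i
  exact Int.fract_eq_self.2 (hx i)

theorem exists_eq_wrap_add (x : Space d) : ∃ n : Fin d → ℤ, x = wrap x + latticeVec n :=
  ⟨fun i => ⌊x i⌋, by ext i; simp [wrap_apply, latticeVec, Int.fract_add_floor]⟩

theorem wrap_add_latticeVec (x : Space d) (n : Fin d → ℤ) : wrap (x + latticeVec n) = wrap x := by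
  ext i
  simp [wrap_apply, latticeVec]

@[fun_prop]
theorem measurable_wrap : Measurable (wrap : Space d → Space d) := by
  refine (PiLp.volume_preserving_toLp (Fin d)).measurable.comp ?_
  refine measurable_pi_lambda _ fun i => measurable_fract.comp ?_
  fun_prop

theorem measurableSet_cell : MeasurableSet (cell d) := by
  have : cell d = ⋂ i, (fun x : Space d => x i) ⁻¹' Ico (0 : ℝ) 1 := by
    ext x; simp [cell]
  rw [this]
  exact MeasurableSet.iInter fun i => (by fun_prop : Measurable fun x : Space d => x i)
    measurableSet_Ico

/-- The Haar measure on the torus `(ℝ/ℤ)^d`. -/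
def torusMeasure (d : ℕ) : Measure (Fin d → UnitAddCircle) :=
  Measure.pi fun _ => AddCircle.haarAddCircle

instance : (torusMeasure d).IsAddLeftInvariant := by
  unfold torusMeasure; infer_instance

instance : IsProbabilityMeasure (torusMeasure d) := by
  unfold torusMeasure; infer_instance

/-- The representative in `[0,1)` of a point of the circle. -/
def circleLift (t : UnitAddCircle) : ℝ := (AddCircle.equivIco 1 0 t : ℝ)

theorem circleLift_coe (x : ℝ) : circleLift (x : UnitAddCircle) = Int.fract x := by
  simp [circleLift]

theorem coe_circleLift (t : UnitAddCircle) : ((circleLift t : ℝ) : UnitAddCircle) = t :=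
  AddCircle.coe_equivIco

theorem measurable_circleLift : Measurable circleLift :=
  measurable_subtype_coe.comp (AddCircle.measurableEquivIco 1 0).measurable

theorem measurePreserving_circleLift :
    MeasurePreserving circleLift AddCircle.haarAddCircle (volume.restrict (Ico (0 : ℝ) 1)) := by
  have h := AddCircle.measurePreserving_mk 1 0
  have hv : (volume : Measure (AddCircle (1 : ℝ))) = AddCircle.haarAddCircle := by
    rw [AddCircle.volume_eq_smul_haarAddCircle]
    simp
  rw [hv, zero_add, Measure.restrict_congr_set Ico_ae_eq_Ioc.symm] at h
  refine ⟨measurable_circleLift, ?_⟩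
  rw [← h.map_eq, Measure.map_map measurable_circleLift h.measurable]
  have : circleLift ∘ ((↑) : ℝ → AddCircle (1 : ℝ)) =ᵐ[volume.restrict (Ico (0 : ℝ) 1)] id := by
    filter_upwards [ae_restrict_mem measurableSet_Ico] with x hx
    simp only [Function.comp_apply, id]
    exact (circleLift_coe x).trans (Int.fract_eq_self.2 hx)
  rw [Measure.map_congr this, Measure.map_id]

/-- The representative in the cell of a point of the torus. -/
def torusLift (t : Fin d → UnitAddCircle) : Space d := WithLp.toLp 2 fun i => circleLift (t i)

theorem measurePreserving_torusLift :
    MeasurePreserving (torusLift (d := d)) (torusMeasure d) (volume.restrict (cell d)) := by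
  have h1 : MeasurePreserving (fun (t : Fin d → UnitAddCircle) i => circleLift (t i))
      (torusMeasure d) (Measure.pi fun _ => volume.restrict (Ico (0 : ℝ) 1)) :=
    measurePreserving_pi _ _ fun i => measurePreserving_circleLift
  rw [← Measure.restrict_pi_pi] at h1
  have h2 := (PiLp.volume_preserving_toLp (Fin d)).restrict_preimage (measurableSet_cell (d := d))
  have h3 : WithLp.toLp 2 ⁻¹' (cell d) = Set.pi univ fun _ : Fin d => Ico (0 : ℝ) 1 := by
    ext x; simp [cell]
  rw [h3] at h2
  exact h2.comp h1

/-- Translation by `z` on the cell, modulo `ℤ^d`. -/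
theorem measurePreserving_wrap_add (z : Space d) :
    MeasurePreserving (fun x => wrap (x + z)) (volume.restrict (cell d))
      (volume.restrict (cell d)) := by
  have hq := measurePreserving_torusLift (d := d)
  refine ⟨by fun_prop, ?_⟩
  -- The lift conjugates translation modulo the lattice to a rotation of the torus, under which Haar
  -- measure is invariant.
  have hcomp : (fun x => wrap (x + z)) ∘ torusLift =
      torusLift ∘ fun t => (fun i => ((z i : ℝ) : UnitAddCircle)) + t := by
    ext t i
    simp only [Function.comp_apply, wrap_apply, torusLift, PiLp.add_apply, Pi.add_apply]
    rw [← circleLift_coe, AddCircle.coe_add, coe_circleLift, add_comm]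
  conv_lhs => rw [← hq.map_eq]
  rw [Measure.map_map (by fun_prop) hq.measurable, hcomp,
    ← Measure.map_map hq.measurable (measurable_const_add _), map_add_left_eq_self, hq.map_eq]

/-! ### Fourier series -/

/-- The frequency `2πn`. -/
def freq (n : Fin d → ℤ) : Space d := (2 * Real.pi) • latticeVec n

/-- The exponential `x ↦ e^{i⟨k,x⟩}`. -/
def expi (k x : Space d) : ℂ := Complex.exp (Complex.I * (inner ℝ k x : ℝ))

theorem norm_expi (k x : Space d) : ‖expi k x‖ = 1 := by
  rw [expi, mul_comm]
  exact Complex.norm_exp_ofReal_mul_I _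

theorem expi_add_right (k x y : Space d) : expi k (x + y) = expi k x * expi k y := by
  rw [expi, expi, expi, ← Complex.exp_add, inner_add_right]
  push_cast
  ring_nf

theorem expi_add_left (k l x : Space d) : expi (k + l) x = expi k x * expi l x := by
  rw [expi, expi, expi, ← Complex.exp_add, inner_add_left]
  push_cast
  ring_nf

@[fun_prop]
theorem measurable_expi (k : Space d) : Measurable (expi k) := by
  unfold expi; fun_prop

theorem expi_freq_latticeVec (n m : Fin d → ℤ) : expi (freq n) (latticeVec m) = 1 := by
  rw [expi, Complex.exp_eq_one_iff]
  refine ⟨∑ i, n i * m i, ?_⟩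
  simp only [freq, latticeVec, PiLp.inner_apply, PiLp.smul_apply, smul_eq_mul, RCLike.inner_apply,
    conj_trivial]
  push_cast
  simp only [Finset.mul_sum, Finset.sum_mul]
  exact Finset.sum_congr rfl fun i _ => by ring

theorem expi_freq_wrap (n : Fin d → ℤ) (x : Space d) : expi (freq n) (wrap x) = expi (freq n) x := by
  obtain ⟨m, hm⟩ := exists_eq_wrap_add x
  conv_rhs => rw [hm, expi_add_right, expi_freq_latticeVec, mul_one]

theorem mFourier_eq_expi (n : Fin d → ℤ) (t : Fin d → UnitAddCircle) :
    UnitAddTorus.mFourier n t = expi (freq n) (torusLift t) := by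
  simp only [UnitAddTorus.mFourier, ContinuousMap.coe_mk]
  have : ∀ i, fourier (n i) (t i) =
      Complex.exp (2 * Real.pi * Complex.I * n i * (circleLift (t i) : ℝ) / (1 : ℝ)) := by
    intro i
    rw [← fourier_coe_apply, coe_circleLift]
  simp only [this]
  rw [← Complex.exp_sum, expi]
  congr 1
  simp only [freq, latticeVec, torusLift, PiLp.inner_apply, PiLp.smul_apply, smul_eq_mul,
    RCLike.inner_apply, conj_trivial]
  push_cast
  simp only [Finset.mul_sum]
  exact Finset.sum_congr rfl fun i _ => by ring

theorem memLp_expi (k : Space d) : MemLp (expi k) 2 (volume.restrict (cell d)) :=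
  MemLp.of_bound (by fun_prop) 1 (Filter.Eventually.of_forall fun x => (norm_expi k x).le)

/-- The Fourier basis of `L₂(Ω)`. -/
theorem exists_fourierBasis (d : ℕ) : ∃ e : HilbertBasis (Fin d → ℤ) ℂ (L2Cell d),
    ∀ n, e n = (memLp_expi (freq n)).toLp _ := by
  obtain ⟨B, hB⟩ : ∃ B : HilbertBasis (Fin d → ℤ) ℂ (Lp ℂ 2 (torusMeasure d)),
      ∀ n, B n =ᵐ[torusMeasure d] UnitAddTorus.mFourier n :=
    ⟨UnitAddTorus.mFourierBasis, fun n => by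
      have := UnitAddTorus.coeFn_mFourierLp 2 n
      rw [← UnitAddTorus.coe_mFourierBasis] at this
      exact this⟩
  -- Orthonormality and completeness are pulled back along this isometry from the Fourier basis of
  -- the torus; surjectivity of `J` is not needed.
  let J : L2Cell d →ₗᵢ[ℂ] Lp ℂ 2 (torusMeasure d) :=
    Lp.compMeasurePreservingₗᵢ ℂ torusLift measurePreserving_torusLift
  let E : (Fin d → ℤ) → L2Cell d := fun n => (memLp_expi (freq n)).toLp _
  have hJ : ∀ n, J (E n) = B n := by
    intro n
    apply Lp.ext
    have h1 := Lp.coeFn_compMeasurePreserving (E n) (measurePreserving_torusLift (d := d))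
    have h2 := (measurePreserving_torusLift (d := d)).quasiMeasurePreserving.ae_eq_comp
      (memLp_expi (freq n)).coeFn_toLp
    filter_upwards [h1, h2, hB n] with t a1 a2 a3
    rw [a3, mFourier_eq_expi]
    exact a1.trans a2
  have hE : Orthonormal ℂ E := by
    rw [orthonormal_iff_ite]
    intro m n
    rw [← J.inner_map_map, hJ, hJ]
    exact orthonormal_iff_ite.1 B.orthonormal m n
  refine ⟨HilbertBasis.mkOfOrthogonalEqBot hE ?_, fun n => by
    rw [HilbertBasis.coe_mkOfOrthogonalEqBot]⟩
  rw [eq_bot_iff]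
  intro u hu
  have h0 : J u = 0 := B.ext_inner fun n => by
    rw [← hJ, J.inner_map_map, inner_zero_right]
    exact (Submodule.mem_orthogonal _ _).1 hu _ (Submodule.subset_span ⟨n, rfl⟩)
  have : u = 0 := J.injective (by rw [h0, map_zero])
  simpa using this

/-- The Fourier basis of `L₂(Ω)`, the exponentials `e^{2πi⟨n,x⟩}`. -/
def fourierBasis (d : ℕ) : HilbertBasis (Fin d → ℤ) ℂ (L2Cell d) := (exists_fourierBasis d).choose

theorem fourierBasis_apply (n : Fin d → ℤ) :
    fourierBasis d n = (memLp_expi (freq n)).toLp _ := (exists_fourierBasis d).choose_spec n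

theorem fourierBasis_zero : fourierBasis d 0 = oneCell d := by
  rw [fourierBasis_apply]
  apply Lp.ext
  filter_upwards [(memLp_expi (freq (0 : Fin d → ℤ))).coeFn_toLp,
    Lp.coeFn_const 2 (volume.restrict (cell d)) (1 : ℂ)] with x h1 h2
  rw [h1]
  refine Eq.trans ?_ h2.symm
  have : freq (0 : Fin d → ℤ) = 0 := by ext i; simp [freq, latticeVec]
  simp [expi, this]

theorem norm_oneCell : ‖oneCell d‖ = 1 := by
  rw [← fourierBasis_zero]
  exact (fourierBasis d).orthonormal.1 0

theorem projOne_apply (u : L2Cell d) : projOne d u = inner ℂ (oneCell d) u • oneCell d :=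
  Submodule.starProjection_unit_singleton ℂ norm_oneCell u

/-- Translation by `z` of a periodic function in `L₂(Ω)`. -/
def translate (z : Space d) : L2Cell d →ₗᵢ[ℂ] L2Cell d :=
  Lp.compMeasurePreservingₗᵢ ℂ _ (measurePreserving_wrap_add z)

theorem translate_ae (z : Space d) (u : L2Cell d) :
    translate z u =ᵐ[volume.restrict (cell d)] fun x => periodicExt u (x + z) :=
  Lp.coeFn_compMeasurePreserving u (measurePreserving_wrap_add z)

/-- Translation preserves inner products and multiplies each exponential by a phase. -/
theorem inner_fourierBasis_translate (z : Space d) (u : L2Cell d) (n : Fin d → ℤ) :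
    inner ℂ (fourierBasis d n) (translate z u) =
      expi (freq n) z * inner ℂ (fourierBasis d n) u := by
  have h1 : translate z (fourierBasis d n) = expi (freq n) z • fourierBasis d n := by
    apply Lp.ext
    rw [fourierBasis_apply]
    have h2 := (measurePreserving_wrap_add z).quasiMeasurePreserving.ae_eq_comp
      (memLp_expi (freq n)).coeFn_toLp
    filter_upwards [translate_ae z ((memLp_expi (freq n)).toLp _), h2,
      (memLp_expi (freq n)).coeFn_toLp,
      Lp.coeFn_smul (expi (freq n) z) ((memLp_expi (freq n)).toLp _)] with x a1 a2 a3 a4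
    rw [a1, a4, Pi.smul_apply, a3]
    refine Eq.trans a2 ?_
    simp only [Function.comp_apply, smul_eq_mul]
    rw [expi_freq_wrap, expi_add_right, mul_comm]
  have h2 := (translate z).inner_map_map (fourierBasis d n) u
  rw [h1, inner_smul_left] at h2
  rw [← h2, ← mul_assoc, Complex.mul_conj', norm_expi]
  simp

theorem norm_one_sub_expi_sq (k z : Space d) :
    ‖1 - expi k z‖ ^ 2 = 2 * (1 - Real.cos (inner ℝ k z)) := by
  have h : expi k z = Complex.exp ((inner ℝ k z : ℝ) * Complex.I) := by rw [expi, mul_comm]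
  rw [h, Complex.exp_mul_I, ← Complex.ofReal_cos, ← Complex.ofReal_sin, Complex.sq_norm,
    Complex.normSq_apply]
  simp only [Complex.sub_re, Complex.sub_im, Complex.add_re, Complex.add_im, Complex.one_re,
    Complex.one_im, Complex.mul_re, Complex.mul_im, Complex.ofReal_re, Complex.ofReal_im,
    Complex.I_re, Complex.I_im]
  nlinarith [Real.sin_sq_add_cos_sq (inner ℝ k z)]

/-- Parseval's identity for the twisted differences. -/
theorem lintegral_twisted_translate (ξ z : Space d) (u : L2Cell d) :
    ∫⁻ x in cell d, ENNReal.ofReal (‖u x - expi ξ z * periodicExt u (x + z)‖ ^ 2) =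
      ∑' n, ENNReal.ofReal (2 * (1 - Real.cos (inner ℝ (ξ + freq n) z))) *
        ENNReal.ofReal (‖inner ℂ (fourierBasis d n) u‖ ^ 2) := by
  -- The Fourier coefficients of `v` are (1 - e^{i⟨ξ+2πn,z⟩})û(n), and both sides of the claim
  -- compute ‖v‖².
  set v : L2Cell d := u - expi ξ z • translate z u with hv
  have h1 : ∫⁻ x in cell d, ENNReal.ofReal (‖u x - expi ξ z * periodicExt u (x + z)‖ ^ 2) =
      ENNReal.ofReal (‖v‖ ^ 2) := by
    have h2 : ENNReal.ofReal (‖v‖ ^ 2) = ∫⁻ x in cell d, ENNReal.ofReal (‖v x‖ ^ 2) := by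
      rw [Lp.norm_def, eLpNorm_eq_lintegral_rpow_enorm_toReal two_ne_zero ENNReal.ofNat_ne_top,
        ← ENNReal.toReal_pow, ENNReal.ofReal_toReal]
      · rw [← ENNReal.rpow_natCast, ← ENNReal.rpow_mul]
        simp [ENNReal.ofReal_pow, ofReal_norm]
      · have := (Lp.memLp v).2.ne
        rw [eLpNorm_eq_lintegral_rpow_enorm_toReal two_ne_zero ENNReal.ofNat_ne_top] at this
        exact ENNReal.pow_ne_top this
    rw [h2]
    refine lintegral_congr_ae ?_
    filter_upwards [translate_ae z u, Lp.coeFn_sub u (expi ξ z • translate z u),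
      Lp.coeFn_smul (expi ξ z) (translate z u)] with x a1 a2 a3
    rw [hv, a2, Pi.sub_apply, a3, Pi.smul_apply, a1, smul_eq_mul]
  rw [h1, ← ((fourierBasis d).hasSum_norm_inner_sq v).tsum_eq,
    ENNReal.ofReal_tsum_of_nonneg (fun i => by positivity)
      ((fourierBasis d).hasSum_norm_inner_sq v).summable]
  congr 1
  ext n
  have : inner ℂ (fourierBasis d n) v =
      (1 - expi (ξ + freq n) z) * inner ℂ (fourierBasis d n) u := by
    rw [hv, inner_sub_right, inner_smul_right, inner_fourierBasis_translate, expi_add_left]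
    ring
  rw [this, norm_mul, mul_pow, norm_one_sub_expi_sq, ENNReal.ofReal_mul]
  nlinarith [Real.cos_le_one (inner ℝ (ξ + freq n) z)]

/-! ### The rate and one-dimensional integrals -/

/-- The square root of the rate. -/
def sqrtRate (α r : ℝ) : ℝ :=
  if α < 1 then r ^ α else if α = 1 then r * (1 + |Real.log r|) else r

theorem sqrtRate_sq {α r : ℝ} (hr : 0 ≤ r) : sqrtRate α r ^ 2 = rate α r := by
  unfold sqrtRate rate
  split_ifs
  · rw [← Real.rpow_natCast, ← Real.rpow_mul hr, mul_comm α]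
    norm_num
  · ring
  · rfl

theorem sqrtRate_nonneg {α r : ℝ} (hr : 0 ≤ r) : 0 ≤ sqrtRate α r := by
  unfold sqrtRate
  split_ifs <;> positivity

/-- Serves to absorb the terms of order |ξ| into ρ. The range r ≤ 4 covers |ξ| ≤ π, and some upper
bound on r is necessary when α < 1. -/
theorem le_sqrtRate {α r : ℝ} (hα : 0 < α) (hr : 0 ≤ r) (hr' : r ≤ 4) :
    r ≤ 4 * sqrtRate α r := by
  unfold sqrtRate
  split_ifs with h1 h2
  · rcases hr.eq_or_lt with h0 | h0
    · rw [← h0]; positivity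
    · have e : r = r ^ (1 - α) * r ^ α := by rw [← Real.rpow_add h0]; simp
      have h4 : r ^ (1 - α) ≤ 4 := by
        calc r ^ (1 - α) ≤ 4 ^ (1 - α) := Real.rpow_le_rpow hr hr' (by linarith)
          _ ≤ 4 ^ (1 : ℝ) := Real.rpow_le_rpow_of_exponent_le (by norm_num) (by linarith)
          _ = 4 := by norm_num
      calc r = r ^ (1 - α) * r ^ α := e
        _ ≤ _ := by gcongr
  · nlinarith [abs_nonneg (Real.log r), mul_nonneg hr (abs_nonneg (Real.log r))]
  · linarith

/-- Makes the eigenvalue, which is of order |ξ|^α, of order ρ. -/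
theorem rpow_le_sqrtRate {α r : ℝ} (hα : 0 < α) (hα2 : α < 2) (hr : 0 ≤ r) (hr' : r ≤ 4) :
    r ^ α ≤ 4 * sqrtRate α r := by
  unfold sqrtRate
  split_ifs with h1 h2
  · have := Real.rpow_nonneg hr α
    linarith
  · rw [h2, Real.rpow_one]
    nlinarith [abs_nonneg (Real.log r), mul_nonneg hr (abs_nonneg (Real.log r))]
  · rcases hr.eq_or_lt with h0 | h0
    · rw [← h0, Real.zero_rpow hα.ne']; simp
    · have h3 : 1 < α := lt_of_le_of_ne (not_lt.1 h1) (Ne.symm h2)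
      have e : r ^ α = r ^ (α - 1) * r := by
        rw [← Real.rpow_add_one h0.ne']; simp
      have h4 : r ^ (α - 1) ≤ 4 := by
        calc r ^ (α - 1) ≤ 4 ^ (α - 1) := Real.rpow_le_rpow hr hr' (by linarith)
          _ ≤ 4 ^ (1 : ℝ) := Real.rpow_le_rpow_of_exponent_le (by norm_num) (by linarith)
          _ = 4 := by norm_num
      rw [e]
      gcongr

/-- Tool for splitting an integral at a cut-off, with a different majorant on each piece. -/
theorem setIntegral_le_of_le_indicator_add {f g h : ℝ → ℝ} {A B : Set ℝ} (hA : A ⊆ Ioi 0)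
    (hB : B ⊆ Ioi 0) (hAm : MeasurableSet A) (hBm : MeasurableSet B)
    (hf : IntegrableOn f (Ioi 0)) (hg : IntegrableOn g A) (hh : IntegrableOn h B)
    (hle : ∀ y, 0 < y → f y ≤ A.indicator g y + B.indicator h y) :
    ∫ y in Ioi 0, f y ≤ (∫ y in A, g y) + ∫ y in B, h y := by
  have h1 : Integrable (A.indicator g) (volume.restrict (Ioi 0)) := by
    rw [integrable_indicator_iff hAm]
    unfold IntegrableOn at *
    rw [Measure.restrict_restrict hAm, inter_eq_self_of_subset_left hA]
    exact hg
  have h2 : Integrable (B.indicator h) (volume.restrict (Ioi 0)) := by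
    rw [integrable_indicator_iff hBm]
    unfold IntegrableOn at *
    rw [Measure.restrict_restrict hBm, inter_eq_self_of_subset_left hB]
    exact hh
  have h3 := setIntegral_mono_on hf (h1.add h2) measurableSet_Ioi (fun y hy => hle y hy)
  refine h3.trans_eq ?_
  rw [integral_add' h1 h2, setIntegral_indicator hAm, setIntegral_indicator hBm,
    inter_eq_self_of_subset_right hA, inter_eq_self_of_subset_right hB]

/-- The radial profile of the kernel `min (2, r|z|) / |z|^{d+α}` on `|z| > 1`. -/
def tailProfile (α r y : ℝ) : ℝ := if 1 < y then min 2 (r * y) * y ^ (-1 - α) else 0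

theorem integrableOn_tailProfile {α r : ℝ} (hα : 0 < α) (hr : 0 < r) :
    IntegrableOn (tailProfile α r) (Ioi 0) := by
  have h1 : IntegrableOn (fun y : ℝ => 2 * y ^ (-1 - α)) (Ioi 1) :=
    (integrableOn_Ioi_rpow_of_lt (by linarith) one_pos).const_mul 2
  have h2 : Integrable ((Ioi (1 : ℝ)).indicator fun y : ℝ => 2 * y ^ (-1 - α)) :=
    (integrable_indicator_iff measurableSet_Ioi).2 h1
  have hm : Measurable (tailProfile α r) := by
    unfold tailProfile
    exact Measurable.ite measurableSet_Ioi (by fun_prop) measurable_const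
  refine (h2.mono hm.aestronglyMeasurable (Filter.Eventually.of_forall fun y => ?_)).integrableOn
  unfold tailProfile
  by_cases hy : 1 < y
  · have hy0 : 0 < y := by linarith
    have := Real.rpow_nonneg hy0.le (-1 - α)
    rw [if_pos hy, indicator_of_mem (by exact hy), Real.norm_of_nonneg (by positivity),
      Real.norm_of_nonneg (by positivity)]
    gcongr
    exact min_le_left _ _
  · rw [if_neg hy]; simp

theorem tailProfile_le_left {α r y : ℝ} (hy : 0 < y) :
    tailProfile α r y ≤ if 1 < y then r * y ^ (-α) else 0 := by
  unfold tailProfile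
  split_ifs
  · have e : y ^ (-α) = y * y ^ (-1 - α) := by
      conv_rhs => rw [← Real.rpow_one y, ← Real.rpow_mul hy.le, ← Real.rpow_add hy]
      ring_nf
    rw [e, ← mul_assoc]
    have := Real.rpow_nonneg hy.le (-1 - α)
    gcongr
    exact min_le_right _ _
  · rfl

theorem tailProfile_le_right {α r y : ℝ} (hy : 0 < y) :
    tailProfile α r y ≤ if 1 < y then 2 * y ^ (-1 - α) else 0 := by
  unfold tailProfile
  split_ifs
  · have := Real.rpow_nonneg hy.le (-1 - α)
    gcongr
    exact min_le_left _ _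
  · rfl

/-- Origin of the three regimes. With r y used below 1/r and 2 above, the upper piece is of order
r^α, and the lower one is r ∫ y^{-α} dy: dominated by its upper end if α < 1, logarithmic if α = 1,
and convergent at infinity if α > 1, where no cut is needed. -/
theorem integral_tailProfile_le {α : ℝ} (hα : 0 < α) :
    ∃ C, 0 < C ∧ ∀ r, 0 < r → ∫ y in Ioi 0, tailProfile α r y ≤ C * sqrtRate α r := by
  rcases lt_trichotomy α 1 with h1 | h1 | h1
  · refine ⟨1 / (1 - α) + 2 / α, by have : 0 < 1 - α := by linarith
                                    positivity, fun r hr => ?_⟩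
    have hr1 : 0 < 1 / r := by positivity
    -- For α < 1 the power is integrable at zero, so the range may start at 0 instead of 1, and 1/r
    -- need not be compared with 1.
    have hi : IntegrableOn (fun y : ℝ => r * y ^ (-α)) (Ioc 0 (1 / r)) := by
      have := (intervalIntegral.intervalIntegrable_rpow' (r := -α) (a := 0) (b := 1 / r)
        (by linarith)).const_mul r
      rwa [intervalIntegrable_iff_integrableOn_Ioc_of_le hr1.le] at this
    have hj : IntegrableOn (fun y : ℝ => 2 * y ^ (-1 - α)) (Ioi (1 / r)) :=
      (integrableOn_Ioi_rpow_of_lt (by linarith) hr1).const_mul 2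
    refine (setIntegral_le_of_le_indicator_add (A := Ioc 0 (1 / r)) (B := Ioi (1 / r))
      (fun y hy => hy.1) (fun y hy => hr1.trans hy) measurableSet_Ioc measurableSet_Ioi
      (integrableOn_tailProfile hα hr) hi hj fun y hy => ?_).trans_eq ?_
    · by_cases hy1 : y ≤ 1 / r
      · rw [indicator_of_mem (show y ∈ Ioc 0 (1 / r) from ⟨hy, hy1⟩),
          indicator_of_notMem (by simpa using hy1), add_zero]
        refine (tailProfile_le_left hy).trans ?_
        split_ifs
        · rfl
        · positivity
      · rw [indicator_of_notMem (fun h => hy1 h.2), indicator_of_mem (by simpa using hy1),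
          zero_add]
        refine (tailProfile_le_right hy).trans ?_
        split_ifs
        · rfl
        · positivity
    · rw [integral_const_mul, integral_const_mul, integral_Ioi_rpow_of_lt (by linarith) hr1,
        ← intervalIntegral.integral_of_le hr1.le, integral_rpow (Or.inl (by linarith)),
        sqrtRate, if_pos h1, Real.zero_rpow (by linarith), one_div r, Real.inv_rpow hr.le,
        Real.inv_rpow hr.le, ← Real.rpow_neg hr.le, ← Real.rpow_neg hr.le]
      have e1 : r ^ α = r * r ^ (-(-α + 1)) := by
        rw [← Real.rpow_one_add' hr.le (by linarith)]; ring_nf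
      have e2 : -(-1 - α + 1) = α := by ring
      rw [e2, mul_div_assoc', sub_zero, ← e1]
      have : 1 - α ≠ 0 := by linarith
      have h3 : -α + 1 = 1 - α := by ring
      have h4 : -1 - α + 1 = -α := by ring
      rw [h3, h4]
      field_simp
  · subst h1
    refine ⟨2, two_pos, fun r hr => ?_⟩
    have hsr : sqrtRate 1 r = r * (1 + |Real.log r|) := by simp [sqrtRate]
    rw [hsr]
    have hr1 : 0 < 1 / r := by positivity
    have hlog : 0 ≤ r * |Real.log r| := by positivity
    rcases le_or_gt r 1 with hrle | hrgt
    · have h1r : 1 ≤ 1 / r := by rw [le_div_iff₀ hr]; linarith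
      have hi : IntegrableOn (fun y : ℝ => r * y⁻¹) (Ioc 1 (1 / r)) := by
        have : IntervalIntegrable (fun y : ℝ => y⁻¹) volume 1 (1 / r) := by
          rw [intervalIntegrable_inv_iff]
          right
          rw [uIcc_of_le h1r]
          exact fun h => by linarith [h.1]
        have := this.const_mul r
        rwa [intervalIntegrable_iff_integrableOn_Ioc_of_le h1r] at this
      have hj : IntegrableOn (fun y : ℝ => 2 * y ^ (-1 - (1 : ℝ))) (Ioi (1 / r)) :=
        (integrableOn_Ioi_rpow_of_lt (by linarith) hr1).const_mul 2
      refine (setIntegral_le_of_le_indicator_add (A := Ioc 1 (1 / r)) (B := Ioi (1 / r))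
        (fun y hy => one_pos.trans hy.1) (fun y hy => hr1.trans hy) measurableSet_Ioc
        measurableSet_Ioi
        (integrableOn_tailProfile one_pos hr) hi hj fun y hy => ?_).trans ?_
      · by_cases hy1 : y ≤ 1 / r
        · rw [indicator_of_notMem (s := Ioi (1 / r)) (by simpa using hy1), add_zero]
          refine (tailProfile_le_left hy).trans ?_
          split_ifs with h
          · rw [indicator_of_mem (show y ∈ Ioc 1 (1 / r) from ⟨h, hy1⟩), Real.rpow_neg_one]
          · exact indicator_nonneg (fun y hy => by
              have := one_pos.trans hy.1
              positivity) _
        · rw [indicator_of_notMem (fun h => hy1 h.2), indicator_of_mem (by simpa using hy1),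
            zero_add]
          refine (tailProfile_le_right hy).trans ?_
          split_ifs
          · rfl
          · positivity
      · rw [integral_const_mul, integral_const_mul, integral_Ioi_rpow_of_lt (by linarith) hr1,
          ← intervalIntegral.integral_of_le h1r, integral_inv_of_pos one_pos hr1]
        have e : -1 - (1 : ℝ) + 1 = -1 := by norm_num
        rw [e, Real.rpow_neg_one, div_one, one_div, inv_inv, Real.log_inv]
        have := neg_abs_le (Real.log r)
        nlinarith
    -- Here 1/r < 1 and the lower piece is empty; the constant majorant alone gives 2, which is at
    -- most 2r.
    · have hj : IntegrableOn (fun y : ℝ => 2 * y ^ (-1 - (1 : ℝ))) (Ioi 1) :=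
        (integrableOn_Ioi_rpow_of_lt (by linarith) one_pos).const_mul 2
      refine (setIntegral_le_of_le_indicator_add (A := ∅) (B := Ioi 1) (g := 0)
        (empty_subset _) (fun y hy => mem_Ioi.2 (one_pos.trans (mem_Ioi.1 hy))) MeasurableSet.empty
        measurableSet_Ioi
        (integrableOn_tailProfile one_pos hr) (by simp) hj fun y hy => ?_).trans ?_
      · refine (tailProfile_le_right hy).trans ?_
        rw [indicator_empty, zero_add]
        simp [indicator]
      · rw [integral_const_mul, integral_Ioi_rpow_of_lt (by linarith) one_pos]
        simp
        nlinarith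
  · refine ⟨1 / (α - 1), by have : 0 < α - 1 := by linarith
                            positivity, fun r hr => ?_⟩
    have hsr : sqrtRate α r = r := by
      rw [sqrtRate, if_neg (by linarith), if_neg (by linarith)]
    rw [hsr]
    have hj : IntegrableOn (fun y : ℝ => r * y ^ (-α)) (Ioi 1) :=
      (integrableOn_Ioi_rpow_of_lt (by linarith) one_pos).const_mul r
    refine (setIntegral_le_of_le_indicator_add (A := ∅) (B := Ioi 1) (g := 0)
      (empty_subset _) (fun y hy => mem_Ioi.2 (one_pos.trans (mem_Ioi.1 hy))) MeasurableSet.empty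
      measurableSet_Ioi
      (integrableOn_tailProfile hα hr) (by simp) hj fun y hy => ?_).trans_eq ?_
    · refine (tailProfile_le_left hy).trans ?_
      rw [indicator_empty, zero_add]
      simp [indicator]
    · rw [integral_const_mul, integral_Ioi_rpow_of_lt (by linarith) one_pos, Real.one_rpow]
      have h3 : -α + 1 = -(α - 1) := by ring
      rw [h3, neg_div_neg_eq, mul_comm]
      simp

/-! ### Kernels in `ℝ^d` -/

/-- The Lévy kernel `min (1, |z|²) / |z|^{d+α}`. -/
def levyKernel (α : ℝ) (z : Space d) : ℝ := min 1 (‖z‖ ^ 2) / ‖z‖ ^ ((d : ℝ) + α)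

/-- The tail kernel `min (2, r|z|) / |z|^{d+α}` on `|z| > 1`. -/
def tailKernel (α r : ℝ) (z : Space d) : ℝ :=
  if 1 < ‖z‖ then min 2 (r * ‖z‖) / ‖z‖ ^ ((d : ℝ) + α) else 0

/-- The kernel `(1 - cos⟨k,z⟩) / |z|^{d+α}`. -/
def cosKernel (α : ℝ) (k z : Space d) : ℝ :=
  (1 - Real.cos (inner ℝ k z)) / ‖z‖ ^ ((d : ℝ) + α)

@[fun_prop]
theorem measurable_levyKernel (α : ℝ) : Measurable (levyKernel (d := d) α) := by
  unfold levyKernel; fun_prop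

@[fun_prop]
theorem measurable_tailKernel (α r : ℝ) : Measurable (tailKernel (d := d) α r) := by
  unfold tailKernel
  exact Measurable.ite (measurableSet_lt measurable_const measurable_norm) (by fun_prop)
    measurable_const

@[fun_prop]
theorem measurable_cosKernel (α : ℝ) (k : Space d) : Measurable (cosKernel α k) := by
  unfold cosKernel; fun_prop

theorem levyKernel_nonneg (α : ℝ) (z : Space d) : 0 ≤ levyKernel α z := by
  unfold levyKernel; positivity

theorem tailKernel_nonneg {α r : ℝ} (hr : 0 ≤ r) (z : Space d) : 0 ≤ tailKernel α r z := by
  unfold tailKernel; split_ifs <;> positivity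

theorem cosKernel_nonneg (α : ℝ) (k z : Space d) : 0 ≤ cosKernel α k z :=
  div_nonneg (by linarith [Real.cos_le_one (inner ℝ k z)]) (by positivity)

/-- The polar Jacobian cancels the dimension, so radial integrals depend on α alone. -/
theorem pow_mul_div_rpow [NeZero d] {α y : ℝ} (hy : 0 < y) (c : ℝ) :
    y ^ (d - 1) * (c / y ^ ((d : ℝ) + α)) = c * y ^ (-1 - α) := by
  have h1 : y ^ (d - 1) = y ^ ((d : ℝ) - 1) := by
    rw [← Real.rpow_natCast, Nat.cast_sub (NeZero.one_le), Nat.cast_one]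
  have h2 : y ^ (-1 - α) = y ^ ((d : ℝ) - 1) / y ^ ((d : ℝ) + α) := by
    rw [← Real.rpow_sub hy]; ring_nf
  rw [h1, h2]
  ring

theorem integrable_levyKernel [NeZero d] {α : ℝ} (hα0 : 0 < α) (hα2 : α < 2) :
    Integrable (levyKernel (d := d) α) := by
  have : Nontrivial (Space d) := by
    have := NeZero.pos d
    exact Module.nontrivial_of_finrank_pos (R := ℝ) (by simpa using this)
  have h := integrable_fun_norm_addHaar (E := Space d) volume
    (f := fun y => min 1 (y ^ 2) / y ^ ((d : ℝ) + α))
  refine h.2 ?_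
  rw [finrank_euclideanSpace_fin, ← Ioc_union_Ioi_eq_Ioi zero_le_one]
  refine IntegrableOn.union ?_ ?_
  · have h1 : IntegrableOn (fun y : ℝ => y ^ (1 - α)) (Ioc 0 1) := by
      have := intervalIntegral.intervalIntegrable_rpow' (r := 1 - α) (a := 0) (b := 1)
        (by linarith)
      rwa [intervalIntegrable_iff_integrableOn_Ioc_of_le zero_le_one] at this
    refine h1.congr_fun (fun y hy => ?_) measurableSet_Ioc
    simp only [smul_eq_mul]
    have hy2 : y ^ 2 ≤ 1 := by nlinarith [hy.1, hy.2]
    rw [pow_mul_div_rpow hy.1, min_eq_right hy2, ← Real.rpow_natCast, ← Real.rpow_add hy.1]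
    congr 1
    push_cast
    ring
  · have h1 : IntegrableOn (fun y : ℝ => y ^ (-1 - α)) (Ioi 1) :=
      integrableOn_Ioi_rpow_of_lt (by linarith) one_pos
    refine h1.congr_fun (fun y hy => ?_) measurableSet_Ioi
    have hy1 : 1 < y := hy
    simp only [smul_eq_mul]
    rw [pow_mul_div_rpow (by linarith), min_eq_left (by nlinarith), one_mul]

theorem integrable_tailKernel [NeZero d] {α r : ℝ} (hα0 : 0 < α) (hα2 : α < 2) (hr : 0 ≤ r) :
    Integrable (tailKernel (d := d) α r) := by
  refine ((integrable_levyKernel hα0 hα2).const_mul 2).mono (by fun_prop)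
    (Filter.Eventually.of_forall fun z => ?_)
  rw [Real.norm_of_nonneg (tailKernel_nonneg hr z),
    Real.norm_of_nonneg (mul_nonneg zero_le_two (levyKernel_nonneg α z))]
  unfold tailKernel
  split_ifs with h
  · rw [levyKernel, min_eq_left (a := (1 : ℝ)) (by nlinarith), mul_one_div]
    gcongr
    exact min_le_left _ _
  · exact mul_nonneg zero_le_two (levyKernel_nonneg α z)

theorem integral_tailKernel_le (d : ℕ) [NeZero d] {α : ℝ} (hα0 : 0 < α) :
    ∃ C, 0 < C ∧ ∀ r, 0 < r → ∫ z : Space d, tailKernel α r z ≤ C * sqrtRate α r := by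
  have : Nontrivial (Space d) := by
    have := NeZero.pos d
    exact Module.nontrivial_of_finrank_pos (R := ℝ) (by simpa using this)
  obtain ⟨C, hC, h⟩ := integral_tailProfile_le hα0
  have hd : (0 : ℝ) < d := by exact_mod_cast NeZero.pos d
  have hv : 0 < (volume : Measure (Space d)).real (Metric.ball 0 1) :=
    ENNReal.toReal_pos (Metric.measure_ball_pos _ _ one_pos).ne' measure_ball_lt_top.ne
  refine ⟨d * (volume : Measure (Space d)).real (Metric.ball 0 1) * C, by positivity,
    fun r hr => ?_⟩
  have h1 := integral_fun_norm_addHaar (E := Space d) volume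
    (fun y => if 1 < y then min 2 (r * y) / y ^ ((d : ℝ) + α) else 0)
  have h2 : ∫ z : Space d, tailKernel α r z = _ := h1
  rw [h2, finrank_euclideanSpace_fin, nsmul_eq_mul, smul_eq_mul, mul_assoc, mul_assoc]
  gcongr
  refine le_trans (le_of_eq ?_) (h r hr)
  refine setIntegral_congr_fun measurableSet_Ioi fun y hy => ?_
  simp only [tailProfile, smul_eq_mul]
  split_ifs
  · exact pow_mul_div_rpow hy _
  · simp

theorem one_sub_cos_le (t : ℝ) : 1 - Real.cos t ≤ t ^ 2 / 2 := by
  linarith [Real.one_sub_sq_div_two_le_cos (x := t)]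

theorem abs_inner_le (k z : Space d) : |inner ℝ k z| ≤ ‖k‖ * ‖z‖ := abs_real_inner_le_norm k z

theorem inner_sq_le (k z : Space d) : (inner ℝ k z) ^ 2 ≤ ‖k‖ ^ 2 * ‖z‖ ^ 2 := by
  rw [← mul_pow, ← sq_abs]
  have := abs_inner_le k z
  gcongr

theorem cosKernel_le (α : ℝ) (k z : Space d) :
    cosKernel α k z ≤ max 2 (‖k‖ ^ 2 / 2) * levyKernel α z := by
  rw [cosKernel, levyKernel, ← mul_div_assoc]
  gcongr
  rcases le_total 1 (‖z‖ ^ 2) with h | h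
  · rw [min_eq_left h, mul_one]
    exact le_max_of_le_left (by linarith [Real.neg_one_le_cos (inner ℝ k z)])
  · rw [min_eq_right h]
    refine (one_sub_cos_le _).trans ?_
    calc (inner ℝ k z) ^ 2 / 2 ≤ ‖k‖ ^ 2 / 2 * ‖z‖ ^ 2 := by linarith [inner_sq_le k z]
      _ ≤ _ := by gcongr; exact le_max_right _ _

theorem integrable_cosKernel [NeZero d] {α : ℝ} (hα0 : 0 < α) (hα2 : α < 2) (k : Space d) :
    Integrable (cosKernel α k) := by
  refine ((integrable_levyKernel hα0 hα2).const_mul (max 2 (‖k‖ ^ 2 / 2))).mono (by fun_prop)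
    (Filter.Eventually.of_forall fun z => ?_)
  rw [Real.norm_of_nonneg (cosKernel_nonneg α k z), Real.norm_of_nonneg
    (mul_nonneg (by positivity) (levyKernel_nonneg α z))]
  exact cosKernel_le α k z

theorem V_eq (α : ℝ) (k : Space d) : V α k = ∫ z, cosKernel α k z := rfl

theorem c0_eq [NeZero d] (α : ℝ) :
    c0 d α = V α (EuclideanSpace.single (0 : Fin d) (1 : ℝ)) := by
  unfold c0 V
  simp [EuclideanSpace.inner_single_left]

theorem V_nonneg (α : ℝ) (k : Space d) : 0 ≤ V α k :=
  integral_nonneg fun z => cosKernel_nonneg α k z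

theorem V_comp_isometry (α : ℝ) (L : Space d ≃ₗᵢ[ℝ] Space d) (k : Space d) :
    V α (L k) = V α k := by
  rw [V_eq, V_eq, ← L.measurePreserving.integral_comp L.toHomeomorph.measurableEmbedding]
  simp [cosKernel, L.inner_map_map]

/-- Substitution of t z for z; the Jacobian removes the power t^d. -/
theorem V_smul {α : ℝ} (t : ℝ) (ht : 0 < t) (k : Space d) :
    V α (t • k) = t ^ α * V α k := by
  have h := Measure.integral_comp_smul_of_nonneg (volume : Measure (Space d)) (cosKernel α k) t
    (hR := ht.le)
  rw [V_eq, V_eq]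
  have h2 : ∀ z : Space d, cosKernel α (t • k) z = t ^ ((d : ℝ) + α) * cosKernel α k (t • z) := by
    intro z
    rw [cosKernel, cosKernel, real_inner_smul_left, real_inner_smul_right, norm_smul,
      Real.norm_of_nonneg ht.le, Real.mul_rpow ht.le (norm_nonneg _)]
    have : t ^ ((d : ℝ) + α) ≠ 0 := (Real.rpow_pos_of_pos ht _).ne'
    -- At the origin both sides are zero, by the convention for division by zero.
    rcases eq_or_ne (‖z‖ ^ ((d : ℝ) + α)) 0 with h0 | h0
    · rw [h0]; simp
    · field_simp
  simp only [h2]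
  rw [integral_const_mul, h, finrank_euclideanSpace_fin, smul_eq_mul, ← mul_assoc]
  congr 1
  rw [Real.rpow_add ht, Real.rpow_natCast]
  field_simp

theorem exists_isometry_map (e f : Space d) (h : ‖e‖ = ‖f‖) :
    ∃ L : Space d ≃ₗᵢ[ℝ] Space d, L e = f :=
  ⟨Submodule.reflection (ℝ ∙ (e - f))ᗮ, Submodule.reflection_sub h⟩

/-- Invariance under isometries moves `k` to a multiple of the first basis vector, and homogeneity
extracts the length. -/
theorem V_eq_c0_mul [NeZero d] {α : ℝ} (hα : 0 < α) (k : Space d) : V α k = c0 d α * ‖k‖ ^ α := by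
  rcases eq_or_ne k 0 with h | h
  · rw [h, norm_zero, Real.zero_rpow hα.ne']
    simp [V]
  · have hk : 0 < ‖k‖ := norm_pos_iff.2 h
    obtain ⟨L, hL⟩ := exists_isometry_map (‖k‖ • EuclideanSpace.single (0 : Fin d) (1 : ℝ)) k
      (by rw [norm_smul]; simp)
    rw [← hL, V_comp_isometry, V_smul _ hk, c0_eq, hL, mul_comm]

theorem c0_pos (d : ℕ) [NeZero d] {α : ℝ} (hα0 : 0 < α) (hα2 : α < 2) : 0 < c0 d α := by
  rw [c0_eq, V_eq]
  set e : Space d := EuclideanSpace.single (0 : Fin d) (1 : ℝ) with he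
  have hc : ContinuousOn (cosKernel α e) {0}ᶜ := by
    unfold cosKernel
    refine ContinuousOn.div (by fun_prop) ?_ fun z hz =>
      (Real.rpow_pos_of_pos (norm_pos_iff.2 hz) _).ne'
    exact ContinuousOn.rpow_const (by fun_prop) fun z hz => Or.inl (norm_ne_zero_iff.2 hz)
  rw [integral_pos_iff_support_of_nonneg (fun z => cosKernel_nonneg α e z)
    (integrable_cosKernel hα0 hα2 e)]
  -- On this ball 0 < ⟨e,z⟩ < 2 < π, so the cosine is strictly below one and the nonnegative
  -- integrand is positive on a set of positive measure.
  have hsub : Metric.ball e 1 ⊆ Function.support (cosKernel α e) := by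
    intro z hz
    rw [Metric.mem_ball, dist_eq_norm] at hz
    have hze : ‖z - e‖ ^ 2 < 1 := by nlinarith [norm_nonneg (z - e)]
    have hne : ‖e‖ = 1 := by simp [he]
    rw [norm_sub_sq_real, hne, real_inner_comm] at hze
    have hz2 : ‖z‖ < 2 := by
      have := norm_add_le (z - e) e
      rw [sub_add_cancel, hne] at this
      linarith
    have hpos : 0 < inner ℝ e z := by nlinarith [sq_nonneg ‖z‖]
    have hz0 : z ≠ 0 := by rintro rfl; simp at hpos
    have hlt : inner ℝ e z < 2 := by
      have := (le_abs_self _).trans (abs_inner_le e z)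
      rw [hne, one_mul] at this
      linarith
    rw [Function.mem_support, cosKernel]
    refine div_ne_zero ?_ (Real.rpow_pos_of_pos (norm_pos_iff.2 hz0) _).ne'
    have := Real.cos_lt_cos_of_nonneg_of_le_pi le_rfl
      (by linarith [Real.pi_gt_three] : inner ℝ e z ≤ Real.pi) hpos
    rw [Real.cos_zero] at this
    linarith
  exact (Metric.measure_ball_pos volume e one_pos).trans_le (measure_mono hsub)

/-- On bounded sets of z the quadratic bound for 1 - cos yields the full factor |k|², with no loss
from large z. -/
theorem cosKernel_le_of_norm_le (α : ℝ) {R : ℝ} (hR : 1 ≤ R) (k : Space d) {z : Space d}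
    (hz : ‖z‖ ≤ R) : cosKernel α k z ≤ R ^ 2 / 2 * ‖k‖ ^ 2 * levyKernel α z := by
  rw [cosKernel, levyKernel, ← mul_div_assoc]
  gcongr
  have h1 : ‖z‖ ^ 2 ≤ R ^ 2 * min 1 (‖z‖ ^ 2) := by
    rcases le_total 1 (‖z‖ ^ 2) with h | h
    · rw [min_eq_left h, mul_one]; gcongr
    · rw [min_eq_right h]
      exact le_mul_of_one_le_left (by positivity) (by nlinarith)
  calc 1 - Real.cos (inner ℝ k z) ≤ (inner ℝ k z) ^ 2 / 2 := one_sub_cos_le _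
    _ ≤ ‖k‖ ^ 2 / 2 * ‖z‖ ^ 2 := by linarith [inner_sq_le k z]
    _ ≤ ‖k‖ ^ 2 / 2 * (R ^ 2 * min 1 (‖z‖ ^ 2)) := by gcongr
    _ = _ := by ring

theorem abs_inv_rpow_sub_le {p a b c : ℝ} (hp : 0 < p) (hc : 0 < c) (ha : c ≤ a) (hb : c ≤ b) :
    |(a ^ p)⁻¹ - (b ^ p)⁻¹| ≤ p * c ^ (-p - 1) * |a - b| := by
  rw [← Real.rpow_neg (hc.le.trans ha), ← Real.rpow_neg (hc.le.trans hb)]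
  have h := (convex_Ici c).norm_image_sub_le_of_norm_hasDerivWithin_le
    (f := fun x : ℝ => x ^ (-p)) (f' := fun x => -p * x ^ (-p - 1)) (C := p * c ^ (-p - 1))
    (x := b) (y := a) (fun x hx => (Real.hasDerivAt_rpow_const
      (Or.inl (hc.trans_le hx).ne')).hasDerivWithinAt) (fun x hx => ?_) hb ha
  · exact h
  · have hx0 : 0 < x := hc.trans_le hx
    rw [norm_mul, norm_neg, Real.norm_of_nonneg hp.le, Real.norm_of_nonneg (by positivity)]
    exact mul_le_mul_of_nonneg_left (Real.rpow_le_rpow_of_nonpos hc hx (by linarith)) hp.le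

theorem abs_sin_le_min (t : ℝ) : |Real.sin t| ≤ min 1 |t| :=
  le_min (Real.abs_sin_le_one t) Real.abs_sin_le_abs

/-- Interpolates between the quadratic and the trivial bound. The factor t offsets the extra 1/|z|
from differentiating the inverse power, and the minimum is that of the tail kernel. -/
theorem one_sub_cos_le_mul_min {t x : ℝ} (hx : |x| ≤ t) :
    1 - Real.cos x ≤ t * min 2 t := by
  have h1 : 1 - Real.cos x ≤ t ^ 2 / 2 := by
    have : x ^ 2 ≤ t ^ 2 := by rw [← sq_abs]; gcongr
    linarith [one_sub_cos_le x]
  rcases le_total t 2 with h | h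
  · rw [min_eq_right h]; nlinarith
  · rw [min_eq_left h]; linarith [Real.neg_one_le_cos x]

/-- The variation of the kernel `(1 - cos⟨k,z⟩) / |z|^{d+α}` under a bounded shift. -/
theorem abs_cosKernel_sub_le {α D : ℝ} (hα : 0 < α) (hD : 1 ≤ D) (k z : Space d) {s : Space d}
    (hs : ‖s‖ ≤ D) :
    |cosKernel α k z - cosKernel α k (z - s)| ≤
      (3 * D) ^ 2 / 2 * ‖k‖ ^ 2 * (levyKernel α z + levyKernel α (z - s)) +
      D * (2 + 9 / 4 * (((d : ℝ) + α) * 2 ^ ((d : ℝ) + α + 1))) * ‖k‖ * tailKernel α ‖k‖ z := by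
  set p : ℝ := (d : ℝ) + α with hp
  have hp0 : 0 < p := by positivity
  have hT := tailKernel_nonneg (α := α) (norm_nonneg k) z
  have hL1 := levyKernel_nonneg α z
  have hL2 := levyKernel_nonneg α (z - s)
  -- Near the origin both points have norm at most 3D and the two kernels are bounded separately.
  -- Farther out z and z - s have comparable norms, and the difference is exploited; D ≥ 1 places z
  -- in the support of the tail kernel.
  rcases le_or_gt ‖z‖ (2 * D) with hz | hz
  · have h1 := cosKernel_le_of_norm_le α (R := 3 * D) (by linarith) k (z := z) (by linarith)
    have h2 := cosKernel_le_of_norm_le α (R := 3 * D) (by linarith) k (z := z - s)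
      ((norm_sub_le _ _).trans (by linarith))
    have h3 : |cosKernel α k z - cosKernel α k (z - s)| ≤
        cosKernel α k z + cosKernel α k (z - s) := by
      have a1 := cosKernel_nonneg α k z
      have a2 := cosKernel_nonneg α k (z - s)
      rw [abs_le]; constructor <;> linarith
    have h4 : 0 ≤ D * (2 + 9 / 4 * (p * 2 ^ (p + 1))) * ‖k‖ * tailKernel α ‖k‖ z := by positivity
    linarith
  · set w := z - s with hw
    have hzpos : 0 < ‖z‖ := by linarith
    have hwl : ‖z‖ / 2 ≤ ‖w‖ := by
      have := norm_sub_norm_le z s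
      linarith
    have hwu : ‖w‖ ≤ 3 / 2 * ‖z‖ := (norm_sub_le _ _).trans (by linarith)
    have hwz : |‖z‖ - ‖w‖| ≤ D := by
      refine (abs_norm_sub_norm_le z w).trans ?_
      rw [hw, sub_sub_cancel]; exact hs
    have hκ : 0 < ‖z‖ ^ p := Real.rpow_pos_of_pos hzpos _
    set m := min 2 (‖k‖ * ‖z‖) with hm
    have hm0 : 0 ≤ m := by positivity
    -- In the product formula for the difference of cosines, one sine has argument ⟨k,s⟩/2 and gains
    -- |k|D; the other retains the minimum `m`.
    have hcos : |Real.cos (inner ℝ k w) - Real.cos (inner ℝ k z)| ≤ 2 * ‖k‖ * D * m := by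
      rw [Real.cos_sub_cos, abs_mul, abs_mul, abs_neg, abs_two]
      have e1 : (inner ℝ k w - inner ℝ k z) / 2 = - inner ℝ k s / 2 := by
        rw [hw, inner_sub_right]; ring
      have e2 : (inner ℝ k w + inner ℝ k z) / 2 = inner ℝ k ((1 / 2 : ℝ) • (w + z)) := by
        rw [real_inner_smul_right, inner_add_right]; ring
      have b1 : |Real.sin ((inner ℝ k w - inner ℝ k z) / 2)| ≤ ‖k‖ * D / 2 := by
        refine Real.abs_sin_le_abs.trans ?_
        rw [e1, neg_div, abs_neg, abs_div, abs_two]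
        have := (abs_inner_le k s).trans (mul_le_mul_of_nonneg_left hs (norm_nonneg k))
        linarith
      have b2 : |Real.sin ((inner ℝ k w + inner ℝ k z) / 2)| ≤ 2 * m := by
        refine (abs_sin_le_min _).trans ?_
        rw [e2]
        have h5 : ‖(1 / 2 : ℝ) • (w + z)‖ ≤ 5 / 4 * ‖z‖ := by
          rw [norm_smul]
          have := norm_add_le w z
          norm_num
          linarith
        have h6 := (abs_inner_le k ((1 / 2 : ℝ) • (w + z))).trans
          (mul_le_mul_of_nonneg_left h5 (norm_nonneg k))
        rw [hm, mul_min_of_nonneg _ _ zero_le_two]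
        refine min_le_min (by norm_num) (h6.trans ?_)
        nlinarith [mul_nonneg (norm_nonneg k) (norm_nonneg z)]
      calc 2 * |Real.sin ((inner ℝ k w + inner ℝ k z) / 2)| *
            |Real.sin ((inner ℝ k w - inner ℝ k z) / 2)| ≤ 2 * (2 * m) * (‖k‖ * D / 2) := by gcongr
        _ = _ := by ring
    have hone : 1 - Real.cos (inner ℝ k w) ≤ 9 / 4 * (‖k‖ * ‖z‖ * m) := by
      have h7 : |inner ℝ k w| ≤ 3 / 2 * (‖k‖ * ‖z‖) := by
        have := (abs_inner_le k w).trans (mul_le_mul_of_nonneg_left hwu (norm_nonneg k))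
        linarith
      refine (one_sub_cos_le_mul_min h7).trans ?_
      have h8 : min 2 (3 / 2 * (‖k‖ * ‖z‖)) ≤ 3 / 2 * m := by
        rw [hm, mul_min_of_nonneg _ _ (by norm_num : (0 : ℝ) ≤ 3 / 2)]
        exact min_le_min (by norm_num) le_rfl
      calc _ ≤ 3 / 2 * (‖k‖ * ‖z‖) * (3 / 2 * m) := by gcongr
        _ = _ := by ring
    have hinv : |(‖z‖ ^ p)⁻¹ - (‖w‖ ^ p)⁻¹| ≤ p * 2 ^ (p + 1) * D * (‖z‖ * ‖z‖ ^ p)⁻¹ := by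
      refine (abs_inv_rpow_sub_le hp0 (c := ‖z‖ / 2) (by positivity) (by linarith) hwl).trans ?_
      have e3 : (‖z‖ / 2) ^ (-p - 1) = 2 ^ (p + 1) * (‖z‖ * ‖z‖ ^ p)⁻¹ := by
        rw [Real.div_rpow hzpos.le zero_le_two, div_eq_mul_inv, ← Real.rpow_neg zero_le_two,
          show -p - 1 = -(p + 1) by ring, neg_neg, Real.rpow_neg hzpos.le,
          Real.rpow_add_one hzpos.ne']
        ring
      rw [e3]
      calc p * (2 ^ (p + 1) * (‖z‖ * ‖z‖ ^ p)⁻¹) * |‖z‖ - ‖w‖|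
          ≤ p * (2 ^ (p + 1) * (‖z‖ * ‖z‖ ^ p)⁻¹) * D := by gcongr
        _ = _ := by ring
    -- Discrete product rule: vary the numerator with the weight at z fixed, then the weight with
    -- the numerator at w fixed.
    have hdec : cosKernel α k z - cosKernel α k w =
        (Real.cos (inner ℝ k w) - Real.cos (inner ℝ k z)) * (‖z‖ ^ p)⁻¹ +
          (1 - Real.cos (inner ℝ k w)) * ((‖z‖ ^ p)⁻¹ - (‖w‖ ^ p)⁻¹) := by
      rw [cosKernel, cosKernel, ← hp, div_eq_mul_inv, div_eq_mul_inv]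
      ring
    have hone0 : 0 ≤ 1 - Real.cos (inner ℝ k w) := by linarith [Real.cos_le_one (inner ℝ k w)]
    have htail : tailKernel α ‖k‖ z = m * (‖z‖ ^ p)⁻¹ := by
      rw [tailKernel, if_pos (by linarith), div_eq_mul_inv]
    rw [hdec, htail]
    refine (abs_add_le _ _).trans ?_
    rw [abs_mul, abs_mul, abs_of_pos (inv_pos.2 hκ), abs_of_nonneg hone0]
    have h9 : (1 - Real.cos (inner ℝ k w)) * |(‖z‖ ^ p)⁻¹ - (‖w‖ ^ p)⁻¹| ≤
        9 / 4 * (‖k‖ * ‖z‖ * m) * (p * 2 ^ (p + 1) * D * (‖z‖ * ‖z‖ ^ p)⁻¹) := by gcongr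
    have h10 : 9 / 4 * (‖k‖ * ‖z‖ * m) * (p * 2 ^ (p + 1) * D * (‖z‖ * ‖z‖ ^ p)⁻¹) =
        D * (9 / 4 * (p * 2 ^ (p + 1))) * ‖k‖ * (m * (‖z‖ ^ p)⁻¹) := by
      rw [mul_inv]
      field_simp
    have h11 : |Real.cos (inner ℝ k w) - Real.cos (inner ℝ k z)| * (‖z‖ ^ p)⁻¹ ≤
        2 * ‖k‖ * D * m * (‖z‖ ^ p)⁻¹ := by gcongr
    have h12 : 0 ≤ (3 * D) ^ 2 / 2 * ‖k‖ ^ 2 * (levyKernel α z + levyKernel α w) := by positivity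
    rw [h10] at h9
    calc _ ≤ 2 * ‖k‖ * D * m * (‖z‖ ^ p)⁻¹ + D * (9 / 4 * (p * 2 ^ (p + 1))) * ‖k‖ *
          (m * (‖z‖ ^ p)⁻¹) := add_le_add h11 h9
      _ = D * (2 + 9 / 4 * (p * 2 ^ (p + 1))) * ‖k‖ * (m * (‖z‖ ^ p)⁻¹) := by ring
      _ ≤ _ := le_add_of_nonneg_left h12

/-- The integrated variation of the kernel under a bounded shift is of the order of the rate. -/
theorem integral_abs_cosKernel_sub_le (d : ℕ) [NeZero d] {α : ℝ} (hα0 : 0 < α) (hα2 : α < 2)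
    {D : ℝ} (hD : 1 ≤ D) :
    ∃ C, 0 < C ∧ ∀ (k s : Space d), ‖k‖ ≤ 4 → ‖s‖ ≤ D →
      ∫ z, |cosKernel α k z - cosKernel α k (z - s)| ≤ C * sqrtRate α ‖k‖ ^ 2 := by
  obtain ⟨C, hC, h⟩ := integral_tailKernel_le d hα0
  set A := (3 * D) ^ 2 / 2 with hA
  set B := D * (2 + 9 / 4 * (((d : ℝ) + α) * 2 ^ ((d : ℝ) + α + 1))) with hB
  have hA0 : 0 < A := by positivity
  have hB0 : 0 < B := by positivity
  set I := ∫ z : Space d, levyKernel α z with hI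
  have hI0 : 0 ≤ I := integral_nonneg fun z => levyKernel_nonneg α z
  refine ⟨A * 16 * (2 * I) + B * 4 * C, by positivity, fun k s hk hs => ?_⟩
  have hL := integrable_levyKernel (d := d) hα0 hα2
  have hLs : Integrable fun z : Space d => levyKernel α (z - s) := hL.comp_sub_right s
  have hT := integrable_tailKernel (d := d) hα0 hα2 (norm_nonneg k)
  have hK := integrable_cosKernel hα0 hα2 k
  have h1 := integral_mono ((hK.sub (hK.comp_sub_right s)).abs)
    (((hL.add hLs).const_mul (A * ‖k‖ ^ 2)).add (hT.const_mul (B * ‖k‖)))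
    (fun z => abs_cosKernel_sub_le hα0 hD k z hs)
  refine h1.trans ?_
  rw [integral_add' ((hL.add hLs).const_mul _) (hT.const_mul _), integral_const_mul,
    integral_const_mul, integral_add' hL hLs, integral_sub_right_eq_self, ← hI]
  -- Both |k| and the tail integral are O(ρ), so |k|² and |k| times the tail integral are O(ρ²).
  set ρ := sqrtRate α ‖k‖ with hρ
  have hρ0 : 0 ≤ ρ := sqrtRate_nonneg (norm_nonneg k)
  have hr : ‖k‖ ≤ 4 * ρ := le_sqrtRate hα0 (norm_nonneg k) hk
  have h2 : ∫ z : Space d, tailKernel α ‖k‖ z ≤ C * ρ := by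
    rcases (norm_nonneg k).eq_or_lt with h0 | h0
    · have : ∀ z : Space d, tailKernel α ‖k‖ z = 0 := by
        intro z
        rw [← h0, tailKernel]
        simp
      simp only [this, integral_zero]
      positivity
    · exact h _ h0
  have h3 : 0 ≤ ∫ z : Space d, tailKernel α ‖k‖ z :=
    integral_nonneg fun z => tailKernel_nonneg (norm_nonneg k) z
  calc A * ‖k‖ ^ 2 * (I + I) + B * ‖k‖ * ∫ z : Space d, tailKernel α ‖k‖ z
      ≤ A * (4 * ρ) ^ 2 * (I + I) + B * (4 * ρ) * (C * ρ) := by gcongr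
    _ = _ := by ring

/-! ### The form with coefficient one and its domain -/

theorem volume_restrict_cell_prod :
    (volume : Measure (Space d × Space d)).restrict (cell d ×ˢ univ) =
      (volume.restrict (cell d)).prod volume := by
  rw [Measure.volume_eq_prod, ← Measure.prod_restrict, Measure.restrict_univ]

/-- The substitution y = x + z followed by Tonelli makes the kernel a function of the outer variable
only. -/
theorem lintegral_cell_prod {F : Space d × Space d → ENNReal} (hF : Measurable F) :
    ∫⁻ p in cell d ×ˢ univ, F p = ∫⁻ z, ∫⁻ x in cell d, F (x, x + z) := by
  rw [volume_restrict_cell_prod, lintegral_prod _ hF.aemeasurable]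
  have h : ∀ x : Space d, ∫⁻ y, F (x, y) = ∫⁻ z, F (x, x + z) := fun x =>
    (lintegral_add_left_eq_self (fun y => F (x, y)) x).symm
  simp only [h]
  exact lintegral_lintegral_swap
    (by fun_prop : Measurable (Function.uncurry fun x z : Space d => F (x, x + z))).aemeasurable

theorem lintegral_cell_wrap_add {g : Space d → ENNReal} (hg : Measurable g) (z : Space d) :
    ∫⁻ x in cell d, g (wrap (x + z)) = ∫⁻ x in cell d, g x :=
  (measurePreserving_wrap_add z).lintegral_comp hg

theorem measurable_coe (u : L2Cell d) : Measurable (u : Space d → ℂ) :=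
  (Lp.stronglyMeasurable u).measurable

@[fun_prop]
theorem measurable_periodicExt (u : L2Cell d) : Measurable (periodicExt (u : Space d → ℂ)) :=
  (measurable_coe u).comp measurable_wrap

@[fun_prop]
theorem measurable_twistedDiff (ξ : Space d) (u : L2Cell d) :
    Measurable (twistedDiff ξ (u : Space d → ℂ)) := by
  have h := measurable_periodicExt u
  unfold twistedDiff
  fun_prop

theorem periodicExt_of_mem (u : Space d → ℂ) {x : Space d} (hx : x ∈ cell d) :
    periodicExt u x = u x := by rw [periodicExt_eq, wrap_of_mem hx]

theorem twistedDiff_eq (ξ : Space d) (u : Space d → ℂ) (p : Space d × Space d) :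
    twistedDiff ξ u p = expi ξ p.1 * periodicExt u p.1 - expi ξ p.2 * periodicExt u p.2 := rfl

theorem twistedDiff_add (ξ : Space d) (u : Space d → ℂ) (x z : Space d) :
    twistedDiff ξ u (x, x + z) =
      expi ξ x * (periodicExt u x - expi ξ z * periodicExt u (x + z)) := by
  rw [twistedDiff_eq, expi_add_right]; ring

theorem norm_twistedDiff_add (ξ : Space d) (u : Space d → ℂ) (x z : Space d) :
    ‖twistedDiff ξ u (x, x + z)‖ = ‖periodicExt u x - expi ξ z * periodicExt u (x + z)‖ := by
  rw [twistedDiff_add, norm_mul, norm_expi, one_mul]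

/-- The integrand of the form with coefficient one. -/
def energyDensity (α : ℝ) (ξ : Space d) (u : Space d → ℂ) (p : Space d × Space d) : ENNReal :=
  ENNReal.ofReal (‖twistedDiff ξ u p‖ ^ 2 / ‖p.1 - p.2‖ ^ ((d : ℝ) + α))

@[fun_prop]
theorem measurable_energyDensity (α : ℝ) (ξ : Space d) (u : L2Cell d) :
    Measurable (energyDensity α ξ (u : Space d → ℂ)) := by
  unfold energyDensity; fun_prop

/-- Twice the form with coefficient one. -/
def energy (α : ℝ) (ξ : Space d) (u : L2Cell d) : ENNReal :=
  ∫⁻ p in cell d ×ˢ univ, energyDensity α ξ (u : Space d → ℂ) p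

theorem energyDensity_add (α : ℝ) (ξ : Space d) (u : Space d → ℂ) (x z : Space d) :
    energyDensity α ξ u (x, x + z) = ENNReal.ofReal (‖z‖ ^ ((d : ℝ) + α))⁻¹ *
      ENNReal.ofReal (‖periodicExt u x - expi ξ z * periodicExt u (x + z)‖ ^ 2) := by
  rw [energyDensity, norm_twistedDiff_add, ← ENNReal.ofReal_mul (by positivity)]
  congr 1
  simp only [sub_add_cancel_left, norm_neg]
  rw [div_eq_inv_mul]

/-- Parseval in x at fixed z produces the factors 2(1 - cos⟨ξ+2πn,z⟩); integrating them against
|z|^{-d-α} gives 2V_α(ξ+2πn). -/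
theorem energy_eq_tsum [NeZero d] {α : ℝ} (hα0 : 0 < α) (hα2 : α < 2) (ξ : Space d)
    (u : L2Cell d) : energy α ξ u =
      ∑' n, ENNReal.ofReal (2 * (V α (ξ + freq n) * ‖inner ℂ (fourierBasis d n) u‖ ^ 2)) := by
  rw [energy, lintegral_cell_prod (by fun_prop)]
  have h1 : ∀ z, ∫⁻ x in cell d, energyDensity α ξ u (x, x + z) =
      ∑' n, ENNReal.ofReal (cosKernel α (ξ + freq n) z) *
        ENNReal.ofReal (2 * ‖inner ℂ (fourierBasis d n) u‖ ^ 2) := by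
    intro z
    have hm : Measurable fun x =>
        ENNReal.ofReal (‖periodicExt u x - expi ξ z * periodicExt u (x + z)‖ ^ 2) := by
      have h := measurable_periodicExt u
      fun_prop
    simp only [energyDensity_add]
    rw [lintegral_const_mul _ hm]
    have h2 : ∫⁻ x in cell d,
        ENNReal.ofReal (‖periodicExt u x - expi ξ z * periodicExt u (x + z)‖ ^ 2) =
        ∫⁻ x in cell d, ENNReal.ofReal (‖u x - expi ξ z * periodicExt u (x + z)‖ ^ 2) :=
      setLIntegral_congr_fun measurableSet_cell fun x hx => by
        simp only [periodicExt_of_mem _ hx]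
    rw [h2, lintegral_twisted_translate, ← ENNReal.tsum_mul_left]
    refine tsum_congr fun n => ?_
    have hc : 0 ≤ 1 - Real.cos (inner ℝ (ξ + freq n) z) := by
      linarith [Real.cos_le_one (inner ℝ (ξ + freq n) z)]
    rw [← mul_assoc, ← ENNReal.ofReal_mul (by positivity), ← ENNReal.ofReal_mul (by positivity),
      ← ENNReal.ofReal_mul (cosKernel_nonneg _ _ _)]
    congr 1
    rw [cosKernel]
    ring
  simp only [h1]
  rw [lintegral_tsum fun n => by fun_prop]
  refine tsum_congr fun n => ?_
  rw [lintegral_mul_const _ (by fun_prop), ← ofReal_integral_eq_lintegral_ofReal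
    (integrable_cosKernel hα0 hα2 _) (Filter.Eventually.of_forall fun z => cosKernel_nonneg _ _ _),
    ← V_eq, ← ENNReal.ofReal_mul (V_nonneg _ _)]
  congr 1
  ring

theorem lintegral_sq_norm_lt_top (u : L2Cell d) :
    ∫⁻ x in cell d, ENNReal.ofReal (‖u x‖ ^ 2) < ⊤ := by
  have := (Lp.memLp u).integrable_norm_pow two_ne_zero
  have h := this.2
  rw [hasFiniteIntegral_iff_norm] at h
  simpa using h

theorem lintegral_sq_norm_periodicExt_add (u : L2Cell d) (z : Space d) :
    ∫⁻ x in cell d, ENNReal.ofReal (‖periodicExt u (x + z)‖ ^ 2) =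
      ∫⁻ x in cell d, ENNReal.ofReal (‖u x‖ ^ 2) := by
  have h := measurable_coe u
  exact lintegral_cell_wrap_add (g := fun x => ENNReal.ofReal (‖u x‖ ^ 2)) (by fun_prop) z

/-- An energy is finite if it is pointwise bounded by another finite quantity and integrable kernels
times the squares of the function. -/
theorem energy_lt_top_of_le {α : ℝ} {ξ : Space d} {u : L2Cell d}
    {G : Space d × Space d → ENNReal} (hG : Measurable G)
    (hGt : ∫⁻ p in cell d ×ˢ univ, G p < ⊤) {κ : Space d → ℝ} (hκm : Measurable κ)
    (hκ : Integrable κ)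
    (hle : ∀ x z, x ∈ cell d → energyDensity α ξ u (x, x + z) ≤ G (x, x + z) +
      ENNReal.ofReal (κ z) * (ENNReal.ofReal (‖u x‖ ^ 2) +
        ENNReal.ofReal (‖periodicExt u (x + z)‖ ^ 2))) : energy α ξ u < ⊤ := by
  rw [lintegral_cell_prod hG] at hGt
  rw [energy, lintegral_cell_prod (by fun_prop)]
  have hu := measurable_coe u
  have hp := measurable_periodicExt u
  set I := ∫⁻ x in cell d, ENNReal.ofReal (‖u x‖ ^ 2) with hI
  have hIt : I < ⊤ := lintegral_sq_norm_lt_top u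
  have h1 : ∀ z, ∫⁻ x in cell d, energyDensity α ξ u (x, x + z) ≤
      (∫⁻ x in cell d, G (x, x + z)) + ENNReal.ofReal (κ z) * (I + I) := by
    intro z
    refine (setLIntegral_mono' measurableSet_cell fun x hx => hle x z hx).trans ?_
    rw [lintegral_add_left (by fun_prop), lintegral_const_mul _ (by fun_prop),
      lintegral_add_left (by fun_prop), lintegral_sq_norm_periodicExt_add]
  refine (lintegral_mono h1).trans_lt ?_
  rw [lintegral_add_right _ (by fun_prop), lintegral_mul_const _ (by fun_prop)]
  refine ENNReal.add_lt_top.2 ⟨hGt, ENNReal.mul_lt_top ?_ (ENNReal.add_lt_top.2 ⟨hIt, hIt⟩)⟩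
  exact (lintegral_mono fun z => ENNReal.ofReal_le_ofReal (le_abs_self (κ z))).trans_lt (by
    have := hκ.2
    rw [hasFiniteIntegral_iff_norm] at this
    exact this)

theorem sq_norm_sub_le (a b c : ℂ) : ‖a - c‖ ^ 2 ≤ 2 * ‖a - b‖ ^ 2 + 2 * ‖b - c‖ ^ 2 := by
  have h := norm_sub_le_norm_sub_add_norm_sub a b c
  have : ‖a - c‖ ^ 2 ≤ (‖a - b‖ + ‖b - c‖) ^ 2 := by gcongr
  nlinarith [sq_nonneg (‖a - b‖ - ‖b - c‖)]

/-- Finiteness of the energy does not depend on the quasimomentum. -/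
theorem energy_lt_top_of_energy_lt_top [NeZero d] {α : ℝ} (hα0 : 0 < α) (hα2 : α < 2)
    (ξ η : Space d) {u : L2Cell d} (h : energy α ξ u < ⊤) : energy α η u < ⊤ := by
  refine energy_lt_top_of_le (G := fun p => ENNReal.ofReal 2 * energyDensity α ξ u p) (by fun_prop) ?_
    (κ := fun z => 4 * cosKernel α (ξ - η) z) (by fun_prop)
    ((integrable_cosKernel hα0 hα2 _).const_mul 4) fun x z _ => ?_
  · rw [lintegral_const_mul _ (by fun_prop)]
    exact ENNReal.mul_lt_top (by simp) h
  · refine le_trans ?_ (add_le_add_right (mul_le_mul_right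
      (le_add_of_nonneg_left zero_le) _) _)
    rw [energyDensity_add, energyDensity_add]
    set c := (‖z‖ ^ ((d : ℝ) + α))⁻¹ with hc
    have hc0 : 0 ≤ c := by positivity
    set v := periodicExt u (x + z)
    rw [← ENNReal.ofReal_mul hc0, ← ENNReal.ofReal_mul hc0,
      ← ENNReal.ofReal_mul (mul_nonneg (by norm_num) (cosKernel_nonneg _ _ _)),
      ← ENNReal.ofReal_mul zero_le_two,
      ← ENNReal.ofReal_add (by positivity) (mul_nonneg (mul_nonneg (by norm_num)
        (cosKernel_nonneg _ _ _)) (by positivity))]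
    refine ENNReal.ofReal_le_ofReal ?_
    -- Changing the phase from ξ to η costs (1 - cos⟨ξ-η,z⟩)|u(x+z)|², whose kernel is integrable in
    -- z, so an L₂ norm pays for it.
    have h1 := sq_norm_sub_le (periodicExt u x) (expi ξ z * v) (expi η z * v)
    have h2 : ‖expi ξ z * v - expi η z * v‖ ^ 2 =
        2 * (1 - Real.cos (inner ℝ (ξ - η) z)) * ‖v‖ ^ 2 := by
      have : expi ξ z * v - expi η z * v = -(expi η z * ((1 - expi (ξ - η) z) * v)) := by
        conv_lhs => rw [← sub_add_cancel ξ η, expi_add_left]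
        ring
      rw [this, norm_neg, norm_mul, norm_mul, norm_expi, one_mul, mul_pow, norm_one_sub_expi_sq]
    rw [h2] at h1
    calc c * ‖periodicExt u x - expi η z * v‖ ^ 2
        ≤ c * (2 * ‖periodicExt u x - expi ξ z * v‖ ^ 2 +
          2 * (2 * (1 - Real.cos (inner ℝ (ξ - η) z)) * ‖v‖ ^ 2)) := by gcongr
      _ = _ := by rw [cosKernel, div_eq_mul_inv, ← hc]; ring

theorem norm_le_of_mem_cell {x : Space d} (hx : x ∈ cell d) : ‖x‖ ≤ √(d : ℝ) := by
  rw [EuclideanSpace.norm_eq]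
  refine Real.sqrt_le_sqrt ?_
  calc ∑ i, ‖x i‖ ^ 2 ≤ ∑ _i : Fin d, (1 : ℝ) := by
        refine Finset.sum_le_sum fun i _ => ?_
        have h := hx i
        rw [Real.norm_eq_abs, sq_abs]
        nlinarith [h.1, h.2]
    _ = d := by simp

/-- The integral of a periodic function over a ball is controlled by that over the cell. -/
theorem lintegral_ball_le (R : ℝ) : ∃ N : ℕ, ∀ G : Space d → ENNReal, Measurable G →
    (∀ n x, G (x + latticeVec n) = G x) →
    ∫⁻ x in Metric.ball 0 R, G x ≤ N * ∫⁻ x in cell d, G x := by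
  -- The cells translated by these lattice vectors cover the ball.
  let S : Finset (Fin d → ℤ) := Fintype.piFinset fun _ => Finset.Icc (-⌈R⌉) ⌈R⌉
  refine ⟨S.card, fun G hG hper => ?_⟩
  have hcov : Metric.ball (0 : Space d) R ⊆ ⋃ n : S, (fun x => x - latticeVec n.1) ⁻¹' cell d := by
    intro x hx
    simp only [mem_iUnion, Subtype.exists, exists_prop]
    refine ⟨fun i => ⌊x i⌋, ?_, ?_⟩
    · rw [Fintype.mem_piFinset]
      intro i
      have hxi : |x i| ≤ R := (PiLp.norm_apply_le x i).trans (by simpa using (mem_ball_zero_iff.1 hx).le)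
      rw [abs_le] at hxi
      rw [Finset.mem_Icc]
      constructor
      · rw [Int.le_floor]
        push_cast
        linarith [Int.le_ceil R]
      · exact (Int.floor_le_floor hxi.2).trans (Int.floor_le_ceil R)
    · have : x - latticeVec (fun i => ⌊x i⌋) = wrap x := by
        ext i; exact Int.self_sub_floor (x i)
      rw [mem_preimage, this]
      exact wrap_mem x
  refine (lintegral_mono_set hcov).trans ?_
  refine (lintegral_iUnion_le _ _).trans ?_
  have : ∀ n : S, ∫⁻ x in (fun x => x - latticeVec n.1) ⁻¹' cell d, G x =
      ∫⁻ x in cell d, G x := by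
    intro n
    have hmp := (measurePreserving_sub_right (volume : Measure (Space d))
      (latticeVec n.1)).restrict_preimage (measurableSet_cell (d := d))
    rw [← hmp.lintegral_comp hG]
    refine lintegral_congr fun x => ?_
    rw [← hper n.1 (x - latticeVec n.1), sub_add_cancel]
  rw [tsum_congr this, tsum_fintype]
  simp

theorem periodicExt_add_latticeVec (u : Space d → ℂ) (x : Space d) (n : Fin d → ℤ) :
    periodicExt u (x + latticeVec n) = periodicExt u x := by
  rw [periodicExt_eq, wrap_add_latticeVec, periodicExt_eq]

theorem energyDensity_zero_eq (α : ℝ) (u : Space d → ℂ) (p : Space d × Space d) :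
    energyDensity α 0 u p = ENNReal.ofReal
      (‖periodicExt u p.1 - periodicExt u p.2‖ ^ 2 / ‖p.1 - p.2‖ ^ ((d : ℝ) + α)) := by
  have : ∀ x : Space d, expi 0 x = 1 := fun x => by simp [expi]
  rw [energyDensity, twistedDiff_eq, this, this, one_mul, one_mul]

/-- The form domain consists of the functions of finite energy. -/
theorem mem_periodicSobolev_iff [NeZero d] {α : ℝ} (hα0 : 0 < α) (hα2 : α < 2)
    (ξ : Space d) (u : L2Cell d) : u ∈ periodicSobolev d (α / 2) ↔ energy α ξ u < ⊤ := by
  have hexp : (d : ℝ) + 2 * (α / 2) = d + α := by ring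
  have hloc : ∀ O : Set (Space d), ∫⁻ p in O ×ˢ O, ENNReal.ofReal
      (‖periodicExt u p.1 - periodicExt u p.2‖ ^ 2 / ‖p.1 - p.2‖ ^ ((d : ℝ) + 2 * (α / 2))) =
      ∫⁻ p in O ×ˢ O, energyDensity α 0 u p := by
    intro O
    refine lintegral_congr fun p => ?_
    rw [energyDensity_zero_eq, hexp]
  have hp := measurable_periodicExt u
  constructor
  · rintro ⟨-, h⟩
    refine energy_lt_top_of_energy_lt_top hα0 hα2 0 ξ ?_
    -- The ball contains the cell and every point at distance at most one from it.
    set R : ℝ := √(d : ℝ) + 2 with hR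
    have hR0 : 0 < R := by positivity
    have h2 := (h R hR0).2
    rw [hloc] at h2
    have hmB : MeasurableSet (Metric.ball (0 : Space d) R ×ˢ Metric.ball (0 : Space d) R) :=
      measurableSet_ball.prod measurableSet_ball
    refine energy_lt_top_of_le
      (G := (Metric.ball (0 : Space d) R ×ˢ Metric.ball (0 : Space d) R).indicator
        (energyDensity α 0 u)) ((measurable_energyDensity α 0 u).indicator hmB) ?_
      (κ := fun z => 2 * levyKernel α z) (by fun_prop)
      ((integrable_levyKernel hα0 hα2).const_mul 2) fun x z hx => ?_
    · rw [lintegral_indicator hmB]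
      exact (lintegral_mono' (Measure.restrict_mono_measure Measure.restrict_le_self _)
        le_rfl).trans_lt h2
    -- Near the diagonal the local Sobolev energy is used; away from it the Lévy kernel is
    -- integrable and the L₂ norm of `u` is enough.
    · rcases le_or_gt ‖z‖ 1 with hz | hz
      · refine le_add_of_le_of_nonneg (le_of_eq ?_) zero_le
        rw [indicator_of_mem]
        have := norm_le_of_mem_cell hx
        constructor
        · simp only [Metric.mem_ball, dist_zero_right]
          linarith
        · simp only [Metric.mem_ball, dist_zero_right]
          linarith [norm_add_le x z]
      · refine le_add_of_nonneg_of_le zero_le ?_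
        rw [energyDensity_add, periodicExt_of_mem _ hx, ← ENNReal.ofReal_add (by positivity)
          (by positivity), ← ENNReal.ofReal_mul (by positivity),
          ← ENNReal.ofReal_mul (mul_nonneg zero_le_two (levyKernel_nonneg _ _)), levyKernel,
          min_eq_left (by nlinarith), one_div]
        refine ENNReal.ofReal_le_ofReal ?_
        have h1 := sq_norm_sub_le (u x) 0 (expi 0 z * periodicExt u (x + z))
        rw [sub_zero, zero_sub, norm_neg, norm_mul, norm_expi, one_mul] at h1
        set c := (‖z‖ ^ ((d : ℝ) + α))⁻¹
        have hc : 0 ≤ c := by positivity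
        calc _ ≤ c * (2 * ‖u x‖ ^ 2 + 2 * ‖periodicExt u (x + z)‖ ^ 2) := by gcongr
          _ = _ := by ring
  · intro h
    have h0 := energy_lt_top_of_energy_lt_top hα0 hα2 ξ 0 h
    refine ⟨⟨Lp.memLp u, ?_⟩, fun R _ => ⟨⟨hp.aestronglyMeasurable, ?_⟩, ?_⟩⟩
    · refine lt_of_le_of_lt ?_ h0
      refine le_trans (le_of_eq ?_) (lintegral_mono_set (prod_mono_right (subset_univ (cell d))))
      refine setLIntegral_congr_fun (measurableSet_cell.prod measurableSet_cell) fun p hp => ?_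
      rw [energyDensity_zero_eq, hexp, periodicExt_of_mem _ hp.1, periodicExt_of_mem _ hp.2]
    · obtain ⟨N, hN⟩ := lintegral_ball_le (d := d) R
      have h1 := hN (fun x => ENNReal.ofReal (‖periodicExt u x‖ ^ 2)) (by fun_prop)
        (fun n x => by rw [periodicExt_add_latticeVec])
      rw [eLpNorm_lt_top_iff_lintegral_rpow_enorm_lt_top two_ne_zero ENNReal.ofNat_ne_top]
      refine lt_of_le_of_lt ?_ (h1.trans_lt (ENNReal.mul_lt_top (by simp) ?_))
      · refine lintegral_mono fun x => le_of_eq ?_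
        simp [ENNReal.ofReal_pow, ofReal_norm]
      · have := lintegral_sq_norm_periodicExt_add u 0
        simp only [add_zero] at this
        rw [this]
        exact lintegral_sq_norm_lt_top u
    · rw [hloc]
      obtain ⟨N, hN⟩ := lintegral_ball_le (d := d) R
      -- Integrated over all y, the density is periodic in x, so the ball in x reduces to finitely
      -- many copies of the cell.
      have h1 := hN (fun x => ∫⁻ y, energyDensity α 0 u (x, y))
        ((measurable_energyDensity α 0 u).lintegral_prod_right') (fun n x => by
          rw [← lintegral_add_right_eq_self _ (latticeVec n)]
          refine lintegral_congr fun y => ?_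
          simp only [energyDensity_zero_eq, periodicExt_add_latticeVec, add_sub_add_right_eq_sub])
      refine (lintegral_mono_set (prod_mono_right (subset_univ _))).trans_lt ?_
      rw [Measure.volume_eq_prod, ← Measure.prod_restrict, Measure.restrict_univ,
        lintegral_prod _ (measurable_energyDensity α 0 u).aemeasurable]
      refine h1.trans_lt (ENNReal.mul_lt_top (by simp) ?_)
      rw [← lintegral_prod _ (measurable_energyDensity α 0 u).aemeasurable,
        ← volume_restrict_cell_prod]
      exact h0

/-! ### The form as a squared norm -/

/-- A coefficient that is measurable, bounded, and periodic in its second variable everywhere. -/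
structure IsRegularCoefficient (μ : Space d × Space d → ℝ) (μm μp : ℝ) : Prop where
  measurable : Measurable μ
  bounds : ∀ p, μm ≤ μ p ∧ μ p ≤ μp
  periodic : ∀ x y (n : Fin d → ℤ), μ (x, y + latticeVec n) = μ (x, y)

/-- The periodic extension of a null set is null, so twisted differences are well defined on classes
of functions modulo null sets. -/
theorem quasiMeasurePreserving_wrap :
    Measure.QuasiMeasurePreserving (wrap (d := d)) volume (volume.restrict (cell d)) := by
  refine ⟨measurable_wrap, Measure.AbsolutelyContinuous.mk fun s hs h0 => ?_⟩
  rw [Measure.map_apply measurable_wrap hs]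
  have hw : MeasurableSet (wrap (d := d) ⁻¹' s) := measurable_wrap hs
  have h1 : ∀ R : ℕ, volume (wrap (d := d) ⁻¹' s ∩ Metric.ball 0 R) = 0 := by
    intro R
    obtain ⟨N, hN⟩ := lintegral_ball_le (d := d) R
    have h2 := hN ((wrap (d := d) ⁻¹' s).indicator 1) (measurable_one.indicator hw) (fun n x => by
      by_cases hx : wrap x ∈ s <;> simp [indicator, wrap_add_latticeVec, hx])
    rw [lintegral_indicator_one hw, Measure.restrict_apply hw] at h2
    have h3 : ∫⁻ x in cell d, (wrap (d := d) ⁻¹' s).indicator 1 x = 0 := by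
      rw [lintegral_indicator_one hw]
      refine measure_mono_null ?_ ((Measure.restrict_apply hs).symm.trans h0) |> fun h => by
        rw [Measure.restrict_apply hw]; exact h
      rintro x ⟨hx, hc⟩
      exact ⟨by rw [mem_preimage, wrap_of_mem hc] at hx; exact hx, hc⟩
    rw [h3, mul_zero] at h2
    exact le_antisymm h2 zero_le
  have h4 : wrap (d := d) ⁻¹' s = ⋃ R : ℕ, wrap (d := d) ⁻¹' s ∩ Metric.ball 0 R := by
    rw [← inter_iUnion, Metric.iUnion_ball_nat, inter_univ]
  rw [h4]
  exact measure_iUnion_null h1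

theorem twistedDiff_congr_ae {f g : Space d → ℂ} (h : f =ᵐ[volume.restrict (cell d)] g)
    (ξ : Space d) : twistedDiff ξ f =ᵐ[volume] twistedDiff ξ g := by
  have h1 := quasiMeasurePreserving_wrap.ae_eq_comp h
  have h2 := (Measure.quasiMeasurePreserving_fst (μ := (volume : Measure (Space d)))
    (ν := (volume : Measure (Space d)))).ae_eq_comp h1
  have h3 := (Measure.quasiMeasurePreserving_snd (μ := (volume : Measure (Space d)))
    (ν := (volume : Measure (Space d)))).ae_eq_comp h1
  rw [Measure.volume_eq_prod]
  filter_upwards [h2, h3] with p a2 a3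
  simp only [Function.comp_apply] at a2 a3
  rw [twistedDiff_eq, twistedDiff_eq, periodicExt_eq, periodicExt_eq, periodicExt_eq,
    periodicExt_eq, a2, a3]

/-- The measure `μ(x,y) dx dy / (2 |x-y|^{d+α})` on `Ω × ℝ^d`. -/
def formMeasure (α : ℝ) (μ : Space d × Space d → ℝ) : Measure (Space d × Space d) :=
  (volume.restrict (cell d ×ˢ univ)).withDensity fun p =>
    ENNReal.ofReal (μ p / (2 * ‖p.1 - p.2‖ ^ ((d : ℝ) + α)))

theorem formMeasure_absolutelyContinuous (α : ℝ) (μ : Space d × Space d → ℝ) :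
    formMeasure α μ ≪ volume :=
  (withDensity_absolutelyContinuous _ _).trans Measure.absolutelyContinuous_restrict

theorem twistedDiff_add_ae (α : ℝ) (μ : Space d × Space d → ℝ) (ξ : Space d) (u v : L2Cell d) :
    twistedDiff ξ ((u + v : L2Cell d) : Space d → ℂ) =ᵐ[formMeasure α μ]
      twistedDiff ξ (u : Space d → ℂ) + twistedDiff ξ (v : Space d → ℂ) := by
  filter_upwards [(formMeasure_absolutelyContinuous α μ).ae_le
    (twistedDiff_congr_ae (Lp.coeFn_add u v) ξ)] with p hp
  rw [hp, Pi.add_apply, twistedDiff_eq, twistedDiff_eq, twistedDiff_eq]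
  simp only [periodicExt_eq, Pi.add_apply]
  ring

theorem twistedDiff_smul_ae (α : ℝ) (μ : Space d × Space d → ℝ) (ξ : Space d) (c : ℂ)
    (u : L2Cell d) :
    twistedDiff ξ ((c • u : L2Cell d) : Space d → ℂ) =ᵐ[formMeasure α μ]
      c • twistedDiff ξ (u : Space d → ℂ) := by
  filter_upwards [(formMeasure_absolutelyContinuous α μ).ae_le
    (twistedDiff_congr_ae (Lp.coeFn_smul c u) ξ)] with p hp
  rw [hp, Pi.smul_apply, twistedDiff_eq, twistedDiff_eq]
  simp only [periodicExt_eq, Pi.smul_apply, smul_eq_mul]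
  ring

/-- The form domain, as a linear subspace. -/
def formDomain (α : ℝ) (μ : Space d × Space d → ℝ) (ξ : Space d) : Submodule ℂ (L2Cell d) where
  carrier := {u | MemLp (twistedDiff ξ (u : Space d → ℂ)) 2 (formMeasure α μ)}
  add_mem' {u v} hu hv := (MemLp.add hu hv).ae_eq (twistedDiff_add_ae α μ ξ u v).symm
  zero_mem' := by
    have h := twistedDiff_smul_ae α μ ξ 0 (0 : L2Cell d)
    rw [zero_smul, zero_smul] at h
    exact MemLp.zero.ae_eq h.symm
  smul_mem' c u hu := (MemLp.const_smul hu c).ae_eq (twistedDiff_smul_ae α μ ξ c u).symm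

theorem mem_formDomain {α : ℝ} {μ : Space d × Space d → ℝ} {ξ : Space d} {u : L2Cell d} :
    u ∈ formDomain α μ ξ ↔ MemLp (twistedDiff ξ (u : Space d → ℂ)) 2 (formMeasure α μ) := Iff.rfl

/-- The linear map whose squared norm is the form. -/
def formMap (α : ℝ) (μ : Space d × Space d → ℝ) (ξ : Space d) :
    formDomain α μ ξ →ₗ[ℂ] Lp ℂ 2 (formMeasure α μ) where
  toFun u := MemLp.toLp _ (mem_formDomain.1 u.2)
  map_add' u v := by
    rw [← MemLp.toLp_add]
    exact MemLp.toLp_congr _ _ (twistedDiff_add_ae α μ ξ u v)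
  map_smul' c u := by
    rw [RingHom.id_apply, ← MemLp.toLp_const_smul]
    exact MemLp.toLp_congr _ _ (twistedDiff_smul_ae α μ ξ c u)

theorem formMap_coe {α : ℝ} {μ : Space d × Space d → ℝ} {ξ : Space d} (u : formDomain α μ ξ) :
    formMap α μ ξ u =ᵐ[formMeasure α μ] twistedDiff ξ ((u : L2Cell d) : Space d → ℂ) :=
  MemLp.coeFn_toLp (mem_formDomain.1 u.2)

theorem ofReal_norm_sq_toLp {X : Type*} [MeasurableSpace X] {ν : Measure X} (f : Lp ℂ 2 ν) :
    ENNReal.ofReal (‖f‖ ^ 2) = ∫⁻ x, ENNReal.ofReal (‖f x‖ ^ 2) ∂ν := by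
  rw [Lp.norm_def, eLpNorm_eq_lintegral_rpow_enorm_toReal two_ne_zero ENNReal.ofNat_ne_top,
    ← ENNReal.toReal_pow, ENNReal.ofReal_toReal]
  · rw [← ENNReal.rpow_natCast, ← ENNReal.rpow_mul]
    simp [ENNReal.ofReal_pow, ofReal_norm]
  · have := (Lp.memLp f).2.ne
    rw [eLpNorm_eq_lintegral_rpow_enorm_toReal two_ne_zero ENNReal.ofNat_ne_top] at this
    exact ENNReal.pow_ne_top this

section Regular

variable {α : ℝ} {μ : Space d × Space d → ℝ} {μm μp : ℝ} {ξ : Space d}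

theorem lintegral_formMeasure (hμ : Measurable μ) {F : Space d × Space d → ENNReal}
    (hF : Measurable F) : ∫⁻ p, F p ∂(formMeasure α μ) = ∫⁻ p in cell d ×ˢ univ,
      ENNReal.ofReal (μ p / (2 * ‖p.1 - p.2‖ ^ ((d : ℝ) + α))) * F p := by
  rw [formMeasure, lintegral_withDensity_eq_lintegral_mul _ (by fun_prop) hF]
  rfl

theorem lintegral_sq_twistedDiff (hμ : Measurable μ) (h0 : ∀ p, 0 ≤ μ p) (u : L2Cell d) :
    ∫⁻ p, ENNReal.ofReal (‖twistedDiff ξ (u : Space d → ℂ) p‖ ^ 2) ∂(formMeasure α μ) =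
      ∫⁻ p in cell d ×ˢ univ, ENNReal.ofReal (μ p / 2) * energyDensity α ξ u p := by
  rw [lintegral_formMeasure hμ (by fun_prop)]
  refine lintegral_congr fun p => ?_
  have := h0 p
  rw [energyDensity, ← ENNReal.ofReal_mul (by positivity), ← ENNReal.ofReal_mul (by positivity)]
  congr 1
  rw [div_mul_div_comm, div_mul_eq_mul_div]

theorem lintegral_sq_twistedDiff_le (hμm : 0 < μm) (hμ : IsRegularCoefficient μ μm μp)
    (u : L2Cell d) :
    ∫⁻ p, ENNReal.ofReal (‖twistedDiff ξ (u : Space d → ℂ) p‖ ^ 2) ∂(formMeasure α μ) ≤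
      ENNReal.ofReal (μp / 2) * energy α ξ u := by
  rw [lintegral_sq_twistedDiff hμ.measurable (fun p => hμm.le.trans (hμ.bounds p).1), energy,
    ← lintegral_const_mul _ (by fun_prop)]
  refine lintegral_mono fun p => ?_
  have := (hμ.bounds p).2
  gcongr

theorem le_lintegral_sq_twistedDiff (hμm : 0 < μm) (hμ : IsRegularCoefficient μ μm μp)
    (u : L2Cell d) : ENNReal.ofReal (μm / 2) * energy α ξ u ≤
    ∫⁻ p, ENNReal.ofReal (‖twistedDiff ξ (u : Space d → ℂ) p‖ ^ 2) ∂(formMeasure α μ) := by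
  rw [lintegral_sq_twistedDiff hμ.measurable (fun p => hμm.le.trans (hμ.bounds p).1), energy,
    ← lintegral_const_mul _ (by fun_prop)]
  refine lintegral_mono fun p => ?_
  have := (hμ.bounds p).1
  gcongr

/-- The two-sided bound on μ makes the domain independent of the coefficient. -/
theorem mem_formDomain_iff (hμm : 0 < μm) (hμ : IsRegularCoefficient μ μm μp) (u : L2Cell d) :
    u ∈ formDomain α μ ξ ↔ energy α ξ u < ⊤ := by
  have h1 : u ∈ formDomain α μ ξ ↔
      ∫⁻ p, ENNReal.ofReal (‖twistedDiff ξ (u : Space d → ℂ) p‖ ^ 2) ∂(formMeasure α μ) < ⊤ := by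
    rw [mem_formDomain, MemLp, and_iff_right (measurable_twistedDiff ξ u).aestronglyMeasurable,
      eLpNorm_lt_top_iff_lintegral_rpow_enorm_lt_top two_ne_zero ENNReal.ofNat_ne_top]
    simp [ENNReal.ofReal_pow, ofReal_norm]
  rw [h1]
  constructor
  · intro h
    have h2 := (le_lintegral_sq_twistedDiff hμm hμ u).trans_lt h
    refine lt_top_iff_ne_top.2 fun h3 => ?_
    rw [h3, ENNReal.mul_top (by simpa using hμm)] at h2
    exact lt_irrefl _ h2
  · intro h
    exact (lintegral_sq_twistedDiff_le hμm hμ u).trans_lt (ENNReal.mul_lt_top (by simp) h)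

theorem ofReal_norm_sq_formMap (u : formDomain α μ ξ) :
    ENNReal.ofReal (‖formMap α μ ξ u‖ ^ 2) =
      ∫⁻ p, ENNReal.ofReal (‖twistedDiff ξ ((u : L2Cell d) : Space d → ℂ) p‖ ^ 2)
        ∂(formMeasure α μ) := by
  rw [ofReal_norm_sq_toLp]
  refine lintegral_congr_ae ?_
  filter_upwards [formMap_coe u] with p hp
  rw [hp]

theorem inner_formMap (hμ : Measurable μ) (h0 : ∀ p, 0 ≤ μ p) (u v : formDomain α μ ξ) :
    inner ℂ (formMap α μ ξ v) (formMap α μ ξ u) = form α μ ξ (u : L2Cell d) v := by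
  have h1 : inner ℂ (formMap α μ ξ v) (formMap α μ ξ u) =
      ∫ p, (twistedDiff ξ ((u : L2Cell d) : Space d → ℂ) p *
        starRingEnd ℂ (twistedDiff ξ ((v : L2Cell d) : Space d → ℂ) p)) ∂(formMeasure α μ) := by
    rw [L2.inner_def]
    refine integral_congr_ae ?_
    filter_upwards [formMap_coe u, formMap_coe v] with p hu hv
    rw [hu, hv, RCLike.inner_apply]
  rw [h1, formMeasure, integral_withDensity_eq_integral_toReal_smul (by fun_prop)
    (Filter.Eventually.of_forall fun p => ENNReal.ofReal_lt_top), form, ← integral_const_mul]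
  refine integral_congr_ae (Filter.Eventually.of_forall fun p => ?_)
  have := h0 p
  simp only
  rw [ENNReal.toReal_ofReal (by positivity), Complex.real_smul]
  push_cast
  ring

theorem tsum_symbol_eq [NeZero d] (hα0 : 0 < α) (hα2 : α < 2) {u : L2Cell d}
    (hu : energy α ξ u < ⊤) :
    (Summable fun n => V α (ξ + freq n) * ‖inner ℂ (fourierBasis d n) u‖ ^ 2) ∧
    energy α ξ u =
      ENNReal.ofReal (2 * ∑' n, V α (ξ + freq n) * ‖inner ℂ (fourierBasis d n) u‖ ^ 2) := by
  have hnn : ∀ n, 0 ≤ 2 * (V α (ξ + freq n) * ‖inner ℂ (fourierBasis d n) u‖ ^ 2) := fun n =>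
    mul_nonneg zero_le_two (mul_nonneg (V_nonneg _ _) (by positivity))
  have h := hu
  rw [energy_eq_tsum hα0 hα2] at h
  have h2 := ENNReal.summable_toReal h.ne
  simp only [ENNReal.toReal_ofReal (hnn _)] at h2
  refine ⟨(summable_mul_left_iff two_ne_zero).1 h2, ?_⟩
  rw [energy_eq_tsum hα0 hα2, ← tsum_mul_left, ENNReal.ofReal_tsum_of_nonneg hnn h2]

theorem energy_lt_top_iff_summable [NeZero d] (hα0 : 0 < α) (hα2 : α < 2) (u : L2Cell d) :
    energy α ξ u < ⊤ ↔
      Summable fun n => V α (ξ + freq n) * ‖inner ℂ (fourierBasis d n) u‖ ^ 2 := by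
  refine ⟨fun h => (tsum_symbol_eq hα0 hα2 h).1, fun h => ?_⟩
  have hnn : ∀ n, 0 ≤ 2 * (V α (ξ + freq n) * ‖inner ℂ (fourierBasis d n) u‖ ^ 2) := fun n =>
    mul_nonneg zero_le_two (mul_nonneg (V_nonneg _ _) (by positivity))
  rw [energy_eq_tsum hα0 hα2, ← ENNReal.ofReal_tsum_of_nonneg hnn (h.mul_left 2)]
  exact ENNReal.ofReal_lt_top

/-- The coefficient is bounded below by its minimum and the rest is diagonal in the Fourier basis;
the factor 2 of the energy cancels the 1/2 of the form. -/
theorem symbol_le_norm_sq_formMap [NeZero d] (hα0 : 0 < α) (hα2 : α < 2) (hμm : 0 < μm)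
    (hμ : IsRegularCoefficient μ μm μp) (u : formDomain α μ ξ) :
    μm * ∑' n, V α (ξ + freq n) * ‖inner ℂ (fourierBasis d n) (u : L2Cell d)‖ ^ 2 ≤
      ‖formMap α μ ξ u‖ ^ 2 := by
  have h1 := le_lintegral_sq_twistedDiff (α := α) (ξ := ξ) hμm hμ u
  rw [← ofReal_norm_sq_formMap, (tsum_symbol_eq hα0 hα2 ((mem_formDomain_iff hμm hμ _).1 u.2)).2,
    ← ENNReal.ofReal_mul (by positivity), ENNReal.ofReal_le_ofReal_iff (by positivity)] at h1
  linarith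

theorem norm_sq_formMap_le_symbol [NeZero d] (hα0 : 0 < α) (hα2 : α < 2) (hμm : 0 < μm)
    (hμ : IsRegularCoefficient μ μm μp) (u : formDomain α μ ξ) :
    ‖formMap α μ ξ u‖ ^ 2 ≤
      μp * ∑' n, V α (ξ + freq n) * ‖inner ℂ (fourierBasis d n) (u : L2Cell d)‖ ^ 2 := by
  have hp : 0 < μp := hμm.trans_le ((hμ.bounds 0).1.trans (hμ.bounds 0).2)
  have h1 := lintegral_sq_twistedDiff_le (α := α) (ξ := ξ) hμm hμ u
  have hnn : 0 ≤ ∑' n, V α (ξ + freq n) * ‖inner ℂ (fourierBasis d n) (u : L2Cell d)‖ ^ 2 :=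
    tsum_nonneg fun n => mul_nonneg (V_nonneg _ _) (by positivity)
  rw [← ofReal_norm_sq_formMap, (tsum_symbol_eq hα0 hα2 ((mem_formDomain_iff hμm hμ _).1 u.2)).2,
    ← ENNReal.ofReal_mul (by positivity), ENNReal.ofReal_le_ofReal_iff (by positivity)] at h1
  linarith

/-- Connects the operator as defined through the Sobolev domain and the Bochner integral with the
abstract setting of squared norms. -/
theorem opGraph_eq_formGraph [NeZero d] (hα0 : 0 < α) (hα2 : α < 2) (hμm : 0 < μm)
    (hμ : IsRegularCoefficient μ μm μp) : opGraph α μ ξ = formGraph (formMap α μ ξ) := by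
  have h0 : ∀ p, 0 ≤ μ p := fun p => hμm.le.trans (hμ.bounds p).1
  have hD : ∀ u, u ∈ periodicSobolev d (α / 2) ↔ u ∈ formDomain α μ ξ := fun u => by
    rw [mem_periodicSobolev_iff hα0 hα2 ξ, mem_formDomain_iff hμm hμ]
  ext ⟨u, g⟩
  constructor
  · rintro ⟨hu, h⟩
    refine ⟨(hD u).1 hu, fun v => ?_⟩
    rw [inner_formMap hμ.measurable h0]
    exact h v ((hD _).2 v.2)
  · rintro ⟨hu, h⟩
    refine ⟨(hD u).2 hu, fun v hv => ?_⟩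
    rw [← h ⟨v, (hD v).1 hv⟩, inner_formMap hμ.measurable h0]

end Regular

/-! ### The symbol -/

theorem one_le_norm_latticeVec {n : Fin d → ℤ} (hn : n ≠ 0) : 1 ≤ ‖(latticeVec n : Space d)‖ := by
  obtain ⟨i, hi⟩ := Function.ne_iff.1 hn
  refine le_trans ?_ (PiLp.norm_apply_le (latticeVec n : Space d) i)
  simp only [latticeVec, Real.norm_eq_abs]
  exact_mod_cast Int.one_le_abs hi

theorem norm_freq (n : Fin d → ℤ) : ‖freq n‖ = 2 * Real.pi * ‖(latticeVec n : Space d)‖ := by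
  rw [freq, norm_smul, Real.norm_of_nonneg (by positivity)]

/-- Nonzero frequencies have length at least 2π, twice the bound on |ξ|. This distance produces the
gap d₀. -/
theorem pi_le_norm_add_freq {ξ : Space d} (hξ : ‖ξ‖ ≤ Real.pi) {n : Fin d → ℤ} (hn : n ≠ 0) :
    Real.pi ≤ ‖ξ + freq n‖ := by
  have h1 := norm_sub_norm_le (freq n) (-ξ)
  rw [norm_neg, sub_neg_eq_add, add_comm (freq n), norm_freq] at h1
  have := one_le_norm_latticeVec hn
  nlinarith [Real.pi_pos]

/-- Growth of the symbol, from which compactness of the resolvent follows. -/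
theorem tendsto_symbol [NeZero d] {α : ℝ} (hα0 : 0 < α) (hα2 : α < 2) (ξ : Space d) :
    Filter.Tendsto (fun n => V α (ξ + freq n)) Filter.cofinite Filter.atTop := by
  have h1 : Filter.Tendsto (fun n : Fin d → ℤ => ‖(latticeVec n : Space d)‖) Filter.cofinite
      Filter.atTop := by
    refine Filter.tendsto_atTop_mono (f := fun n : Fin d → ℤ => ‖n‖) (fun n => ?_) ?_
    · refine (pi_norm_le_iff_of_nonneg (norm_nonneg _)).2 fun i => ?_
      refine le_trans (le_of_eq ?_) (PiLp.norm_apply_le (latticeVec n : Space d) i)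
      simp [latticeVec, Int.norm_eq_abs]
    · rw [← Filter.cocompact_eq_cofinite]
      exact tendsto_norm_cocompact_atTop
  have h2 : Filter.Tendsto (fun n : Fin d → ℤ => ‖ξ + freq n‖) Filter.cofinite Filter.atTop := by
    refine Filter.tendsto_atTop_mono (f := fun n => 2 * Real.pi *
      ‖(latticeVec n : Space d)‖ + -‖ξ‖) (fun n => ?_) ?_
    · have h1 := norm_sub_norm_le (freq n) (-ξ)
      rw [norm_neg, sub_neg_eq_add, add_comm (freq n), norm_freq] at h1
      linarith
    · exact Filter.tendsto_atTop_add_const_right _ _ (h1.const_mul_atTop (by positivity))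
  simp only [V_eq_c0_mul hα0]
  exact ((tendsto_rpow_atTop hα0).comp h2).const_mul_atTop (c0_pos d hα0 hα2)

instance : IsProbabilityMeasure ((volume : Measure (Space d)).restrict (cell d)) := by
  have h := measurePreserving_torusLift (d := d)
  exact ⟨by rw [← h.measure_preimage MeasurableSet.univ.nullMeasurableSet, preimage_univ,
    measure_univ]⟩

/-! ### Regularization of the coefficient -/

theorem latticeVec_zero : (latticeVec (0 : Fin d → ℤ) : Space d) = 0 := by
  ext i; simp [latticeVec]

theorem latticeVec_neg (n : Fin d → ℤ) : (latticeVec (-n) : Space d) = -latticeVec n := by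
  ext i; simp [latticeVec]

/-- A measurable representative is clamped to the interval of admissible values, and its second
argument is then reduced to the cell, which makes periodicity in that variable hold everywhere. -/
theorem IsCoefficient.exists_regular {μ : Space d × Space d → ℝ} {μm μp : ℝ}
    (hμ : IsCoefficient μ μm μp) : ∃ μ', IsRegularCoefficient μ' μm μp ∧ μ =ᵐ[volume] μ' := by
  obtain ⟨p₀, hp₀⟩ := hμ.bounds.exists
  have hle : μm ≤ μp := hp₀.1.trans hp₀.2
  let g : Space d × Space d → ℝ := fun p => max μm (min μp (hμ.aestronglyMeasurable.mk μ p))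
  have hg : Measurable g := by
    have := hμ.aestronglyMeasurable.stronglyMeasurable_mk.measurable
    fun_prop
  have hgμ : g =ᵐ[volume] μ := by
    filter_upwards [hμ.bounds, hμ.aestronglyMeasurable.ae_eq_mk] with p h1 h2
    simp only [g]
    rw [← h2, min_eq_right h1.2, max_eq_right h1.1]
  refine ⟨fun p => g (p.1, wrap p.2), ⟨by fun_prop, fun p => ⟨le_max_left _ _,
    max_le hle (min_le_left _ _)⟩, fun x y n => by simp only [wrap_add_latticeVec]⟩, ?_⟩
  -- The translation that reduces the second argument depends on the point, but there are only
  -- countably many, so the exceptional sets still have null union.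
  have h1 : ∀ n : Fin d → ℤ, ∀ᵐ p : Space d × Space d, g (p.1, p.2 + latticeVec n) = μ p := by
    intro n
    have hq : MeasurePreserving (fun p : Space d × Space d => (p.1, p.2 + latticeVec n))
        volume volume :=
      (MeasurePreserving.id volume).prod (measurePreserving_add_right volume (latticeVec n))
    filter_upwards [hq.quasiMeasurePreserving.ae_eq_comp hgμ, hμ.periodic 0 n] with p a1 a2
    rw [latticeVec_zero, add_zero] at a2
    rw [← a2]
    exact a1
  filter_upwards [ae_all_iff.2 h1] with p hp
  obtain ⟨n, hn⟩ := exists_eq_wrap_add p.2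
  rw [← hp (-n), latticeVec_neg]
  congr 2
  conv_lhs => rw [hn]
  exact add_neg_cancel_right _ _

theorem form_congr {α : ℝ} {μ μ' : Space d × Space d → ℝ} (h : μ =ᵐ[volume] μ') (ξ : Space d)
    (u v : L2Cell d) : form α μ ξ u v = form α μ' ξ u v := by
  unfold form
  congr 1
  refine integral_congr_ae ?_
  filter_upwards [ae_restrict_of_ae h] with p hp
  rw [hp]

theorem opGraph_congr {α : ℝ} {μ μ' : Space d × Space d → ℝ} (h : μ =ᵐ[volume] μ') (ξ : Space d) :
    opGraph α μ ξ = opGraph α μ' ξ := by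
  unfold opGraph
  simp only [form_congr h]

theorem mean_congr {μ μ' : Space d × Space d → ℝ} (h : μ =ᵐ[volume] μ') : mean μ = mean μ' :=
  integral_congr_ae (ae_restrict_of_ae h)

section Regular

variable {α : ℝ} {μ : Space d × Space d → ℝ} {μm μp : ℝ} {ξ : Space d}

/-! ### The form on the constant function -/

theorem inner_fourierBasis_oneCell (n : Fin d → ℤ) :
    inner ℂ (fourierBasis d n) (oneCell d) = if n = 0 then 1 else 0 := by
  rw [← fourierBasis_zero]
  exact orthonormal_iff_ite.1 (fourierBasis d).orthonormal n 0

theorem freq_zero : freq (0 : Fin d → ℤ) = 0 := by rw [freq, latticeVec_zero, smul_zero]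

theorem hasSum_symbol_oneCell (α : ℝ) (ξ : Space d) :
    HasSum (fun n => V α (ξ + freq n) * ‖inner ℂ (fourierBasis d n) (oneCell d)‖ ^ 2) (V α ξ) := by
  have h := hasSum_single (f := fun n => V α (ξ + freq n) *
    ‖inner ℂ (fourierBasis d n) (oneCell d)‖ ^ 2) 0 (fun n hn => by
      rw [inner_fourierBasis_oneCell, if_neg hn]; simp)
  simpa [inner_fourierBasis_oneCell, freq_zero] using h

theorem oneCell_mem_formDomain [NeZero d] (hα0 : 0 < α) (hα2 : α < 2) (hμm : 0 < μm)
    (hμ : IsRegularCoefficient μ μm μp) (ξ : Space d) : oneCell d ∈ formDomain α μ ξ := by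
  rw [mem_formDomain_iff hμm hμ, energy_lt_top_iff_summable hα0 hα2]
  exact (hasSum_symbol_oneCell α ξ).summable

theorem norm_sq_formMap_oneCell_le [NeZero d] (hα0 : 0 < α) (hα2 : α < 2) (hμm : 0 < μm)
    (hμ : IsRegularCoefficient μ μm μp) (h1 : oneCell d ∈ formDomain α μ ξ) :
    ‖formMap α μ ξ ⟨oneCell d, h1⟩‖ ^ 2 ≤ μp * (c0 d α * ‖ξ‖ ^ α) := by
  have h := norm_sq_formMap_le_symbol hα0 hα2 hμm hμ ⟨oneCell d, h1⟩
  rwa [(hasSum_symbol_oneCell α ξ).tsum_eq, V_eq_c0_mul hα0] at h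

/-- Orthogonality to the constant removes the mode n = 0, and every other mode has V_α(ξ+2πn) ≥
c₀π^α. -/
theorem d0_mul_norm_sq_le [NeZero d] (hα0 : 0 < α) (hα2 : α < 2) (hμm : 0 < μm)
    (hμ : IsRegularCoefficient μ μm μp) (hξ : ‖ξ‖ ≤ Real.pi) (v : formDomain α μ ξ)
    (hv : inner ℂ (oneCell d) (v : L2Cell d) = 0) :
    d0 d α μm * ‖(v : L2Cell d)‖ ^ 2 ≤ ‖formMap α μ ξ v‖ ^ 2 := by
  refine le_trans ?_ (symbol_le_norm_sq_formMap hα0 hα2 hμm hμ v)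
  have h1 := ((mem_formDomain_iff hμm hμ _).1 v.2)
  rw [energy_lt_top_iff_summable hα0 hα2] at h1
  rw [d0, mul_assoc, mul_assoc]
  gcongr
  rw [← mul_assoc]
  refine hasSum_le (fun n => ?_)
    (((fourierBasis d).hasSum_norm_inner_sq (v : L2Cell d)).mul_left _) h1.hasSum
  rcases eq_or_ne n 0 with rfl | hn
  · rw [fourierBasis_zero, hv]; simp
  · rw [V_eq_c0_mul hα0]
    have := pi_le_norm_add_freq hξ hn
    have := c0_pos d hα0 hα2
    gcongr

theorem twistedDiff_oneCell_ae (ξ : Space d) :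
    twistedDiff ξ (oneCell d : Space d → ℂ) =ᵐ[volume] fun p => expi ξ p.1 - expi ξ p.2 := by
  have h : (oneCell d : Space d → ℂ) =ᵐ[volume.restrict (cell d)] fun _ => (1 : ℂ) :=
    Lp.coeFn_const 2 (volume.restrict (cell d)) (1 : ℂ)
  filter_upwards [twistedDiff_congr_ae h ξ] with p hp
  rw [hp, twistedDiff_eq]
  simp [periodicExt]

theorem norm_expi_sub_sq (ξ x z : Space d) :
    ‖expi ξ x - expi ξ (x + z)‖ ^ 2 = 2 * (1 - Real.cos (inner ℝ ξ z)) := by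
  rw [← norm_one_sub_expi_sq, expi_add_right, ← mul_one_sub, norm_mul, norm_expi, one_mul]

/-- The form on the constant function, with the kernel shifted by `s`. -/
def shiftedForm (α : ℝ) (μ : Space d × Space d → ℝ) (ξ s : Space d) : ℝ :=
  ∫ p, μ (p.1, p.1 + p.2) * cosKernel α ξ (p.2 - s) ∂((volume.restrict (cell d)).prod volume)

theorem integrable_coeff_mul (hμm : 0 < μm) (hμ : IsRegularCoefficient μ μm μp)
    {X : Type*} [MeasurableSpace X] {ν : Measure X} {f : X → Space d × Space d} (hf : Measurable f)
    {g : X → ℝ} (hg : Integrable g ν) : Integrable (fun x => μ (f x) * g x) ν := by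
  refine hg.bdd_mul (c := μp) (hμ.measurable.comp hf).aestronglyMeasurable
    (Filter.Eventually.of_forall fun x => ?_)
  have := hμ.bounds (f x)
  rw [Real.norm_of_nonneg (hμm.le.trans this.1)]
  exact this.2

/-- The modulus of the phase difference depends only on z = y - x, which turns the form into an
integral of the coefficient against the cosine kernel. -/
theorem norm_sq_formMap_oneCell [NeZero d] (hα0 : 0 < α) (hα2 : α < 2) (hμm : 0 < μm)
    (hμ : IsRegularCoefficient μ μm μp) (h1 : oneCell d ∈ formDomain α μ ξ) :
    ‖formMap α μ ξ ⟨oneCell d, h1⟩‖ ^ 2 = shiftedForm α μ ξ 0 := by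
  have hm := hμ.measurable
  have hnn : ∀ p : Space d × Space d, 0 ≤ μ (p.1, p.1 + p.2) * cosKernel α ξ (p.2 - 0) := fun p =>
    mul_nonneg (hμm.le.trans (hμ.bounds _).1) (cosKernel_nonneg _ _ _)
  have hint : Integrable (fun p : Space d × Space d => μ (p.1, p.1 + p.2) *
      cosKernel α ξ (p.2 - 0)) ((volume.restrict (cell d)).prod volume) := by
    simp only [sub_zero]
    exact integrable_coeff_mul hμm hμ (by fun_prop)
      ((integrable_cosKernel hα0 hα2 ξ).comp_snd _)
  rw [shiftedForm, ← ENNReal.ofReal_eq_ofReal_iff (by positivity) (integral_nonneg hnn),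
    ofReal_integral_eq_lintegral_ofReal hint (Filter.Eventually.of_forall hnn),
    ofReal_norm_sq_formMap,
    lintegral_congr_ae (g := fun p => ENNReal.ofReal (‖expi ξ p.1 - expi ξ p.2‖ ^ 2)) (by
      filter_upwards [(formMeasure_absolutelyContinuous α μ).ae_le (twistedDiff_oneCell_ae ξ)]
        with p hp
      rw [hp]), lintegral_formMeasure hm (by fun_prop), lintegral_cell_prod (by fun_prop),
    lintegral_prod_symm _ (by fun_prop)]
  refine lintegral_congr fun z => lintegral_congr fun x => ?_
  have := hμm.le.trans (hμ.bounds (x, x + z)).1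
  rw [norm_expi_sub_sq, ← ENNReal.ofReal_mul (by positivity)]
  congr 1
  simp only [sub_add_cancel_left, norm_neg, sub_zero, cosKernel]
  rw [div_mul_eq_mul_div, mul_left_comm, mul_div_mul_left _ _ two_ne_zero, mul_div_assoc]

/-- Translating z moves the shift from the kernel to the second argument of the coefficient, where
it can be averaged out. -/
theorem shiftedForm_eq [NeZero d] (hα0 : 0 < α) (hα2 : α < 2) (hμm : 0 < μm)
    (hμ : IsRegularCoefficient μ μm μp) (s : Space d) :
    shiftedForm α μ ξ s = ∫ p, μ (p.1, s + (p.1 + p.2)) * cosKernel α ξ p.2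
      ∂((volume.restrict (cell d)).prod volume) := by
  have hk := integrable_cosKernel hα0 hα2 ξ
  rw [shiftedForm, integral_prod _ (integrable_coeff_mul hμm hμ (by fun_prop)
    ((hk.comp_sub_right s).comp_snd _)), integral_prod _ (integrable_coeff_mul hμm hμ
    (by fun_prop) (hk.comp_snd _))]
  congr 1
  ext x
  simp only
  rw [← integral_add_right_eq_self _ s]
  congr 1
  ext z
  rw [add_sub_cancel_right]
  congr 3
  abel

theorem integral_coeff_shift (hμ : IsRegularCoefficient μ μm μp) (x y : Space d) :
    ∫ s in cell d, μ (x, s + y) = ∫ s in cell d, μ (x, s) := by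
  have hm := hμ.measurable
  have hmp := measurePreserving_wrap_add (d := d) y
  conv_rhs => rw [← hmp.map_eq]
  rw [integral_map hmp.measurable.aemeasurable
    (by fun_prop : Measurable fun s => μ (x, s)).aestronglyMeasurable]
  congr 1
  ext s
  obtain ⟨n, hn⟩ := exists_eq_wrap_add (s + y)
  conv_lhs => rw [hn]
  exact hμ.periodic _ _ _

/-- Averaging over s ∈ Ω replaces μ(x, ·) by its mean over a period, which no longer involves z; the
double integral then factorizes. -/
theorem integral_shiftedForm [NeZero d] (hα0 : 0 < α) (hα2 : α < 2) (hμm : 0 < μm)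
    (hμ : IsRegularCoefficient μ μm μp) :
    IntegrableOn (shiftedForm α μ ξ) (cell d) ∧
      ∫ s in cell d, shiftedForm α μ ξ s = mean μ * V α ξ := by
  have hk := integrable_cosKernel hα0 hα2 ξ
  have hm := hμ.measurable
  let F : Space d → Space d × Space d → ℝ := fun s p =>
    μ (p.1, s + (p.1 + p.2)) * cosKernel α ξ p.2
  have hF : Integrable (Function.uncurry F) ((volume.restrict (cell d)).prod
      ((volume.restrict (cell d)).prod volume)) :=
    integrable_coeff_mul hμm hμ (f := fun q : Space d × Space d × Space d =>
      (q.2.1, q.1 + (q.2.1 + q.2.2))) (by fun_prop) ((hk.comp_snd _).comp_snd _)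
  have hS : shiftedForm α μ ξ = fun s => ∫ p, F s p ∂((volume.restrict (cell d)).prod volume) := by
    ext s; exact shiftedForm_eq hα0 hα2 hμm hμ s
  rw [hS]
  refine ⟨hF.integral_prod_left, ?_⟩
  rw [integral_integral_swap hF]
  have h1 : ∀ p : Space d × Space d, ∫ s in cell d, F s p =
      (∫ s in cell d, μ (p.1, s)) * cosKernel α ξ p.2 := by
    intro p
    simp only [F]
    rw [integral_mul_const, integral_coeff_shift hμ]
  simp only [h1]
  rw [integral_prod_mul (fun x => ∫ s in cell d, μ (x, s)) (cosKernel α ξ), ← V_eq, mean]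
  congr 1
  rw [Measure.volume_eq_prod, setIntegral_prod]
  have : Integrable (fun p : Space d × Space d => μ p * 1)
      ((volume.restrict (cell d)).prod (volume.restrict (cell d))) :=
    integrable_coeff_mul hμm hμ measurable_id (integrable_const _)
  simp only [mul_one] at this
  rwa [IntegrableOn, ← Measure.prod_restrict]

theorem abs_shiftedForm_sub_le [NeZero d] (hα0 : 0 < α) (hα2 : α < 2) (hμm : 0 < μm)
    (hμ : IsRegularCoefficient μ μm μp) (s : Space d) :
    |shiftedForm α μ ξ 0 - shiftedForm α μ ξ s| ≤
      μp * ∫ z, |cosKernel α ξ z - cosKernel α ξ (z - s)| := by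
  have hk := integrable_cosKernel hα0 hα2 ξ
  have i1 : Integrable (fun p : Space d × Space d => μ (p.1, p.1 + p.2) * cosKernel α ξ (p.2 - 0))
      ((volume.restrict (cell d)).prod volume) :=
    integrable_coeff_mul hμm hμ (by fun_prop) ((hk.comp_sub_right 0).comp_snd _)
  have i2 : Integrable (fun p : Space d × Space d => μ (p.1, p.1 + p.2) * cosKernel α ξ (p.2 - s))
      ((volume.restrict (cell d)).prod volume) :=
    integrable_coeff_mul hμm hμ (by fun_prop) ((hk.comp_sub_right s).comp_snd _)
  have i3 : Integrable (fun z => |cosKernel α ξ z - cosKernel α ξ (z - s)|) :=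
    (hk.sub (hk.comp_sub_right s)).abs
  rw [shiftedForm, shiftedForm, ← integral_sub i1 i2]
  refine (abs_integral_le_integral_abs).trans ?_
  have i4 : Integrable (fun p : Space d × Space d =>
      μp * |cosKernel α ξ p.2 - cosKernel α ξ (p.2 - s)|)
      ((volume.restrict (cell d)).prod volume) := (i3.comp_snd _).const_mul μp
  refine (integral_mono (i1.sub i2).abs i4 fun p => ?_).trans_eq ?_
  · have := hμ.bounds (p.1, p.1 + p.2)
    simp only [Pi.sub_apply]
    rw [sub_zero, ← mul_sub, abs_mul, abs_of_nonneg (hμm.le.trans this.1)]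
    gcongr
    exact this.2
  · rw [integral_const_mul, integral_fun_snd (fun z => |cosKernel α ξ z - cosKernel α ξ (z - s)|)]
    simp

/-- The form on the constant function is close to `μ⁰ V_α(ξ)`. -/
theorem exists_abs_norm_sq_sub_le (d : ℕ) [NeZero d] {α : ℝ} (hα0 : 0 < α) (hα2 : α < 2) :
    ∃ C, 0 < C ∧ ∀ (μ : Space d × Space d → ℝ) (μm μp : ℝ) (ξ : Space d), 0 < μm →
      IsRegularCoefficient μ μm μp → ‖ξ‖ ≤ 4 → ∀ h1 : oneCell d ∈ formDomain α μ ξ,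
      |‖formMap α μ ξ ⟨oneCell d, h1⟩‖ ^ 2 - mean μ * V α ξ| ≤
        μp * C * sqrtRate α ‖ξ‖ ^ 2 := by
  -- Shifts range over the cell, so their norms are at most √d.
  have hd : (1 : ℝ) ≤ √(d : ℝ) := Real.one_le_sqrt.2 (by exact_mod_cast NeZero.one_le)
  obtain ⟨C, hC, h⟩ := integral_abs_cosKernel_sub_le d hα0 hα2 hd
  refine ⟨C, hC, fun μ μm μp ξ hμm hμ hξ h1 => ?_⟩
  have hp : 0 < μp := hμm.trans_le ((hμ.bounds 0).1.trans (hμ.bounds 0).2)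
  obtain ⟨hi, he⟩ := integral_shiftedForm (ξ := ξ) hα0 hα2 hμm hμ
  rw [norm_sq_formMap_oneCell hα0 hα2 hμm hμ, ← he]
  -- The cell has measure one, so the unshifted value can be written as an average and compared with
  -- the shifted ones under the integral.
  have h2 : shiftedForm α μ ξ 0 = ∫ _s in cell d, shiftedForm α μ ξ 0 := by simp
  rw [h2, ← integral_sub (integrable_const _) hi]
  have h3 := norm_integral_le_of_norm_le_const (μ := volume.restrict (cell d))
    (f := fun s => shiftedForm α μ ξ 0 - shiftedForm α μ ξ s) (C := μp * C * sqrtRate α ‖ξ‖ ^ 2) (by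
      filter_upwards [ae_restrict_mem measurableSet_cell] with s hs
      refine (abs_shiftedForm_sub_le hα0 hα2 hμm hμ s).trans ?_
      rw [mul_assoc]
      gcongr
      exact h ξ s hξ (norm_le_of_mem_cell hs))
  simpa using h3

end Regular

/-! ### The form between the constant function and an arbitrary function -/

theorem lintegral_mul_le_of_sq_le {X : Type*} [MeasurableSpace X] {ν : Measure X}
    {f g : X → ENNReal} (hf : AEMeasurable f ν) (hg : AEMeasurable g ν) {a b : ℝ} (ha : 0 ≤ a)
    (hb : 0 ≤ b) (hfa : ∫⁻ x, f x ^ 2 ∂ν ≤ ENNReal.ofReal (a ^ 2))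
    (hgb : ∫⁻ x, g x ^ 2 ∂ν ≤ ENNReal.ofReal (b ^ 2)) :
    ∫⁻ x, f x * g x ∂ν ≤ ENNReal.ofReal (a * b) := by
  have h := ENNReal.lintegral_mul_le_Lp_mul_Lq ν Real.HolderConjugate.two_two hf hg
  simp only [Pi.mul_apply, ENNReal.rpow_two] at h
  have hs : ∀ c : ℝ, 0 ≤ c → ENNReal.ofReal (c ^ 2) ^ (1 / 2 : ℝ) = ENNReal.ofReal c := by
    intro c hc
    rw [ENNReal.ofReal_rpow_of_nonneg (by positivity) (by norm_num), ← Real.sqrt_eq_rpow,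
      Real.sqrt_sq hc]
  refine h.trans ?_
  rw [ENNReal.ofReal_mul ha, ← hs a ha, ← hs b hb]
  gcongr

theorem norm_one_sub_expi_le (ξ z : Space d) : ‖1 - expi ξ z‖ ≤ min 2 (‖ξ‖ * ‖z‖) := by
  refine le_min ?_ ?_
  · refine (norm_sub_le _ _).trans ?_
    rw [norm_expi, norm_one]
    norm_num
  · refine le_of_sq_le_sq ?_ (by positivity)
    rw [norm_one_sub_expi_sq, mul_pow]
    linarith [one_sub_cos_le (inner ℝ ξ z), inner_sq_le ξ z]

theorem lintegral_enorm_le_norm (v : L2Cell d) : ∫⁻ x in cell d, ‖v x‖ₑ ≤ ENNReal.ofReal ‖v‖ := by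
  rw [← eLpNorm_one_eq_lintegral_enorm, Lp.norm_def, ENNReal.ofReal_toReal (Lp.eLpNorm_ne_top v)]
  exact eLpNorm_le_eLpNorm_of_exponent_le one_le_two (Lp.aestronglyMeasurable v)

theorem lintegral_enorm_periodicExt_add_le (v : L2Cell d) (z : Space d) :
    ∫⁻ x in cell d, ‖periodicExt (v : Space d → ℂ) (x + z)‖ₑ ≤ ENNReal.ofReal ‖v‖ := by
  simp only [periodicExt_eq]
  rw [lintegral_cell_wrap_add (measurable_coe v).enorm]
  exact lintegral_enorm_le_norm v

section Regular

variable {α : ℝ} {μ : Space d × Space d → ℝ} {μm μp : ℝ} {ξ : Space d}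

/-- For |x - y| ≤ 1 the phase difference is at most |ξ||x - y|, and |z|^{2-d-α} is integrable at
zero. This is the factor of the constant function in Cauchy–Schwarz, of the full order |ξ|. -/
theorem lintegral_near_le [NeZero d] (hα0 : 0 < α) (hα2 : α < 2) (hμm : 0 < μm)
    (hμ : IsRegularCoefficient μ μm μp) (ξ : Space d) :
    ∫⁻ p, ({p : Space d × Space d | ‖p.1 - p.2‖ ≤ 1}.indicator
        (fun p => ‖expi ξ p.1 - expi ξ p.2‖ₑ) p) ^ 2 ∂(formMeasure α μ) ≤
      ENNReal.ofReal (μp * (∫ z : Space d, levyKernel α z) * ‖ξ‖ ^ 2) := by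
  have hp : 0 < μp := hμm.trans_le ((hμ.bounds 0).1.trans (hμ.bounds 0).2)
  have hA : MeasurableSet {p : Space d × Space d | ‖p.1 - p.2‖ ≤ 1} :=
    measurableSet_le (by fun_prop) measurable_const
  have hi := Measurable.indicator (f := fun p : Space d × Space d =>
    ‖expi ξ p.1 - expi ξ p.2‖ₑ) (by fun_prop) hA
  have hm := hμ.measurable
  rw [lintegral_formMeasure hm (by fun_prop), lintegral_cell_prod (by fun_prop)]
  have hL := integrable_levyKernel (d := d) hα0 hα2
  calc _ ≤ ∫⁻ z : Space d, ∫⁻ _x in cell d,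
        ENNReal.ofReal (μp * ‖ξ‖ ^ 2 * levyKernel α z) := by
        refine lintegral_mono fun z => lintegral_mono fun x => ?_
        by_cases hz : ‖z‖ ≤ 1
        · have h1 := hμ.bounds (x, x + z)
          rw [indicator_of_mem (by simpa using hz), ← ofReal_norm, ← ENNReal.ofReal_pow
            (norm_nonneg _), norm_expi_sub_sq, ← ENNReal.ofReal_mul
            (div_nonneg (hμm.le.trans h1.1) (by positivity))]
          refine ENNReal.ofReal_le_ofReal ?_
          simp only [sub_add_cancel_left, norm_neg]
          have h2 := cosKernel_le_of_norm_le α le_rfl ξ hz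
          have h3 := levyKernel_nonneg α z
          calc _ = μ (x, x + z) * cosKernel α ξ z := by
                rw [cosKernel, div_mul_eq_mul_div, mul_left_comm, mul_div_mul_left _ _ two_ne_zero,
                  mul_div_assoc]
            _ ≤ μp * (1 ^ 2 / 2 * ‖ξ‖ ^ 2 * levyKernel α z) :=
                mul_le_mul h1.2 h2 (cosKernel_nonneg _ _ _) hp.le
            _ ≤ _ := by
                have : 0 ≤ μp * (‖ξ‖ ^ 2 * levyKernel α z) := by positivity
                linarith
        · rw [indicator_of_notMem (by simpa using hz)]
          simp
    _ = _ := by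
        simp only [lintegral_const, measure_univ, mul_one]
        rw [← ofReal_integral_eq_lintegral_ofReal (hL.const_mul _) (Filter.Eventually.of_forall
          fun z => mul_nonneg (by positivity) (levyKernel_nonneg α z)), integral_const_mul]
        congr 1
        ring

/-- Away from the diagonal no cancellation in v is needed: |v(x)| + |v(y)| bounds its twisted
difference, its L₁ norm over the cell is at most ‖v‖, and the phase difference is left to the tail
kernel. -/
theorem lintegral_far_le [NeZero d] (hα0 : 0 < α) (hα2 : α < 2) (hμm : 0 < μm)
    (hμ : IsRegularCoefficient μ μm μp) (ξ : Space d) (v : L2Cell d) :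
    ∫⁻ p in {p : Space d × Space d | ‖p.1 - p.2‖ ≤ 1}ᶜ, ‖twistedDiff ξ (v : Space d → ℂ) p‖ₑ *
        ‖expi ξ p.1 - expi ξ p.2‖ₑ ∂(formMeasure α μ) ≤
      ENNReal.ofReal (μp * (∫ z : Space d, tailKernel α ‖ξ‖ z) * ‖v‖) := by
  have hp : 0 < μp := hμm.trans_le ((hμ.bounds 0).1.trans (hμ.bounds 0).2)
  have hA : MeasurableSet {p : Space d × Space d | ‖p.1 - p.2‖ ≤ 1}ᶜ :=
    (measurableSet_le (by fun_prop) measurable_const).compl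
  have hF : Measurable fun p : Space d × Space d => ‖twistedDiff ξ (v : Space d → ℂ) p‖ₑ *
    ‖expi ξ p.1 - expi ξ p.2‖ₑ := by fun_prop
  have hi := hF.indicator hA
  have hm := hμ.measurable
  have hv := measurable_periodicExt v
  rw [← lintegral_indicator hA, lintegral_formMeasure hm (by fun_prop),
    lintegral_cell_prod (by fun_prop)]
  have hL := integrable_tailKernel (d := d) hα0 hα2 (norm_nonneg ξ)
  calc _ ≤ ∫⁻ z : Space d, ∫⁻ x in cell d, ENNReal.ofReal (μp / 2 * tailKernel α ‖ξ‖ z) *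
        (‖periodicExt (v : Space d → ℂ) (x + 0)‖ₑ +
          ‖periodicExt (v : Space d → ℂ) (x + z)‖ₑ) := by
        refine lintegral_mono fun z => lintegral_mono fun x => ?_
        by_cases hz : ‖z‖ ≤ 1
        · rw [indicator_of_notMem (by simpa using hz)]
          simp
        · have h1 := hμ.bounds (x, x + z)
          have h0 := hμm.le.trans h1.1
          rw [indicator_of_mem (by simpa using hz), ← ofReal_norm, ← ofReal_norm, ← ofReal_norm,
            ← ofReal_norm, ← ENNReal.ofReal_add (norm_nonneg _) (norm_nonneg _),
            ← ENNReal.ofReal_mul (norm_nonneg _), ← ENNReal.ofReal_mul (by positivity),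
            ← ENNReal.ofReal_mul (mul_nonneg (by positivity) (tailKernel_nonneg (norm_nonneg _) _))]
          refine ENNReal.ofReal_le_ofReal ?_
          simp only [sub_add_cancel_left, norm_neg, add_zero]
          have h2 : ‖expi ξ x - expi ξ (x + z)‖ ≤ min 2 (‖ξ‖ * ‖z‖) := by
            rw [expi_add_right, ← mul_one_sub, norm_mul, norm_expi, one_mul]
            exact norm_one_sub_expi_le ξ z
          have h3 : ‖twistedDiff ξ (v : Space d → ℂ) (x, x + z)‖ ≤
              ‖periodicExt (v : Space d → ℂ) x‖ + ‖periodicExt (v : Space d → ℂ) (x + z)‖ := by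
            rw [norm_twistedDiff_add]
            refine (norm_sub_le _ _).trans_eq ?_
            rw [norm_mul, norm_expi, one_mul]
          rw [tailKernel, if_pos (not_le.1 hz)]
          calc _ ≤ μp / (2 * ‖z‖ ^ ((d : ℝ) + α)) * ((‖periodicExt (v : Space d → ℂ) x‖ +
                ‖periodicExt (v : Space d → ℂ) (x + z)‖) * min 2 (‖ξ‖ * ‖z‖)) := by
                gcongr
                exact h1.2
            _ = _ := by ring
    _ ≤ ∫⁻ z : Space d, ENNReal.ofReal (μp / 2 * tailKernel α ‖ξ‖ z) *
        (ENNReal.ofReal ‖v‖ + ENNReal.ofReal ‖v‖) := by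
        refine lintegral_mono fun z => ?_
        rw [lintegral_const_mul _ (by fun_prop), lintegral_add_left (by fun_prop)]
        gcongr
        · exact lintegral_enorm_periodicExt_add_le v 0
        · exact lintegral_enorm_periodicExt_add_le v z
    _ = _ := by
        rw [lintegral_mul_const _ (by fun_prop), ← ofReal_integral_eq_lintegral_ofReal
          (hL.const_mul _) (Filter.Eventually.of_forall fun z => mul_nonneg (by positivity)
          (tailKernel_nonneg (norm_nonneg _) z)), integral_const_mul, ← ENNReal.ofReal_add
          (norm_nonneg _) (norm_nonneg _), ← ENNReal.ofReal_mul (mul_nonneg (by positivity)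
          (integral_nonneg fun z => tailKernel_nonneg (norm_nonneg _) z))]
        congr 1
        ring

/-- Cauchy–Schwarz is applied only near the diagonal; applied everywhere, it would give the weaker
order |ξ|^{α/2} of the norm of the constant function. -/
theorem norm_inner_formMap_oneCell_le [NeZero d] (hα0 : 0 < α) (hα2 : α < 2) (hμm : 0 < μm)
    (hμ : IsRegularCoefficient μ μm μp) (h1 : oneCell d ∈ formDomain α μ ξ)
    (v : formDomain α μ ξ) :
    ‖inner ℂ (formMap α μ ξ v) (formMap α μ ξ ⟨oneCell d, h1⟩)‖ ≤
      ‖formMap α μ ξ v‖ * (√(μp * ∫ z : Space d, levyKernel α z) * ‖ξ‖) +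
        μp * (∫ z : Space d, tailKernel α ‖ξ‖ z) * ‖(v : L2Cell d)‖ := by
  have hp : 0 < μp := hμm.trans_le ((hμ.bounds 0).1.trans (hμ.bounds 0).2)
  have hA : MeasurableSet {p : Space d × Space d | ‖p.1 - p.2‖ ≤ 1} :=
    measurableSet_le (by fun_prop) measurable_const
  have hL : 0 ≤ ∫ z : Space d, levyKernel α z := integral_nonneg fun z => levyKernel_nonneg α z
  have hJ : 0 ≤ ∫ z : Space d, tailKernel α ‖ξ‖ z :=
    integral_nonneg fun z => tailKernel_nonneg (norm_nonneg _) z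
  rw [← ENNReal.ofReal_le_ofReal_iff (by positivity),
    ENNReal.ofReal_add (by positivity) (by positivity), ofReal_norm, L2.inner_def]
  refine (enorm_integral_le_lintegral_enorm _).trans ?_
  rw [lintegral_congr_ae (g := fun p => ‖twistedDiff ξ ((v : L2Cell d) : Space d → ℂ) p‖ₑ *
    ‖expi ξ p.1 - expi ξ p.2‖ₑ) (by
      filter_upwards [formMap_coe v, formMap_coe ⟨oneCell d, h1⟩,
        (formMeasure_absolutelyContinuous α μ).ae_le (twistedDiff_oneCell_ae ξ)] with p a1 a2 a3
      rw [a1, a2, a3, RCLike.inner_apply, enorm_mul, RCLike.enorm_conj, mul_comm]),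
    ← lintegral_add_compl _ hA]
  refine add_le_add ?_ (lintegral_far_le hα0 hα2 hμm hμ ξ _)
  have h2 := lintegral_mul_le_of_sq_le (ν := formMeasure α μ)
    (f := fun p => ‖twistedDiff ξ ((v : L2Cell d) : Space d → ℂ) p‖ₑ)
    (g := {p : Space d × Space d | ‖p.1 - p.2‖ ≤ 1}.indicator
        (fun p => ‖expi ξ p.1 - expi ξ p.2‖ₑ)) (a := ‖formMap α μ ξ v‖)
    (b := √(μp * ∫ z : Space d, levyKernel α z) * ‖ξ‖) (by fun_prop)
    ((by fun_prop : Measurable fun p : Space d × Space d =>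
      ‖expi ξ p.1 - expi ξ p.2‖ₑ).indicator hA).aemeasurable (norm_nonneg _) (by positivity)
    (by
      rw [ofReal_norm_sq_formMap]
      simp only [ENNReal.ofReal_pow (norm_nonneg _), ofReal_norm]
      exact le_rfl)
    (by
      rw [mul_pow, Real.sq_sqrt (by positivity)]
      exact lintegral_near_le hα0 hα2 hμm hμ ξ)
  refine le_trans (le_of_eq ?_) h2
  rw [← lintegral_indicator hA]
  refine lintegral_congr fun p => ?_
  by_cases hpA : p ∈ {p : Space d × Space d | ‖p.1 - p.2‖ ≤ 1}
  · rw [indicator_of_mem hpA, indicator_of_mem hpA]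
  · rw [indicator_of_notMem hpA, indicator_of_notMem hpA, mul_zero]

end Regular

/-- The weak coupling required by the threshold approximation, with a constant chosen before the
coefficient and the quasimomentum. -/
theorem exists_norm_inner_formMap_oneCell_le (d : ℕ) [NeZero d] {α : ℝ} (hα0 : 0 < α)
    (hα2 : α < 2) (μp : ℝ) :
    ∃ C, 0 ≤ C ∧ ∀ (μ : Space d × Space d → ℝ) (μm : ℝ) (ξ : Space d), 0 < μm →
      IsRegularCoefficient μ μm μp → ‖ξ‖ ≤ 4 → ∀ (h1 : oneCell d ∈ formDomain α μ ξ)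
      (v : formDomain α μ ξ),
      ‖inner ℂ (formMap α μ ξ v) (formMap α μ ξ ⟨oneCell d, h1⟩)‖ ≤
        C * sqrtRate α ‖ξ‖ * (‖formMap α μ ξ v‖ + ‖(v : L2Cell d)‖) := by
  obtain ⟨C, hC, h⟩ := integral_tailKernel_le d hα0
  set L := √(μp * ∫ z : Space d, levyKernel α z) with hLdef
  have hL : 0 ≤ L := Real.sqrt_nonneg _
  refine ⟨L * 4 + |μp| * C, by positivity, fun μ μm ξ hμm hμ hξ h1 v => ?_⟩
  refine (norm_inner_formMap_oneCell_le hα0 hα2 hμm hμ h1 v).trans ?_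
  have hp : 0 < μp := hμm.trans_le ((hμ.bounds 0).1.trans (hμ.bounds 0).2)
  have hs := sqrtRate_nonneg (α := α) (norm_nonneg ξ)
  have h2 := le_sqrtRate hα0 (norm_nonneg ξ) hξ
  have h3 : ∫ z : Space d, tailKernel α ‖ξ‖ z ≤ C * sqrtRate α ‖ξ‖ := by
    rcases (norm_nonneg ξ).eq_or_lt with h0 | h0
    · rw [← h0] at hs ⊢
      have : ∀ z : Space d, tailKernel α 0 z = 0 := fun z => by simp [tailKernel]
      simp only [this, integral_zero]
      positivity
    · exact h _ h0
  rw [abs_of_pos hp]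
  calc _ ≤ ‖formMap α μ ξ v‖ * (L * (4 * sqrtRate α ‖ξ‖)) +
        μp * (C * sqrtRate α ‖ξ‖) * ‖(v : L2Cell d)‖ := by gcongr
    _ ≤ _ := by
      have h4 : 0 ≤ μp * C * sqrtRate α ‖ξ‖ * ‖formMap α μ ξ v‖ := by positivity
      have h5 : 0 ≤ L * 4 * sqrtRate α ‖ξ‖ * ‖(v : L2Cell d)‖ := by positivity
      linarith

/-! ### The threshold estimate -/

theorem d0_pos (d : ℕ) [NeZero d] {α μm : ℝ} (hα0 : 0 < α) (hα2 : α < 2) (hμm : 0 < μm) :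
    0 < d0 d α μm :=
  mul_pos (mul_pos hμm (c0_pos d hα0 hα2)) (Real.rpow_pos_of_pos Real.pi_pos _)

theorem le_pi_of_le_delta0 {α μm μp r : ℝ} (hα0 : 0 < α) (hμm : 0 < μm) (hle : μm ≤ μp)
    (hr : r ≤ delta0 α μm μp) : r ≤ Real.pi := by
  refine hr.trans (mul_le_of_le_one_right Real.pi_pos.le ?_)
  have hp : 0 < μp := hμm.trans_le hle
  refine Real.rpow_le_one (by positivity) ?_ (by positivity)
  rw [div_le_one (by positivity)]
  linarith

/-- δ₀ is the radius at which the upper bound μ₊c₀|ξ|^α for the form on the constant function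
reaches d₀/3. -/
theorem mul_rpow_le_d0_div (d : ℕ) [NeZero d] {α μm μp r : ℝ} (hα0 : 0 < α) (hα2 : α < 2)
    (hμm : 0 < μm) (hle : μm ≤ μp) (hr0 : 0 ≤ r) (hr : r ≤ delta0 α μm μp) :
    μp * (c0 d α * r ^ α) ≤ d0 d α μm / 3 := by
  have hp : 0 < μp := hμm.trans_le hle
  have hc := c0_pos d hα0 hα2
  have h1 : r ^ α ≤ Real.pi ^ α * (μm / (3 * μp)) := by
    refine (Real.rpow_le_rpow hr0 hr hα0.le).trans_eq ?_
    rw [delta0, Real.mul_rpow Real.pi_pos.le (by positivity), ← Real.rpow_mul (by positivity),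
      one_div_mul_cancel hα0.ne', Real.rpow_one]
  calc μp * (c0 d α * r ^ α) ≤ μp * (c0 d α * (Real.pi ^ α * (μm / (3 * μp)))) := by gcongr
    _ = d0 d α μm / 3 := by rw [d0]; field_simp

/-- An eigenbasis of the operator `A(ξ)`. -/
theorem exists_eigenbasis [NeZero d] {α : ℝ} {μ : Space d × Space d → ℝ} {μm μp : ℝ}
    (hα0 : 0 < α) (hα2 : α < 2) (hμm : 0 < μm) (hμ : IsRegularCoefficient μ μm μp) (ξ : Space d) :
    ∃ (ι : Type) (b : HilbertBasis ι ℂ (L2Cell d)) (l : ι → ℝ), (∀ i, 0 ≤ l i) ∧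
      (∀ u g, (u, g) ∈ formGraph (formMap α μ ξ) ↔
        ∀ i, inner ℂ (b i) g = l i * inner ℂ (b i) u) ∧
      ∀ (u : formDomain α μ ξ) κ, 0 ≤ κ → ‖formMap α μ ξ u‖ ^ 2 ≤ κ * ‖(u : L2Cell d)‖ ^ 2 →
        (u : L2Cell d) ≠ 0 → ∃ i, l i ≤ κ := by
  have hp : 0 < μp := hμm.trans_le ((hμ.bounds 0).1.trans (hμ.bounds 0).2)
  exact exists_eigenbasis_of_form (fourierBasis d) (fun n => V_nonneg α _)
    (tendsto_symbol hα0 hα2 ξ)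
    (fun u => by rw [mem_formDomain_iff hμm hμ, energy_lt_top_iff_summable hα0 hα2])
    (formMap α μ ξ) hμm hp.le (symbol_le_norm_sq_formMap hα0 hα2 hμm hμ)
    (norm_sq_formMap_le_symbol hα0 hα2 hμm hμ)

end LevyType

end

/-! ### The main theorem. -/

theorem proposition3p8 (d : ℕ) [NeZero d] (α : ℝ) (hα0 : 0 < α) (hα2 : α < 2)
    (μm μp : ℝ) (hμm : 0 < μm) :
    ∃ C : ℝ, 0 < C ∧
      ∀ μ : LevyType.Space d × LevyType.Space d → ℝ, LevyType.IsCoefficient μ μm μp →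
      ∀ ξ : LevyType.Space d, ‖ξ‖ ≤ LevyType.delta0 α μm μp →
        (∃ E : LevyType.ProjectionMeasure (LevyType.L2Cell d),
          E.IsSpectralMeasureOf (LevyType.opGraph α μ ξ)) ∧
        ∀ E : LevyType.ProjectionMeasure (LevyType.L2Cell d),
          E.IsSpectralMeasureOf (LevyType.opGraph α μ ξ) →
          ∀ u : LevyType.L2Cell d, ∃ f : LevyType.L2Cell d,
            (E.proj (Set.Icc 0 (LevyType.d0 d α μm / 3)) u, f) ∈ LevyType.opGraph α μ ξ ∧
            ‖f - ((LevyType.mean μ * LevyType.V α ξ : ℝ) : ℂ) • LevyType.projOne d u‖ ≤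
              C * LevyType.rate α ‖ξ‖ * ‖u‖ := by
  open LevyType in
  obtain ⟨C₁, hC₁, happ⟩ := exists_norm_inner_formMap_oneCell_le d hα0 hα2 μp
  obtain ⟨C₂, hC₂, hq⟩ := exists_abs_norm_sq_sub_le d hα0 hα2
  have hc := c0_pos d hα0 hα2
  set K := thresholdConst (d0 d α μm) C₁ (μp * C₂) (|μp| * c0 d α * 4) with hK
  -- `K` involves only d, α, μ₋ and μ₊; the absolute value plus one makes the constant positive
  -- without examining the sign of `K`.
  refine ⟨|K| + 1, by positivity, fun μ hμ ξ hξ => ?_⟩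
  -- The graph and the mean depend only on the almost everywhere class of the coefficient, so a
  -- regular representative may be used.
  obtain ⟨μ', hμ', hμμ'⟩ := hμ.exists_regular
  have hle : μm ≤ μp := (hμ'.bounds 0).1.trans (hμ'.bounds 0).2
  have hp : 0 < μp := hμm.trans_le hle
  rw [opGraph_congr hμμ', mean_congr hμμ', opGraph_eq_formGraph hα0 hα2 hμm hμ']
  obtain ⟨ι, b, l, hl, hgr, hex⟩ := exists_eigenbasis hα0 hα2 hμm hμ' ξ
  refine ⟨⟨_, ProjectionMeasure.ofBasis_isSpectralMeasureOf b l hgr⟩, fun E hE u => ?_⟩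
  have hpi := le_pi_of_le_delta0 hα0 hμm hle hξ
  have h4 : ‖ξ‖ ≤ 4 := hpi.trans Real.pi_le_four
  have h1 := oneCell_mem_formDomain hα0 hα2 hμm hμ' ξ
  have hlow := norm_sq_formMap_oneCell_le hα0 hα2 hμm hμ' h1
  have hs := sqrtRate_nonneg (α := α) (norm_nonneg ξ)
  obtain ⟨f, hf, hfu⟩ := threshold_approximation hl hgr hex (d0_pos d hα0 hα2 hμm) hC₁
    (C₃ := |μp| * c0 d α * 4) (by positivity) hs (o := ⟨oneCell d, h1⟩) norm_oneCell
    (fun v hv => d0_mul_norm_sq_le hα0 hα2 hμm hμ' hpi v hv)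
    (happ μ' μm ξ hμm hμ' h4 h1)
    (hlow.trans (mul_rpow_le_d0_div d hα0 hα2 hμm hle (norm_nonneg ξ) hξ))
    -- The same upper bound μ₊c₀|ξ|^α, now read as an O(ρ) bound on the eigenvalue.
    (hlow.trans (by
      rw [abs_of_pos hp, mul_assoc, mul_assoc]
      gcongr
      exact rpow_le_sqrtRate hα0 hα2 (norm_nonneg ξ) h4))
    (hq μ' μm μp ξ hμm hμ' h4 h1) hE u
  refine ⟨f, hf, ?_⟩
  rw [projOne_apply, ← sqrtRate_sq (norm_nonneg ξ)]
  refine hfu.trans ?_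
  gcongr
  linarith [le_abs_self K]
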